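/- **Setting.** Let $P(\boldsymbol\theta)$, $\boldsymbol\theta\in\mathbb R^k$, be a parameterized quantum while-program over finitely many quantum variables, each with a finite-dimensional state space with a computational basis containing $|0\rangle$; let $\mathcal H$ be their joint state space. Programs are generated by $\mathbf{skip}$; $q:=|0\rangle$; $\bar q:=\sigma$ (reset the register $\bar q$ to the density operator $\sigma$); $\bar q:=U[\bar q]$ ($U$ unitary); $\bar q:=e^{-i\theta'\sigma}[\bar q]$ ($\sigma$ a density operator on $\bar q$, $\theta'$ one of the parameters); $P_1;P_2$; $\mathbf{if}\,(\square m\cdot M[\bar q]=m\to P_m)\,\mathbf{fi}$ ($M$ a finite measurement); $\mathbf{while}\ M[\bar q]=1\ \mathbf{do}\ Q\ \mathbf{od}$ ($M=\{M_0,M_1\}$ a measurement). The semantics $[\![P(\boldsymbol\theta)]\!]$ is the usual superoperator on partial density operators (positive semidefinite, trace $\le 1$), with $[\![\mathbf{while}\ M[\bar q]=1\ \mathbf{do}\ Q\ \mathbf{od}]\!](\rho)=\bigsqcup_n\sum_{l\le n}\mathcal E_0\circ([\![Q]\!]\circ\mathcal E_1)^l(\rho)$, where $\mathcal E_a(\rho)=M_a\rho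 M_a^\dagger$ and $\bigsqcup$ is the least upper bound in the Löwner order. A program terminates almost surely if its semantics preserves the trace of every partial density operator. For a parameter $\theta$, the running count $RC_\theta$ is $1$ on $\bar q:=e^{-i\theta\sigma}[\bar q]$, $0$ on the other atomic statements, adds over $P_1;P_2$, is the maximum over the branches of an $\mathbf{if}$, and for a loop equals that of its body; the loop count $LC$ is the number of while-statements. Let $\mu$ be a probability distribution on $\{1,2,\dots\}$ with $\mu(j)>0$ for all $j$ and $\lim_{n\to\infty}\mu(n)^{1/n}=1$. Introduce fresh variables: qubits $q_1,q_2$, a variable $q_c$ with orthonormal basis $\{|n\rangle:n\in\mathbb Z\}$, and a copy $q'$ of each program variable $q$ (so each register $\bar q$ has a copy $\bar q'$). Let $C=\sum_n|n+1\rangle\langle n|$; let $GP$ act on $q_c,q_2$ as $\sum_{j\ge1}|j\rangle\langle j|\otimes R_y(2\arcsin\sqrt{b_j})$, and as the identity on $|j\rangle$ with $j\le 0$, where $b_j=\mu(j)/(1-\sum_{l<j}\mu(l))$ and $R_y(\varphi)=e^{-i\varphi Y/2}$; let $AS=|0\rangle\langle0|\otimes e^{-i\frac\pi4S}+|1\rangle\langle1|\otimes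 e^{i\frac\pi4S}$ on $q_2,\bar q,\bar q'$, with $S$ the SWAP of $\bar q$ and $\bar q'$; and let $X,Z$ be Pauli operators. The transform $T_\theta$ commutes with the program constructors, fixes the atomic statements other than $\bar q:=e^{-i\theta\sigma}[\bar q]$, and sends the latter to the following: measure $q_1,q_2$ with $\{|00\rangle\langle00|,\ |01\rangle\langle01|,\ |10\rangle\langle10|+|11\rangle\langle11|\}$; on the first outcome run $q_c:=C[q_c];\ q_c,q_2:=GP[q_c,q_2]$; on the second run $q_1:=X[q_1];\ q_2:=I/2;\ \bar q':=\sigma;\ q_2,\bar q,\bar q':=AS[q_2,\bar q,\bar q']$; on the third $\mathbf{skip}$; and then, in every case, run $\bar q:=e^{-i\theta\sigma}[\bar q]$. The differential program is $$\tfrac{\partial}{\partial\theta}(P(\boldsymbol\theta))\equiv q_1:=|0\rangle;\ q_2:=|0\rangle;\ q_c:=|0\rangle;\ q_c:=C[q_c];\ q_c,q_2:=GP[q_c,q_2];\ T_\theta(P(\boldsymbol\theta)).$$ Put $O_d=\sum_{j\ge1}\frac2{\mu(j)}|j\rangle\langle j|\otimes|1\rangle\langle1|\otimes Z$ on $q_c,q_1,q_2$.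 **Theorem.** Fix $\boldsymbol\theta$ and one of its parameters $\theta$. Assume that every while-statement occurring in $P(\boldsymbol\theta)$ terminates almost surely. Let $\rho$ be a partial density operator on $\mathcal H$, $O$ a Hermitian operator on $\mathcal H$, $M$ the largest eigenvalue of $|O|$, $M_1=RC_\theta(P(\boldsymbol\theta))$, $M_2=LC(P(\boldsymbol\theta))$, and $S'(n)=\sum_{j=1}^n 1/\mu(j)^3$ (an empty sum being $0$; if $M_1=0$ all occurrences of $S'$ below are $0$). Let $\epsilon\in(0,1)$. Then there is an integer $N_\epsilon>0$ such that, for all while-statements $\mathbf{while}\ M[\bar q]=1\ \mathbf{do}\ Q\ \mathbf{od}$ in $P(\boldsymbol\theta)$, all $n\ge0$ and all partial density operators $\rho'$, $$\operatorname{tr}\bigl(\mathcal E_0\circ([\![Q]\!]\circ\mathcal E_1)^n(\rho')\bigr)\le\epsilon^{\lfloor n/N_\epsilon\rfloor}\operatorname{tr}(\rho'),$$ and for every such $N_\epsilon$ the expectation $$\langle O_d^4\otimes O^4\rangle=\operatorname{tr}\Bigl((O_d^4\otimes O^4)\,[\![\tfrac{\partial}{\partial\theta}(P(\boldsymbol\theta))]\!](\rho)\Bigr)\in[0,\infty]$$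 (the fresh variables starting in an arbitrary partial density operator) is at most $$4M^4\Bigl(4S'(M_1)+\sum_{k=1}^\infty\bigl(M_2+(k-1)(k^{M_2-1}-1)_+\bigr)\,S'\bigl((k+1)^{M_2}M_1-1\bigr)\bigl(2\epsilon^{\lfloor\frac{k-1}{N_\epsilon}\rfloor}+2\epsilon^{\lfloor\frac{k-1}{N_\epsilon}\rfloor-1}\bigr)\Bigr),$$ where $(x)_+=\max\{0,x\}$, and both sides are read in $[0,\infty]$ with the convention $0\cdot\infty=0$. -/

import Mathlib

open scoped ComplexOrder MatrixOrder ENNReal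

noncomputable section

namespace QWhile

/-! ### Operators on `ℓ²(ι)`, written as matrices in the computational basis

The Hilbert space with orthonormal basis `{|i⟩ : i ∈ ι}` may be infinite-dimensional; an operator `A`
on it is represented by its matrix `A i j = ⟨i|A|j⟩`. -/

/-- The product of operators, `⟨i|AB|j⟩ = ∑ₖ ⟨i|A|k⟩⟨k|B|j⟩`, with a possibly infinite sum. -/
def imul {ι : Type} (A B : Matrix ι ι ℂ) : Matrix ι ι ℂ :=
  fun i j => ∑' k, A i k * B k j

/-- The identity operator. -/
def iid (ι : Type) : Matrix ι ι ℂ :=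
  open Classical in fun i j => if i = j then 1 else 0

/-- Powers of an operator. -/
def ipow {ι : Type} (A : Matrix ι ι ℂ) : ℕ → Matrix ι ι ℂ
  | 0 => iid ι
  | n + 1 => imul A (ipow A n)

/-- The exponential `e^A = ∑ₙ Aⁿ / n!`. -/
def iexp {ι : Type} (A : Matrix ι ι ℂ) : Matrix ι ι ℂ :=
  fun i j => ∑' n : ℕ, ((n.factorial : ℂ))⁻¹ * ipow A n i j

/-- The map `ρ ↦ A ρ A†`. -/
def sandwich {ι : Type} (A ρ : Matrix ι ι ℂ) : Matrix ι ι ℂ :=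
  imul (imul A ρ) A.conjTranspose

/-- The trace, in `[0, ∞]`, of a positive semidefinite operator. -/
def trace {ι : Type} (ρ : Matrix ι ι ℂ) : ℝ≥0∞ :=
  ∑' i, ENNReal.ofReal (ρ i i).re

/-- Partial density operators: positive semidefinite with trace at most one. -/
def IsPartialDensity {ι : Type} (ρ : Matrix ι ι ℂ) : Prop :=
  ρ.PosSemidef ∧ trace ρ ≤ 1

/-- Density operators: positive semidefinite with trace one. -/
def IsDensity {ι : Type} (ρ : Matrix ι ι ℂ) : Prop :=
  ρ.PosSemidef ∧ trace ρ = 1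

/-- Unitary operators: `U†U = UU† = I`. -/
def IsUnitaryOp {ι : Type} (U : Matrix ι ι ℂ) : Prop :=
  imul U.conjTranspose U = iid ι ∧ imul U U.conjTranspose = iid ι

/-- Measurements: finite families of operators (with square-summable columns) such that
`∑ₘ Mₘ†Mₘ = I`. -/
def IsMeasurement {ι : Type} {m : ℕ} (M : Fin m → Matrix ι ι ℂ) : Prop :=
  (∀ a j, Summable fun i => ‖M a i j‖ ^ 2) ∧ ∑ a, imul (M a).conjTranspose (M a) = iid ι

/-- `A` is the least upper bound of the sequence `S` among the partial density operators, for the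
Löwner order `X ⊑ Y ↔ Y - X` positive semidefinite. -/
def IsLoewnerLub {ι : Type} (S : ℕ → Matrix ι ι ℂ) (A : Matrix ι ι ℂ) : Prop :=
  IsPartialDensity A ∧ (∀ n, (A - S n).PosSemidef) ∧
    ∀ A', IsPartialDensity A' → (∀ n, (A' - S n).PosSemidef) → (A' - A).PosSemidef

/-- The least upper bound `⨆ₙ S n` in the Löwner order (and `0` if there is none). -/
def loewnerSup {ι : Type} (S : ℕ → Matrix ι ι ℂ) : Matrix ι ι ℂ :=
  open Classical in if h : ∃ A, IsLoewnerLub S A then h.choose else 0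

/-! ### Quantum variables and registers

`V` is a set of quantum variables, and the variable `v` has the state space with orthonormal basis
`{|b⟩ : b ∈ B v}`, in which `|0⟩` is the basis state used for initialization. -/

/-- Labels of the computational basis of the joint state space of all variables. -/
abbrev Cfg {V : Type} (B : V → Type) : Type := ∀ v, B v

/-- Operators on the state space of the register `q`, a family of quantum variables. -/
abbrev RegOp {V I : Type} (B : V → Type) (q : I → V) : Type :=
  Matrix (∀ i, B (q i)) (∀ i, B (q i)) ℂ

/-- The operator `A ⊗ I` on the joint space, with `A` acting on the register `q`. -/
def lift {V I : Type} {B : V → Type} (q : I → V) (A : RegOp B q) : Matrix (Cfg B) (Cfg B) ℂ :=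
  open Classical in fun s t =>
    if ∀ v, v ∉ Set.range q → s v = t v then A (fun i => s (q i)) (fun i => t (q i)) else 0

/-- The label `s` with the values on `R` replaced by those of `a`. -/
def overwrite {V : Type} {B : V → Type} (R : Set V) (a : ∀ v : R, B v) (s : Cfg B) : Cfg B :=
  open Classical in fun v => if h : v ∈ R then a ⟨v, h⟩ else s v

/-- `ρ ↦ ∑ₙ |0⟩⟨n| ρ |n⟩⟨0|` on the variable `v`. -/
def initVar {V : Type} {B : V → Type} [∀ v, Zero (B v)] (v : V)
    (ρ : Matrix (Cfg B) (Cfg B) ℂ) : Matrix (Cfg B) (Cfg B) ℂ :=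
  open Classical in fun s t =>
    if s v = 0 ∧ t v = 0 then ∑' n : B v, ρ (Function.update s v n) (Function.update t v n) else 0

/-- `ρ ↦ tr_q(ρ) ⊗ σ`, with `σ` placed in the register `q`. -/
def assignReg {V I : Type} {B : V → Type} (q : I → V) (σ : RegOp B q)
    (ρ : Matrix (Cfg B) (Cfg B) ℂ) : Matrix (Cfg B) (Cfg B) ℂ :=
  fun s t =>
    (∑' a : (∀ v : Set.range q, B v), ρ (overwrite (Set.range q) a s) (overwrite (Set.range q) a t)) *
      σ (fun i => s (q i)) (fun i => t (q i))

/-! ### Parameterized quantum while-programs -/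

/-- Parameterized quantum while-programs with parameters `θ : Fin k → ℝ`. -/
inductive Prog (k : ℕ) {V : Type} (B : V → Type) : Type 1
  /-- `skip` -/
  | skip : Prog k B
  /-- `v := |0⟩` -/
  | init (v : V) : Prog k B
  /-- `q := σ` -/
  | assign {I : Type} (q : I → V) (σ : RegOp B q) : Prog k B
  /-- `q := U[q]` -/
  | unitary {I : Type} (q : I → V) (U : RegOp B q) : Prog k B
  /-- `q := e^{-iθⱼσ}[q]` -/
  | rot {I : Type} (j : Fin k) (q : I → V) (σ : RegOp B q) : Prog k B
  /-- `P; Q` -/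
  | seq (P Q : Prog k B) : Prog k B
  /-- `if (□ a · M[q] = a → P a) fi` -/
  | branch {I : Type} (q : I → V) (m : ℕ) (M : Fin m → RegOp B q) (P : Fin m → Prog k B) : Prog k B
  /-- `while M[q] = 1 do Q od` -/
  | loop {I : Type} (q : I → V) (M : Fin 2 → RegOp B q) (Q : Prog k B) : Prog k B

namespace Prog

variable {k : ℕ} {V : Type} {B : V → Type}

/-- Well-formedness: registers are finite families of distinct variables, and the operators are
unitary operators, density operators and measurements where the syntax requires this. -/
def WF : Prog k B → Prop
  | skip => True
  | init _ => True
  | @assign _ _ _ I q σ => Finite I ∧ Function.Injective q ∧ IsDensity σ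
  | @unitary _ _ _ I q U => Finite I ∧ Function.Injective q ∧ IsUnitaryOp U
  | @rot _ _ _ I _ q σ => Finite I ∧ Function.Injective q ∧ IsDensity σ
  | seq P Q => P.WF ∧ Q.WF
  | @branch _ _ _ I q _ M P => Finite I ∧ Function.Injective q ∧ IsMeasurement M ∧ ∀ a, (P a).WF
  | @loop _ _ _ I q M Q => Finite I ∧ Function.Injective q ∧ IsMeasurement M ∧ Q.WF

/-- The denotational semantics `⟦P(θ)⟧`. -/
def sem [∀ v, Zero (B v)] (θ : Fin k → ℝ) :
    Prog k B → Matrix (Cfg B) (Cfg B) ℂ → Matrix (Cfg B) (Cfg B) ℂ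
  | skip, ρ => ρ
  | init v, ρ => initVar v ρ
  | assign q σ, ρ => assignReg q σ ρ
  | unitary q U, ρ => sandwich (lift q U) ρ
  | rot j q σ, ρ => sandwich (lift q (iexp ((-(Complex.I * (θ j : ℂ))) • σ))) ρ
  | seq P Q, ρ => Q.sem θ (P.sem θ ρ)
  | branch q _ M P, ρ => ∑ a, (P a).sem θ (sandwich (lift q (M a)) ρ)
  | loop q M Q, ρ => loewnerSup fun n => ∑ l ∈ Finset.range (n + 1),
      sandwich (lift q (M 0)) ((fun ρ' => Q.sem θ (sandwich (lift q (M 1)) ρ'))^[l] ρ)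

/-- The running count of the parameter `θⱼ`. -/
def runningCount (j : Fin k) : Prog k B → ℕ
  | skip => 0
  | init _ => 0
  | assign _ _ => 0
  | unitary _ _ => 0
  | rot j' _ _ => if j' = j then 1 else 0
  | seq P Q => P.runningCount j + Q.runningCount j
  | branch _ _ _ P => Finset.univ.sup fun a => (P a).runningCount j
  | loop _ _ Q => Q.runningCount j

/-- The loop count. -/
def loopCount : Prog k B → ℕ
  | skip => 0
  | init _ => 0
  | assign _ _ => 0
  | unitary _ _ => 0
  | rot _ _ _ => 0
  | seq P Q => P.loopCount + Q.loopCount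
  | branch _ _ _ P => ∑ a, (P a).loopCount
  | loop _ _ Q => Q.loopCount + 1

/-- `P` terminates almost surely at `θ`. -/
def TerminatesAS [∀ v, Zero (B v)] (θ : Fin k → ℝ) (P : Prog k B) : Prop :=
  ∀ ρ, IsPartialDensity ρ → trace (P.sem θ ρ) = trace ρ

/-- All the while-statements that occur in a program (at any depth) terminate almost surely. -/
def AllLoopsTerminate [∀ v, Zero (B v)] (θ : Fin k → ℝ) : Prog k B → Prop
  | seq P Q => P.AllLoopsTerminate θ ∧ Q.AllLoopsTerminate θ
  | branch _ _ _ P => ∀ a, (P a).AllLoopsTerminate θ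
  | loop q M Q => (loop q M Q).TerminatesAS θ ∧ Q.AllLoopsTerminate θ
  | _ => True

/-- For every statement `while M[q] = 1 do Q od` that occurs in a program (at any depth),
`tr(𝓔₀ ∘ (⟦Q⟧ ∘ 𝓔₁)ⁿ(ρ)) ≤ ε^⌊n/N⌋ tr(ρ)` for all `n` and all partial density operators `ρ`,
where `𝓔ₐ(ρ) = Mₐ ρ Mₐ†`. -/
def AllLoopsDecay [∀ v, Zero (B v)] (θ : Fin k → ℝ) (ε : ℝ) (N : ℕ) : Prog k B → Prop
  | seq P Q => P.AllLoopsDecay θ ε N ∧ Q.AllLoopsDecay θ ε N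
  | branch _ _ _ P => ∀ a, (P a).AllLoopsDecay θ ε N
  | loop q M Q =>
      (∀ (n : ℕ) (ρ : Matrix (Cfg B) (Cfg B) ℂ), IsPartialDensity ρ →
        trace (sandwich (lift q (M 0))
          ((fun ρ' => Q.sem θ (sandwich (lift q (M 1)) ρ'))^[n] ρ)) ≤
            ENNReal.ofReal (ε ^ (n / N)) * trace ρ) ∧
      Q.AllLoopsDecay θ ε N
  | _ => True

end Prog

/-! ### The differential program -/

/-- The fresh variables of the differential program: a copy of every program variable (from which the
copies `q'` of registers `q` are formed), the counter `qc`, and the qubits `q₁`, `q₂`. -/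
inductive Anc (V : Type) : Type
  | copy (v : V) : Anc V
  | qc : Anc V
  | q1 : Anc V
  | q2 : Anc V

/-- State spaces of the fresh variables; that of `qc` has the orthonormal basis `{|n⟩ : n ∈ ℤ}`. -/
def AncB {V : Type} (B : V → Type) : Anc V → Type
  | .copy v => B v
  | .qc => ℤ
  | .q1 => Fin 2
  | .q2 => Fin 2

instance instZeroAncB {V : Type} (B : V → Type) [∀ v, Zero (B v)] : ∀ a, Zero (AncB B a)
  | .copy v => inferInstanceAs (Zero (B v))
  | .qc => inferInstanceAs (Zero ℤ)
  | .q1 => inferInstanceAs (Zero (Fin 2))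
  | .q2 => inferInstanceAs (Zero (Fin 2))

/-- State spaces of all variables of the differential program. -/
def DiffB {V : Type} (B : V → Type) : V ⊕ Anc V → Type
  | .inl v => B v
  | .inr a => AncB B a

instance instZeroDiffB {V : Type} (B : V → Type) [∀ v, Zero (B v)] : ∀ w, Zero (DiffB B w)
  | .inl v => inferInstanceAs (Zero (B v))
  | .inr a => inferInstanceAs (Zero (AncB B a))

section Transformation

variable {V : Type} (B : V → Type)

/-- The register `q` among the variables of the differential program. -/
def origReg {I : Type} (q : I → V) : I → V ⊕ Anc V := fun i => .inl (q i)

/-- The copy `q'` of the register `q`. -/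
def copyReg {I : Type} (q : I → V) : I → V ⊕ Anc V := fun i => .inr (.copy (q i))

/-- A register that consists of one fresh variable. -/
def ancReg (a : Anc V) : Unit → V ⊕ Anc V := fun _ => .inr a

/-- The register `q₁, q₂`. -/
def regQ1Q2 : Unit ⊕ Unit → V ⊕ Anc V
  | .inl _ => .inr .q1
  | .inr _ => .inr .q2

/-- The register `qc, q₂`. -/
def regQcQ2 : Unit ⊕ Unit → V ⊕ Anc V
  | .inl _ => .inr .qc
  | .inr _ => .inr .q2

/-- The register `q₂, q, q'`. -/
def regAS {I : Type} (q : I → V) : Unit ⊕ (I ⊕ I) → V ⊕ Anc V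
  | .inl _ => .inr .q2
  | .inr (.inl i) => .inl (q i)
  | .inr (.inr i) => .inr (.copy (q i))

/-- The right-translation `C = ∑ₙ |n+1⟩⟨n|` on `qc`, a unitary operator. -/
def opC : RegOp (DiffB B) (ancReg (V := V) .qc) := fun s t =>
  let m : ℤ := s ()
  let n : ℤ := t ()
  if m = n + 1 then 1 else 0

/-- `b_j = μ(j) / (1 - ∑_{1 ≤ l < j} μ(l))`. -/
def bCoeff (μ : ℕ → ℝ) (j : ℕ) : ℝ := μ j / (1 - ∑ l ∈ Finset.Ico 1 j, μ l)

/-- The rotation `R_y(φ) = e^{-iφY/2}`. -/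
def rotY (φ : ℝ) : Matrix (Fin 2) (Fin 2) ℂ :=
  !![(Real.cos (φ / 2) : ℂ), -(Real.sin (φ / 2) : ℂ);
     (Real.sin (φ / 2) : ℂ), (Real.cos (φ / 2) : ℂ)]

/-- `GP = ∑_{j ≥ 1} |j⟩⟨j| ⊗ R_y(2 arcsin √b_j)` on `qc, q₂`, completed to a unitary operator by the
identity on the span of the `|j⟩` with `j ≤ 0`. -/
def opGP (μ : ℕ → ℝ) : RegOp (DiffB B) (regQcQ2 (V := V)) := fun s t =>
  let m : ℤ := s (.inl ())
  let n : ℤ := t (.inl ())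
  let x : Fin 2 := s (.inr ())
  let y : Fin 2 := t (.inr ())
  if m = n then
    if 1 ≤ n then rotY (2 * Real.arcsin (Real.sqrt (bCoeff μ n.toNat))) x y
    else if x = y then 1 else 0
  else 0

/-- The measurement `M₀ = |00⟩⟨00|`, `M₁ = |01⟩⟨01|`, `M₂ = |10⟩⟨10| + |11⟩⟨11|` of `q₁, q₂`. -/
def opM (a : Fin 3) : RegOp (DiffB B) (regQ1Q2 (V := V)) := fun s t =>
  let x₁ : Fin 2 := s (.inl ())
  let x₂ : Fin 2 := s (.inr ())
  let y₁ : Fin 2 := t (.inl ())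
  let y₂ : Fin 2 := t (.inr ())
  if x₁ = y₁ ∧ x₂ = y₂ ∧ (if x₁ = 1 then a = 2 else if x₂ = 1 then a = 1 else a = 0) then 1 else 0

/-- The Pauli operator `X` on `q₁`. -/
def opX : RegOp (DiffB B) (ancReg (V := V) .q1) := fun s t =>
  let x : Fin 2 := s ()
  let y : Fin 2 := t ()
  if x = y then 0 else 1

/-- The density operator `I/2` on `q₂`. -/
def halfId : RegOp (DiffB B) (ancReg (V := V) .q2) := fun s t =>
  let x : Fin 2 := s ()
  let y : Fin 2 := t ()
  if x = y then 1 / 2 else 0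

/-- The SWAP operator `|a⟩|b⟩ ↦ |b⟩|a⟩`. -/
def swapOp (ι : Type) : Matrix (ι × ι) (ι × ι) ℂ :=
  open Classical in fun s t => if s.1 = t.2 ∧ s.2 = t.1 then 1 else 0

/-- `AS = |0⟩⟨0| ⊗ e^{-i(π/4)S} + |1⟩⟨1| ⊗ e^{i(π/4)S}` on `q₂, q, q'`, where `S` is the SWAP operator
between `q` and `q'`. -/
def opAS {I : Type} (q : I → V) : RegOp (DiffB B) (regAS q) := fun s t =>
  let x : Fin 2 := s (.inl ())
  let y : Fin 2 := t (.inl ())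
  let s' : (∀ i, B (q i)) × (∀ i, B (q i)) := (fun i => s (.inr (.inl i)), fun i => s (.inr (.inr i)))
  let t' : (∀ i, B (q i)) × (∀ i, B (q i)) := (fun i => t (.inr (.inl i)), fun i => t (.inr (.inr i)))
  if x = y then
    if x = 0 then iexp ((-(Complex.I * (Real.pi / 4 : ℂ))) • swapOp (∀ i, B (q i))) s' t'
    else iexp ((Complex.I * (Real.pi / 4 : ℂ)) • swapOp (∀ i, B (q i))) s' t'
  else 0

variable {B} {k : ℕ}

/-- The statements `qc := C[qc]; qc, q₂ := GP[qc, q₂]`. -/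
def stepProg (μ : ℕ → ℝ) : Prog k (DiffB B) :=
  .seq (.unitary (ancReg .qc) (opC B)) (.unitary regQcQ2 (opGP B μ))

/-- The statements `q₁ := X[q₁]; q₂ := I/2; q' := σ; q₂, q, q' := AS[q₂, q, q']`. -/
def commutatorProg {I : Type} (q : I → V) (σ : RegOp B q) : Prog k (DiffB B) :=
  .seq (.unitary (ancReg .q1) (opX B)) (.seq (.assign (ancReg .q2) (halfId B))
    (.seq (.assign (copyReg q) σ) (.unitary (regAS q) (opAS B q))))

/-- The code transformation with respect to the parameter `θⱼ`, for the distribution `μ`. -/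
def transform (μ : ℕ → ℝ) (j : Fin k) : Prog k B → Prog k (DiffB B)
  | .skip => .skip
  | .init v => .init (.inl v)
  | .assign q σ => .assign (origReg q) σ
  | .unitary q U => .unitary (origReg q) U
  | .rot j' q σ =>
      if j' = j then
        .seq (.branch regQ1Q2 3 (opM B) ![stepProg μ, commutatorProg q σ, .skip])
          (.rot j' (origReg q) σ)
      else .rot j' (origReg q) σ
  | .seq P Q => .seq (transform μ j P) (transform μ j Q)
  | .branch q m M P => .branch (origReg q) m M fun a => transform μ j (P a)
  | .loop q M Q => .loop (origReg q) M (transform μ j Q)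

/-- The differential program of `P` with respect to `θⱼ`:
`q₁ := |0⟩; q₂ := |0⟩; qc := |0⟩; qc := C[qc]; qc, q₂ := GP[qc, q₂]`, followed by the transform. -/
def diffProg (μ : ℕ → ℝ) (j : Fin k) (P : Prog k B) : Prog k (DiffB B) :=
  .seq (.init (.inr .q1)) (.seq (.init (.inr .q2)) (.seq (.init (.inr .qc))
    (.seq (stepProg μ) (transform μ j P))))

/-- The product state `ρ ⊗ ρ₀` of the program variables and the fresh variables. -/
def withAnc (ρ : Matrix (Cfg B) (Cfg B) ℂ) (ρ₀ : Matrix (Cfg (AncB B)) (Cfg (AncB B)) ℂ) :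
    Matrix (Cfg (DiffB B)) (Cfg (DiffB B)) ℂ :=
  fun s t => ρ (fun v => s (.inl v)) (fun v => t (.inl v)) *
    ρ₀ (fun a => s (.inr a)) (fun a => t (.inr a))

end Transformation

/-! ### The observable -/

/-- `O_d = ∑_{j ≥ 1} (2/μ(j)) |j⟩⟨j| ⊗ |1⟩⟨1| ⊗ Z` on `qc, q₁, q₂`. -/
def obsD (μ : ℕ → ℝ) : Matrix (ℤ × Fin 2 × Fin 2) (ℤ × Fin 2 × Fin 2) ℂ :=
  Matrix.diagonal fun x =>
    if 1 ≤ x.1 ∧ x.2.1 = 1 then ((2 / μ x.1.toNat : ℝ) : ℂ) * (if x.2.2 = 0 then 1 else -1) else 0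

/-- The operator `D ⊗ A` on the joint space of the differential program, with `D` acting on
`qc, q₁, q₂`, `A` on the program variables, and the identity on the copies. -/
def tensorObs {V : Type} {B : V → Type} (D : Matrix (ℤ × Fin 2 × Fin 2) (ℤ × Fin 2 × Fin 2) ℂ)
    (A : Matrix (Cfg B) (Cfg B) ℂ) : Matrix (Cfg (DiffB B)) (Cfg (DiffB B)) ℂ :=
  fun s t =>
    let c : Cfg (DiffB B) → ℤ × Fin 2 × Fin 2 := fun u => (u (.inr .qc), u (.inr .q1), u (.inr .q2))
    let r : Cfg (DiffB B) → ∀ v, B v := fun u v => u (.inr (.copy v))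
    D (c s) (c t) * iid (∀ v, B v) (r s) (r t) * A (fun v => s (.inl v)) (fun v => t (.inl v))

/-- The expectation `tr(Y²τ) = tr(YτY†) ∈ [0, ∞]` of the square of a Hermitian, possibly unbounded,
operator `Y` in the state `τ`. -/
def expectSq {ι : Type} (Y τ : Matrix ι ι ℂ) : ℝ≥0∞ := trace (sandwich Y τ)

/-- `⟨O_d⁴ ⊗ O⁴⟩ = tr((O_d⁴ ⊗ O⁴) ⟦∂P/∂θⱼ⟧(ρ ⊗ ρ₀)) ∈ [0, ∞]`, where `O_d⁴ ⊗ O⁴ = (O_d² ⊗ O²)²`. -/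
def fourthMoment {k : ℕ} {V : Type} {B : V → Type} [∀ v, Zero (B v)] (μ : ℕ → ℝ) (j : Fin k)
    (θ : Fin k → ℝ) (P : Prog k B) (O ρ : Matrix (Cfg B) (Cfg B) ℂ)
    (ρ₀ : Matrix (Cfg (AncB B)) (Cfg (AncB B)) ℂ) : ℝ≥0∞ :=
  expectSq (tensorObs (ipow (obsD μ) 2) (ipow O 2)) ((diffProg μ j P).sem θ (withAnc ρ ρ₀))

/-- `S'(n) = ∑_{j=1}^{n} 1/μ(j)³`. -/
def sumInvCube (μ : ℕ → ℝ) (n : ℕ) : ℝ := ∑ j ∈ Finset.Icc 1 n, 1 / μ j ^ 3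

/-- The right-hand side of the bound, in `[0, ∞]`; the index `i` of the sum stands for `k = i + 1`. -/
def momentBound (μ : ℕ → ℝ) (ε : ℝ) (N : ℕ) (M : ℝ) (M₁ M₂ : ℕ) : ℝ≥0∞ :=
  ENNReal.ofReal (4 * M ^ 4) *
    (ENNReal.ofReal (4 * sumInvCube μ M₁) +
      ∑' i : ℕ,
        let k : ℕ := i + 1
        ENNReal.ofReal
          (((M₂ : ℝ) + ((k : ℝ) - 1) * max 0 ((k : ℝ) ^ ((M₂ : ℤ) - 1) - 1)) *
            sumInvCube μ ((k + 1) ^ M₂ * M₁ - 1) *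
            (2 * ε ^ ((k - 1) / N) + 2 * ε ^ ((((k - 1) / N : ℕ) : ℤ) - 1))))

end QWhile

end

open QWhile

set_option linter.unusedSectionVars false

namespace QWhile

noncomputable section

open Filter Topology

/-! ### Positive semidefinite matrices over an arbitrary index type -/

section PosSemidef

variable {ι κ : Type}

/-! Write t = tr ρ, a = M₂, R = M₁. After tracing out the copies, the diagonal blocks (`blk`) of a
state of the differential program are indexed by the labels (c, x, y) of qc, q₁, q₂, and on these
labels the inserted code acts like a classical Markov chain: (c,0,0) is "still counting", (c,0,1) is
"stopped at c", (c,1,y) is "flagged at c". At each occurrence of the rotation, the counting block at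
c - 1 moves to c and stops there with probability b_c, a stopped block becomes flagged, and a
flagged block stays flagged. Until flagging, the inserted code leaves the program variables alone,
so they evolve as in P itself. The observable O_d⁴ lives on the flagged labels, with value 16/μ(n)⁴
at n. Hence the moment is at most M⁴ ∑ₙ 16/μ(n)⁴ fₙ, where fₙ is the mass flagged at n
(`expectSq_le`).

There are two bounds on fₙ. The probability of stopping at n, given that counting has reached c < n,
is μ(n) / (1 - ∑_{l ≤ c} μ(l)) (`hit`). This function is harmonic for the chain and extends to a
superharmonic weight that is 1 on the stopped and flagged labels at n. The mass of a superharmonic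
weight never grows along the transformed program (`contracts_transform`), and initially it is at
most μ(n)t, so fₙ ≤ μ(n)t. For the second bound, consider executions in which every run of a loop
makes at most K iterations. They perform at most K^a R rotations. If K^a R < n, their counter does
not pass n, and a stop at n can only happen too late to be flagged. Their whole weight, proportional
to μ(n)T_K with T_K = tr(`tsem` K P ρ), is therefore still unflagged at the end
(`tsem_counting_le`). Subtracting it gives fₙ ≤ μ(n)(t - T_K) (`diffProg_spec`).

It remains to control T_K. In finite dimension almost sure termination is uniform over the input, as
the maximally mixed state shows, and this yields the geometric decay (`exists_iterate_contraction`).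
The decay bounds T_{m+1} - T_m by a polynomial in m times ε^⌊(m+1)/N⌋ t, by induction on the program
(`rtr_tsem_succ_sub_le`). Choosing the best K for every n and exchanging sums bounds the moment by
M⁴(16 S'(R) + ∑_{i ≥ 1} 16 S'((i+1)^a R)(T_{i+1} - T_i)) (`tsum_flagged_le`), which is compared with
the claim term by term (`tsum_le_momentBound`).

Two technical points shape the development. The counter makes the state space infinite, but the
operators that act on it have finitely supported rows, so positivity and traces can be handled by
entries. The semantics of a loop is a supremum and not visibly linear, so estimates are proved for
the linear truncations `tsem` and passed to the limit. -/

theorem _root_.Matrix.PosSemidef.of_apply_eq {A B : Matrix ι ι ℂ} (hA : A.PosSemidef)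
    (h : ∀ i j, B i j = A i j) : B.PosSemidef := by
  have : B = A := funext fun i => funext fun j => h i j
  exact this ▸ hA

/-- Positivity over an infinite index type is tested on finitely supported vectors only, so finite
principal submatrices decide it. -/
theorem posSemidef_of_finset {A : Matrix ι ι ℂ}
    (h : ∀ F : Finset ι, (A.submatrix (fun i : F => (i : ι)) (fun i : F => (i : ι))).PosSemidef) :
    A.PosSemidef := by
  classical
  refine ⟨?_, fun x => ?_⟩
  · ext i j
    have := congrFun (congrFun (h {i, j}).1 ⟨i, by simp⟩) ⟨j, by simp⟩
    simpa using this
  · have := (h x.support).2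
    simpa [Finsupp.sum, ← Finset.sum_attach x.support, ← Finset.subtype_mem_eq_attach,
      ← Finsupp.subtypeDomain_apply, ← Finsupp.support_subtypeDomain] using this _

theorem posSemidef_rankOne (d : ι → ℂ) :
    Matrix.PosSemidef (fun s t => d s * star (d t) : Matrix ι ι ℂ) := by
  refine posSemidef_of_finset fun F => ?_
  exact Matrix.posSemidef_vecMulVec_self_star fun i : F => d i

theorem _root_.Matrix.PosSemidef.weighted_submatrix {τ : Matrix κ κ ℂ} (hτ : τ.PosSemidef)
    (f : ι → κ) (d : ι → ℂ) :
    Matrix.PosSemidef (fun s t => d s * τ (f s) (f t) * star (d t) : Matrix ι ι ℂ) := by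
  refine ((posSemidef_rankOne d).hadamard (hτ.submatrix f)).of_apply_eq fun s t => ?_
  change d s * τ (f s) (f t) * star (d t) = d s * star (d t) * τ (f s) (f t)
  ring

/-- On each finite set of row labels the double sum is D G D†, where D sums out the second
coordinate. With `weighted_submatrix` this gives positivity of A τ A† when A is infinite with finite
rows. -/
theorem _root_.Matrix.PosSemidef.marginal [Fintype κ] {G : Matrix (ι × κ) (ι × κ) ℂ}
    (hG : G.PosSemidef) :
    Matrix.PosSemidef (fun s t => ∑ k, ∑ k', G (s, k) (t, k') : Matrix ι ι ℂ) := by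
  classical
  refine posSemidef_of_finset fun F => ?_
  let G' : Matrix (F × κ) (F × κ) ℂ :=
    G.submatrix (fun p => ((p.1 : ι), p.2)) (fun p => ((p.1 : ι), p.2))
  let D : Matrix F (F × κ) ℂ := fun p q => if p = q.1 then 1 else 0
  have hD : ∀ p q, D p q = if p = q.1 then 1 else 0 := fun _ _ => rfl
  have h1 : ∀ s q, (D * G') s q = ∑ k, G' (s, k) q := by
    intro s q
    rw [Matrix.mul_apply, Fintype.sum_prod_type, Finset.sum_comm]
    simp [hD]
  have h2 : ∀ s t, (D * G' * D.conjTranspose) s t = ∑ k', (D * G') s (t, k') := by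
    intro s t
    rw [Matrix.mul_apply, Fintype.sum_prod_type, Finset.sum_comm]
    refine Finset.sum_congr rfl fun k _ => ?_
    rw [Finset.sum_eq_single t] <;> simp +contextual [hD, Matrix.conjTranspose_apply, eq_comm]
  refine ((hG.submatrix (fun p : F × κ =>
    ((p.1 : ι), p.2))).mul_mul_conjTranspose_same D).of_apply_eq fun s t => ?_
  refine Eq.trans ?_ (h2 s t).symm
  simp_rw [h1]
  rw [Finset.sum_comm]
  rfl

theorem posSemidef_of_tendsto {α : Type*} {l : Filter α} [l.NeBot] {S : α → Matrix ι ι ℂ}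
    {A : Matrix ι ι ℂ} (hS : ∀ᶠ n in l, (S n).PosSemidef)
    (h : ∀ i j, Tendsto (fun n => S n i j) l (𝓝 (A i j))) : A.PosSemidef := by
  refine ⟨?_, fun x => ?_⟩
  · ext i j
    refine tendsto_nhds_unique_of_eventuallyEq ((h j i).star) (h i j) ?_
    filter_upwards [hS] with n hn
    exact congrFun (congrFun hn.1 i) j
  · refine ge_of_tendsto (x := l) (f := fun n => x.sum fun i xi ↦ x.sum fun j xj ↦
      star xi * S n i j * xj) ?_ (hS.mono fun n hn => hn.2 x)
    refine tendsto_finsetSum _ fun i _ => tendsto_finsetSum _ fun j _ => ?_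
    exact ((h i j).const_mul _).mul_const _

theorem _root_.Matrix.PosSemidef.re_diag_nonneg {A : Matrix ι ι ℂ} (hA : A.PosSemidef) (i : ι) :
    0 ≤ (A i i).re := (Complex.le_def.1 hA.diag_nonneg).1

theorem _root_.Matrix.PosSemidef.diag_eq {A : Matrix ι ι ℂ} (hA : A.PosSemidef) (i : ι) :
    A i i = ((A i i).re : ℂ) := by
  apply Complex.ext
  · simp
  · simpa using (Complex.le_def.1 (hA.diag_nonneg (i := i))).2.symm

/-- The 2×2 principal minor gives |A i j|² ≤ A i i · A j j. The weaker linear form is what carries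
convergence and summability from the diagonal to all entries. -/
theorem _root_.Matrix.PosSemidef.norm_le_diag {A : Matrix ι ι ℂ} (hA : A.PosSemidef) (i j : ι) :
    ‖A i j‖ ≤ (A i i).re + (A j j).re := by
  have h := (hA.submatrix ![i, j]).det_nonneg
  rw [Matrix.det_fin_two] at h
  simp only [Matrix.submatrix_apply, Matrix.cons_val_zero, Matrix.cons_val_one] at h
  have hij : A j i = star (A i j) := (congrFun (congrFun hA.1 j) i).symm
  rw [hij, Complex.star_def, Complex.mul_conj, hA.diag_eq i, hA.diag_eq j, ← Complex.ofReal_mul,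
    ← Complex.ofReal_sub, Complex.zero_le_real, Complex.normSq_eq_norm_sq] at h
  have h1 := hA.re_diag_nonneg i
  have h2 := hA.re_diag_nonneg j
  refine abs_le_of_sq_le_sq' ?_ (by positivity) |>.2
  nlinarith

end PosSemidef

/-! ### Traces in `[0, ∞]` -/

section Trace

variable {ι : Type}

theorem trace_zero : trace (0 : Matrix ι ι ℂ) = 0 := by simp [trace]

theorem trace_add {A B : Matrix ι ι ℂ} (hA : A.PosSemidef) (hB : B.PosSemidef) :
    trace (A + B) = trace A + trace B := by
  simp only [trace, ← ENNReal.tsum_add]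
  refine tsum_congr fun i => ?_
  rw [← ENNReal.ofReal_add (hA.re_diag_nonneg i) (hB.re_diag_nonneg i)]
  simp

theorem trace_le_of_tendsto {α : Type*} {l : Filter α} [l.NeBot] {S : α → Matrix ι ι ℂ}
    {A : Matrix ι ι ℂ} {c : ℝ≥0∞} (hS : ∀ n, trace (S n) ≤ c)
    (h : ∀ i, Tendsto (fun n => S n i i) l (𝓝 (A i i))) : trace A ≤ c := by
  rw [trace, ENNReal.tsum_eq_iSup_sum]
  refine iSup_le fun F => ?_
  refine le_of_tendsto' (x := l) (f := fun n => ∑ i ∈ F, ENNReal.ofReal (S n i i).re) ?_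
    fun n => (ENNReal.sum_le_tsum F).trans (hS n)
  refine tendsto_finsetSum _ fun i _ => ?_
  exact (ENNReal.continuous_ofReal.tendsto _).comp ((Complex.continuous_re.tendsto _).comp (h i))

theorem ofReal_diag_le_trace (A : Matrix ι ι ℂ) (i : ι) : ENNReal.ofReal (A i i).re ≤ trace A :=
  ENNReal.le_tsum (f := fun i => ENNReal.ofReal (A i i).re) i

theorem IsPartialDensity.diag_le_one {A : Matrix ι ι ℂ} (hA : IsPartialDensity A) (i : ι) :
    (A i i).re ≤ 1 := by
  have := (ofReal_diag_le_trace A i).trans hA.2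
  rwa [← ENNReal.ofReal_one, ENNReal.ofReal_le_ofReal_iff zero_le_one] at this

end Trace

/-! ### Least upper bounds of increasing sequences of partial density operators -/

section Lub

variable {ι : Type}

/-- Diagonal entries increase and are at most 1, hence are Cauchy. `norm_le_diag`, applied to the
positive difference of two terms of the sequence, transfers this to the other entries. -/
theorem exists_tendsto_of_monotone {S : ℕ → Matrix ι ι ℂ} (hmono : Monotone S)
    (hS : ∀ n, IsPartialDensity (S n)) :
    ∃ A : Matrix ι ι ℂ, ∀ i j, Tendsto (fun n => S n i j) atTop (𝓝 (A i j)) := by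
  have hdiag : ∀ i, CauchySeq fun n => (S n i i).re := by
    intro i
    have hm : Monotone fun n => (S n i i).re := fun m n hmn => by
      have := Matrix.PosSemidef.re_diag_nonneg (Matrix.le_iff.1 (hmono hmn)) i
      simpa using this
    refine (tendsto_atTop_ciSup hm ⟨1, ?_⟩).cauchySeq
    rintro _ ⟨n, rfl⟩
    exact (hS n).diag_le_one i
  have : ∀ i j, ∃ a, Tendsto (fun n => S n i j) atTop (𝓝 a) := by
    intro i j
    refine cauchySeq_tendsto_of_complete ?_
    have hc : CauchySeq fun n => (S n i i).re + (S n j j).re := (hdiag i).add (hdiag j)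
    rw [Metric.cauchySeq_iff'] at hc ⊢
    intro ε hε
    obtain ⟨N, hN⟩ := hc ε hε
    refine ⟨N, fun n hn => lt_of_le_of_lt ?_ (hN n hn)⟩
    rw [dist_eq_norm, Real.dist_eq]
    have := Matrix.PosSemidef.norm_le_diag (Matrix.le_iff.1 (hmono hn)) i j
    simp only [Matrix.sub_apply, Complex.sub_re] at this
    exact this.trans (le_trans (le_of_eq (by ring)) (le_abs_self _))
  choose A hA using this
  exact ⟨A, hA⟩

/-- The entrywise limit is again a partial density operator, and positivity of differences passes to
the limit, so it is a least upper bound. By antisymmetry it is the one chosen by `loewnerSup`. -/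
theorem loewnerSup_tendsto {S : ℕ → Matrix ι ι ℂ} (hmono : Monotone S)
    (hS : ∀ n, IsPartialDensity (S n)) :
    IsPartialDensity (loewnerSup S) ∧
      ∀ i j, Tendsto (fun n => S n i j) atTop (𝓝 (loewnerSup S i j)) := by
  obtain ⟨A, hA⟩ := exists_tendsto_of_monotone hmono hS
  have hAd : IsPartialDensity A :=
    ⟨posSemidef_of_tendsto (.of_forall fun n => (hS n).1) hA,
      trace_le_of_tendsto (fun n => (hS n).2) fun i => hA i i⟩
  have hlub : IsLoewnerLub S A := by
    refine ⟨hAd, fun n => ?_, fun A' _ h => ?_⟩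
    · refine posSemidef_of_tendsto (l := atTop) (S := fun m => S m - S n) ?_ fun i j => ?_
      · filter_upwards [eventually_ge_atTop n] with m hm
        exact hmono hm
      · exact (hA i j).sub_const _
    · exact posSemidef_of_tendsto (l := atTop) (S := fun m => A' - S m) (.of_forall h) fun i j =>
        (hA i j).const_sub _
  have hex : ∃ A, IsLoewnerLub S A := ⟨A, hlub⟩
  have heq : loewnerSup S = A := by
    rw [loewnerSup, dif_pos hex]
    have h := hex.choose_spec
    refine le_antisymm ?_ ?_
    · exact h.2.2 A hAd hlub.2.1
    · exact hlub.2.2 _ h.1 h.2.1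
  rw [heq]
  exact ⟨hAd, hA⟩

end Lub

/-! ### Operators with finitely supported rows -/

section Rows

variable {ι κ : Type}

theorem imul_eq_mul [Fintype ι] (A B : Matrix ι ι ℂ) : imul A B = A * B := by
  ext i j
  simp [imul, Matrix.mul_apply, tsum_fintype]

theorem iid_eq_one [DecidableEq ι] : iid ι = 1 := by
  ext i j
  simp [iid, Matrix.one_apply]

theorem sandwich_eq_mul [Fintype ι] (A ρ : Matrix ι ι ℂ) :
    sandwich A ρ = A * ρ * A.conjTranspose := by
  simp [sandwich, imul_eq_mul]

theorem imul_apply_of_row [Fintype κ] {A : Matrix ι ι ℂ} {i : ι} (f : κ → ι)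
    (hf : Function.Injective f) (hA : ∀ u, A i u ≠ 0 → u ∈ Set.range f) (B : Matrix ι ι ℂ) (j : ι) :
    imul A B i j = ∑ k, A i (f k) * B (f k) j := by
  rw [imul, ← hf.tsum_eq (f := fun k => A i k * B k j), tsum_fintype]
  intro u hu
  exact hA u (left_ne_zero_of_mul hu)

/-- `f i` lists the columns in which the row `i` of `A` may have non-zero entries. -/
structure RowSupport (A : Matrix ι ι ℂ) (f : ι → κ → ι) : Prop where
  inj : ∀ i, Function.Injective (f i)
  mem : ∀ i u, A i u ≠ 0 → u ∈ Set.range (f i)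

variable [Fintype κ] {A : Matrix ι ι ℂ} {f : ι → κ → ι}

theorem RowSupport.sandwich_apply (h : RowSupport A f) (τ : Matrix ι ι ℂ) (s t : ι) :
    sandwich A τ s t =
      ∑ k, ∑ k', A s (f s k) * τ (f s k) (f t k') * star (A t (f t k')) := by
  rw [sandwich, imul, ← (h.inj t).tsum_eq (f := fun k => imul A τ s k * A.conjTranspose k t),
    tsum_fintype]
  · simp_rw [imul_apply_of_row (f s) (h.inj s) (h.mem s), Finset.sum_mul]
    rw [Finset.sum_comm]
    rfl
  · intro u hu
    refine h.mem t u fun h0 => hu ?_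
    simp [h0]

theorem RowSupport.posSemidef_sandwich (h : RowSupport A f) {τ : Matrix ι ι ℂ}
    (hτ : τ.PosSemidef) : (sandwich A τ).PosSemidef := by
  refine (hτ.weighted_submatrix (fun p : ι × κ => f p.1 p.2)
    (fun p => A p.1 (f p.1 p.2))).marginal.of_apply_eq fun s t => ?_
  exact h.sandwich_apply τ s t

end Rows

end

end QWhile

namespace QWhile

noncomputable section

open Filter Topology

/-! ### Registers -/

section Registers

variable {V I : Type} {B : V → Type} {q : I → V}

/-- The label `s` with the values on the register `q` replaced by `x`. -/
def setReg (q : I → V) (x : ∀ i, B (q i)) (s : Cfg B) : Cfg B :=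
  open Classical in fun v => if h : ∃ i, q i = v then h.choose_spec ▸ x h.choose else s v

theorem setReg_apply (hq : Function.Injective q) (x : ∀ i, B (q i)) (s : Cfg B) (i : I) :
    setReg q x s (q i) = x i := by
  have h : ∃ i', q i' = q i := ⟨i, rfl⟩
  rw [setReg, dif_pos h]
  have key : ∀ (i' : I) (e : q i' = q i), (e ▸ x i' : B (q i)) = x i := by
    intro i' e
    obtain rfl := hq e
    rfl
  exact key _ _

theorem setReg_of_notMem (x : ∀ i, B (q i)) (s : Cfg B) {v : V} (hv : v ∉ Set.range q) :
    setReg q x s v = s v := by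
  rw [setReg, dif_neg]
  exact hv

theorem eq_setReg (hq : Function.Injective q) {x : ∀ i, B (q i)} {s u : Cfg B}
    (h₁ : ∀ i, u (q i) = x i) (h₂ : ∀ v, v ∉ Set.range q → u v = s v) : u = setReg q x s := by
  funext v
  by_cases hv : v ∈ Set.range q
  · obtain ⟨i, rfl⟩ := hv
    rw [h₁, setReg_apply hq]
  · rw [h₂ v hv, setReg_of_notMem x s hv]

theorem setReg_injective (hq : Function.Injective q) (s : Cfg B) :
    Function.Injective fun x => setReg q x s := by
  intro x y h
  funext i
  have := congrFun h (q i)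
  simpa [setReg_apply hq] using this

theorem setReg_setReg (hq : Function.Injective q) (x y : ∀ i, B (q i)) (s : Cfg B) :
    setReg q x (setReg q y s) = setReg q x s := by
  refine eq_setReg hq (fun i => setReg_apply hq _ _ _) fun v hv => ?_
  rw [setReg_of_notMem _ _ hv, setReg_of_notMem _ _ hv]

theorem setReg_self (hq : Function.Injective q) (s : Cfg B) : setReg q (fun i => s (q i)) s = s :=
  (eq_setReg hq (fun _ => rfl) fun _ _ => rfl).symm

theorem lift_apply_of_agree (A : RegOp B q) {s t : Cfg B}
    (h : ∀ v, v ∉ Set.range q → s v = t v) :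
    lift q A s t = A (fun i => s (q i)) (fun i => t (q i)) := by
  rw [lift, if_pos h]

theorem lift_apply_of_not (A : RegOp B q) {s t : Cfg B}
    (h : ¬ ∀ v, v ∉ Set.range q → s v = t v) : lift q A s t = 0 := by
  rw [lift, if_neg h]

theorem agree_of_lift_ne_zero {A : RegOp B q} {s t : Cfg B} (h : lift q A s t ≠ 0) :
    ∀ v, v ∉ Set.range q → s v = t v := by
  by_contra hn
  exact h (lift_apply_of_not A hn)

theorem lift_setReg (hq : Function.Injective q) (A : RegOp B q) (s : Cfg B) (x : ∀ i, B (q i)) :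
    lift q A s (setReg q x s) = A (fun i => s (q i)) x := by
  rw [lift_apply_of_agree]
  · congr 1
    funext i
    exact setReg_apply hq x s i
  · intro v hv
    rw [setReg_of_notMem _ _ hv]

theorem imul_lift (hq : Function.Injective q) (A A' : RegOp B q) :
    imul (lift q A) (lift q A') = lift q (imul A A') := by
  ext s t
  rw [imul, ← (setReg_injective hq s).tsum_eq (f := fun k => lift q A s k * lift q A' k t)]
  · simp_rw [lift_setReg hq]
    by_cases h : ∀ v, v ∉ Set.range q → s v = t v
    · rw [lift_apply_of_agree _ h, imul]
      refine tsum_congr fun x => ?_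
      rw [lift_apply_of_agree]
      · congr 2
        funext i
        exact setReg_apply hq x s i
      · intro v hv
        rw [setReg_of_notMem _ _ hv, h v hv]
    · rw [lift_apply_of_not _ h]
      convert tsum_zero with x
      rw [lift_apply_of_not, mul_zero]
      refine fun h' => h fun v hv => ?_
      rw [← h' v hv, setReg_of_notMem _ _ hv]
  · intro u hu
    refine ⟨fun i => u (q i), (eq_setReg hq (fun i => rfl) fun v hv => ?_).symm⟩
    exact (agree_of_lift_ne_zero (left_ne_zero_of_mul hu) v hv).symm

theorem conjTranspose_lift (A : RegOp B q) :
    (lift q A).conjTranspose = lift q A.conjTranspose := by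
  ext s t
  rw [Matrix.conjTranspose_apply]
  by_cases h : ∀ v, v ∉ Set.range q → s v = t v
  · rw [lift_apply_of_agree _ h, lift_apply_of_agree _ fun v hv => (h v hv).symm,
      Matrix.conjTranspose_apply]
  · rw [lift_apply_of_not _ h, lift_apply_of_not _ fun h' => h fun v hv => (h' v hv).symm, star_zero]

theorem lift_iid : lift q (iid (∀ i, B (q i))) = iid (Cfg B) := by
  classical
  ext s t
  by_cases h : ∀ v, v ∉ Set.range q → s v = t v
  · rw [lift_apply_of_agree _ h, iid, iid]
    refine if_congr ⟨fun h' => ?_, ?_⟩ rfl rfl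
    · funext v
      by_cases hv : v ∈ Set.range q
      · obtain ⟨i, rfl⟩ := hv
        exact congrFun h' i
      · exact h v hv
    · rintro rfl
      rfl
  · rw [lift_apply_of_not _ h, iid, if_neg]
    rintro rfl
    exact h fun _ _ => rfl

theorem lift_sum {α : Type*} (F : Finset α) (A : α → RegOp B q) :
    lift q (∑ a ∈ F, A a) = ∑ a ∈ F, lift q (A a) := by
  ext s t
  rw [Matrix.sum_apply]
  by_cases h : ∀ v, v ∉ Set.range q → s v = t v
  · simp_rw [lift_apply_of_agree _ h, Matrix.sum_apply]
  · simp_rw [lift_apply_of_not _ h, Finset.sum_const_zero]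

theorem imul_lift_of_isometry (hq : Function.Injective q) {U : RegOp B q}
    (hU : imul U.conjTranspose U = iid _) :
    imul (lift q U).conjTranspose (lift q U) = iid _ := by
  rw [conjTranspose_lift, imul_lift hq, hU, lift_iid]

theorem sum_imul_lift_of_isMeasurement (hq : Function.Injective q) {m : ℕ} {M : Fin m → RegOp B q}
    (hM : IsMeasurement M) :
    ∑ a, imul (lift q (M a)).conjTranspose (lift q (M a)) = iid _ := by
  simp_rw [conjTranspose_lift, imul_lift hq]
  rw [← lift_sum, hM.2, lift_iid]

/-- Exchanging the contents of the register `q` with `x`. -/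
def swapReg (hq : Function.Injective q) :
    Cfg B × (∀ i, B (q i)) ≃ Cfg B × (∀ i, B (q i)) where
  toFun p := (setReg q p.2 p.1, fun i => p.1 (q i))
  invFun p := (setReg q p.2 p.1, fun i => p.1 (q i))
  left_inv p := by
    ext1
    · simp only [setReg_setReg hq, setReg_self hq]
    · funext i
      exact setReg_apply hq _ _ _
  right_inv p := by
    ext1
    · simp only [setReg_setReg hq, setReg_self hq]
    · funext i
      exact setReg_apply hq _ _ _

end Registers

/-! ### Assignments and initializations -/

section Assign

variable {V I : Type} {B : V → Type} {q : I → V}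

/-- Labels of a register, viewed as labels of its range. -/
def rangeEquiv (hq : Function.Injective q) :
    (∀ i, B (q i)) ≃ (∀ v : Set.range q, B v) :=
  Equiv.piCongrLeft (fun v : Set.range q => B v) (Equiv.ofInjective q hq)

theorem overwrite_rangeEquiv (hq : Function.Injective q) (x : ∀ i, B (q i)) (s : Cfg B) :
    overwrite (Set.range q) (rangeEquiv hq x) s = setReg q x s := by
  refine eq_setReg hq (fun i => ?_) fun v hv => ?_
  · rw [overwrite, dif_pos (Set.mem_range_self i)]
    exact Equiv.piCongrLeft_apply_apply (fun v : Set.range q => B v) (Equiv.ofInjective q hq) x i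
  · rw [overwrite, dif_neg hv]

theorem assignReg_apply (hq : Function.Injective q) (σ : RegOp B q)
    (ρ : Matrix (Cfg B) (Cfg B) ℂ) (s t : Cfg B) :
    assignReg q σ ρ s t = (∑' x : ∀ i, B (q i), ρ (setReg q x s) (setReg q x t)) *
      σ (fun i => s (q i)) (fun i => t (q i)) := by
  rw [assignReg, ← (rangeEquiv hq).tsum_eq]
  simp_rw [overwrite_rangeEquiv]

theorem summable_re_diag {ι : Type} {ρ : Matrix ι ι ℂ} (hρ : ρ.PosSemidef) (h : trace ρ ≠ ⊤) :
    Summable fun i => (ρ i i).re := by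
  have := ENNReal.summable_toReal h
  refine this.congr fun i => ?_
  rw [ENNReal.toReal_ofReal (hρ.re_diag_nonneg i)]

theorem summable_entries {ι κ : Type} {ρ : Matrix ι ι ℂ} (hρ : ρ.PosSemidef) (h : trace ρ ≠ ⊤)
    {f g : κ → ι} (hf : Function.Injective f) (hg : Function.Injective g) :
    Summable fun k => ρ (f k) (g k) := by
  have hs := summable_re_diag hρ h
  exact Summable.of_norm_bounded ((hs.comp_injective hf).add (hs.comp_injective hg))
    fun k => hρ.norm_le_diag _ _

theorem posSemidef_assignReg (hq : Function.Injective q) {σ : RegOp B q}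
    (hσ : σ.PosSemidef) {ρ : Matrix (Cfg B) (Cfg B) ℂ} (hρ : ρ.PosSemidef) (h : trace ρ ≠ ⊤) :
    (assignReg q σ ρ).PosSemidef := by
  have h1 : Matrix.PosSemidef (fun s t =>
      ∑' x : ∀ i, B (q i), ρ (setReg q x s) (setReg q x t) : Matrix (Cfg B) (Cfg B) ℂ) := by
    refine posSemidef_of_tendsto (l := atTop) (S := fun F : Finset (∀ i, B (q i)) =>
      ∑ x ∈ F, ρ.submatrix (setReg q x) (setReg q x)) (.of_forall fun F => ?_) fun s t => ?_
    · exact Matrix.posSemidef_sum _ fun x _ => hρ.submatrix _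
    · simp_rw [Matrix.sum_apply, Matrix.submatrix_apply]
      exact (summable_entries hρ h (setReg_injective hq s) (setReg_injective hq t)).hasSum
  refine (h1.hadamard (hσ.submatrix fun s : Cfg B => fun i => s (q i))).of_apply_eq fun s t => ?_
  exact assignReg_apply hq σ ρ s t

theorem trace_assignReg (hq : Function.Injective q) {σ : RegOp B q}
    (hσ : σ.PosSemidef) {ρ : Matrix (Cfg B) (Cfg B) ℂ} (hρ : ρ.PosSemidef) (h : trace ρ ≠ ⊤) :
    trace (assignReg q σ ρ) = trace ρ * trace σ := by
  have h1 : ∀ s, ENNReal.ofReal (assignReg q σ ρ s s).re =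
      ∑' x : ∀ i, B (q i), ENNReal.ofReal (ρ (setReg q x s) (setReg q x s)).re *
        ENNReal.ofReal (σ (fun i => s (q i)) (fun i => s (q i))).re := by
    intro s
    have hs := summable_entries hρ h (setReg_injective hq s) (setReg_injective hq s)
    rw [assignReg_apply hq, hσ.diag_eq, Complex.re_mul_ofReal, Complex.re_tsum hs,
      ENNReal.ofReal_mul (tsum_nonneg fun x => hρ.re_diag_nonneg _),
      ENNReal.ofReal_tsum_of_nonneg (fun x => hρ.re_diag_nonneg _)
        ((Complex.reCLM.summable hs)), ENNReal.tsum_mul_right]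
    simp
  rw [trace, tsum_congr h1]
  -- Exchanging the contents of the register with the summation variable is a bijection of pairs. It
  -- makes the diagonal of `ρ` and that of `σ` depend on different variables, and the double sum
  -- factors.
  have h2 := (swapReg (B := B) hq).tsum_eq fun p => ENNReal.ofReal (ρ p.1 p.1).re *
    ENNReal.ofReal (σ p.2 p.2).re
  rw [ENNReal.tsum_prod', ENNReal.tsum_prod'] at h2
  refine Eq.trans ?_ (h2.trans ?_)
  · rfl
  · simp_rw [ENNReal.tsum_mul_left, ENNReal.tsum_mul_right]
    rfl

theorem unitReg_injective (v : V) : Function.Injective fun _ : Unit => v := fun _ _ _ => rfl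

theorem setReg_unit [DecidableEq V] (v : V) (x : Unit → B v) (s : Cfg B) :
    setReg (fun _ : Unit => v) x s = Function.update s v (x ()) := by
  refine (eq_setReg (unitReg_injective v) (fun i => ?_) fun w hw => ?_).symm
  · simp
  · rw [Function.update_of_ne]
    rintro rfl
    exact hw ⟨(), rfl⟩

/-- The density operator `|0⟩⟨0|` on the variable `v`. -/
def zeroState [∀ v, Zero (B v)] (v : V) : RegOp B (fun _ : Unit => v) :=
  open Classical in fun x y => if x () = 0 ∧ y () = 0 then 1 else 0

/-- Makes initialization a special case of assignment, so it needs no estimates of its own. -/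
theorem initVar_eq_assignReg [∀ v, Zero (B v)] (v : V) (ρ : Matrix (Cfg B) (Cfg B) ℂ) :
    initVar v ρ = assignReg (fun _ : Unit => v) (zeroState v) ρ := by
  classical
  ext s t
  rw [assignReg_apply (unitReg_injective v), initVar, zeroState]
  split_ifs with h
  · rw [mul_one, ← (Equiv.funUnique Unit (B v)).symm.tsum_eq]
    refine tsum_congr fun n => ?_
    rw [setReg_unit, setReg_unit]
    congr 1
  · rw [mul_zero]

theorem posSemidef_zeroState [∀ v, Zero (B v)] (v : V) : (zeroState (B := B) v).PosSemidef := by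
  classical
  refine (posSemidef_rankOne fun x : Unit → B v => if x () = 0 then (1 : ℂ) else 0).of_apply_eq
    fun x y => ?_
  rw [zeroState]
  by_cases h1 : x () = 0 <;> by_cases h2 : y () = 0 <;> simp [h1, h2]

theorem trace_zeroState [∀ v, Zero (B v)] (v : V) : trace (zeroState (B := B) v) = 1 := by
  classical
  rw [trace, tsum_eq_single (fun _ => 0)]
  · simp [zeroState]
  · intro x hx
    have : x () ≠ 0 := fun h => hx (funext fun _ => h)
    simp [zeroState, this]

theorem posSemidef_initVar [∀ v, Zero (B v)] (v : V) {ρ : Matrix (Cfg B) (Cfg B) ℂ}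
    (hρ : ρ.PosSemidef) (h : trace ρ ≠ ⊤) : (initVar v ρ).PosSemidef := by
  rw [initVar_eq_assignReg]
  exact posSemidef_assignReg (unitReg_injective v) (posSemidef_zeroState v) hρ h

theorem trace_initVar [∀ v, Zero (B v)] (v : V) {ρ : Matrix (Cfg B) (Cfg B) ℂ}
    (hρ : ρ.PosSemidef) (h : trace ρ ≠ ⊤) : trace (initVar v ρ) = trace ρ := by
  rw [initVar_eq_assignReg, trace_assignReg (unitReg_injective v) (posSemidef_zeroState v) hρ h,
    trace_zeroState, mul_one]

end Assign

/-! ### Exponentials of skew-Hermitian operators -/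

section Exp

variable {ι : Type} [Fintype ι]

theorem ipow_eq_pow [DecidableEq ι] (A : Matrix ι ι ℂ) (n : ℕ) : ipow A n = A ^ n := by
  induction n with
  | zero => rw [ipow, iid_eq_one, pow_zero]
  | succ n ih => rw [ipow, ih, imul_eq_mul, pow_succ']

theorem iexp_eq_exp [DecidableEq ι] (A : Matrix ι ι ℂ) : iexp A = NormedSpace.exp A := by
  let : SeminormedRing (Matrix ι ι ℂ) := Matrix.linftyOpSemiNormedRing
  let : NormedRing (Matrix ι ι ℂ) := Matrix.linftyOpNormedRing
  let : NormedAlgebra ℂ (Matrix ι ι ℂ) := Matrix.linftyOpNormedAlgebra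
  have h := NormedSpace.exp_series_hasSum_exp' (𝕂 := ℂ) A
  ext i j
  have h2 := (Pi.hasSum.1 (Pi.hasSum.1 h i)) j
  refine Eq.trans ?_ h2.tsum_eq
  refine tsum_congr fun n => ?_
  rw [ipow_eq_pow]
  rfl

theorem iexp_isometry [DecidableEq ι] {A : Matrix ι ι ℂ} (hA : A.conjTranspose = -A) :
    imul (iexp A).conjTranspose (iexp A) = iid ι := by
  rw [iexp_eq_exp, imul_eq_mul, iid_eq_one, ← Matrix.exp_conjTranspose, hA, Matrix.exp_neg,
    Matrix.nonsing_inv_mul]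
  exact (Matrix.isUnit_iff_isUnit_det _).1 (Matrix.isUnit_exp A)

omit [Fintype ι] in
theorem conjTranspose_smul_of_isHermitian {σ : Matrix ι ι ℂ} (hσ : σ.IsHermitian) (x : ℝ) :
    (((Complex.I * (x : ℂ))) • σ).conjTranspose = -((Complex.I * (x : ℂ)) • σ) := by
  rw [Matrix.conjTranspose_smul, hσ]
  simp

end Exp

end

end QWhile

namespace QWhile

noncomputable section

open Filter Topology

/-! ### Positive trace-nonincreasing maps in finite dimension -/

section TNI

variable {ι : Type} [Fintype ι]

/-- The real trace. -/
def rtr (A : Matrix ι ι ℂ) : ℝ := (Matrix.trace A).re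

theorem rtr_add (A A' : Matrix ι ι ℂ) : rtr (A + A') = rtr A + rtr A' := by
  simp [rtr, Matrix.trace_add]

theorem rtr_sub (A A' : Matrix ι ι ℂ) : rtr (A - A') = rtr A - rtr A' := by
  simp [rtr, Matrix.trace_sub]

theorem rtr_zero : rtr (0 : Matrix ι ι ℂ) = 0 := by simp [rtr]

theorem rtr_sum {α : Type*} (F : Finset α) (A : α → Matrix ι ι ℂ) :
    rtr (∑ a ∈ F, A a) = ∑ a ∈ F, rtr (A a) := by
  simp [rtr, Matrix.trace_sum]

theorem rtr_smul (c : ℝ) (A : Matrix ι ι ℂ) : rtr ((c : ℂ) • A) = c * rtr A := by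
  simp [rtr, Matrix.trace_smul]

theorem rtr_nonneg {A : Matrix ι ι ℂ} (hA : 0 ≤ A) : 0 ≤ rtr A :=
  (Complex.le_def.1 (Matrix.nonneg_iff_posSemidef.1 hA).trace_nonneg).1

theorem rtr_mono {A A' : Matrix ι ι ℂ} (h : A ≤ A') : rtr A ≤ rtr A' := by
  have := rtr_nonneg (sub_nonneg.2 h)
  rw [rtr_sub] at this
  linarith

theorem rtr_eq_sum (A : Matrix ι ι ℂ) : rtr A = ∑ i, (A i i).re := by
  simp [rtr, Matrix.trace]

theorem trace_eq_ofReal {A : Matrix ι ι ℂ} (hA : 0 ≤ A) : trace A = ENNReal.ofReal (rtr A) := by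
  rw [trace, tsum_fintype, rtr_eq_sum, ENNReal.ofReal_sum_of_nonneg]
  exact fun i _ => (Matrix.nonneg_iff_posSemidef.1 hA).re_diag_nonneg i

theorem trace_ne_top {A : Matrix ι ι ℂ} : trace A ≠ ⊤ := by
  rw [trace, tsum_fintype]
  exact ENNReal.sum_ne_top.2 fun _ _ => ENNReal.ofReal_ne_top

theorem trace_le_trace_iff {A A' : Matrix ι ι ℂ} (hA : 0 ≤ A) (hA' : 0 ≤ A') :
    trace A ≤ trace A' ↔ rtr A ≤ rtr A' := by
  rw [trace_eq_ofReal hA, trace_eq_ofReal hA', ENNReal.ofReal_le_ofReal_iff (rtr_nonneg hA')]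

theorem trace_eq_trace_iff {A A' : Matrix ι ι ℂ} (hA : 0 ≤ A) (hA' : 0 ≤ A') :
    trace A = trace A' ↔ rtr A = rtr A' := by
  rw [le_antisymm_iff, trace_le_trace_iff hA hA', trace_le_trace_iff hA' hA, ← le_antisymm_iff]

theorem isPartialDensity_iff {A : Matrix ι ι ℂ} : IsPartialDensity A ↔ 0 ≤ A ∧ rtr A ≤ 1 := by
  rw [IsPartialDensity, ← Matrix.nonneg_iff_posSemidef]
  refine and_congr_right fun hA => ?_
  rw [trace_eq_ofReal hA, ENNReal.ofReal_le_one]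

theorem IsPartialDensity.nonneg {κ : Type} {A : Matrix κ κ ℂ} (hA : IsPartialDensity A) : 0 ≤ A :=
  hA.1.nonneg

/-- Linear maps on matrices. -/
abbrev SuperOp (ι : Type) : Type := Module.End ℂ (Matrix ι ι ℂ)

/-- Positive trace-nonincreasing maps. -/
structure IsTNI (L : SuperOp ι) : Prop where
  nonneg : ∀ ρ, 0 ≤ ρ → 0 ≤ L ρ
  rtr_le : ∀ ρ, 0 ≤ ρ → rtr (L ρ) ≤ rtr ρ

theorem IsTNI.mono {L : SuperOp ι} (hL : IsTNI L) {ρ ρ' : Matrix ι ι ℂ} (h : ρ ≤ ρ') :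
    L ρ ≤ L ρ' := by
  have := hL.nonneg _ (sub_nonneg.2 h)
  rwa [map_sub, sub_nonneg] at this

theorem IsTNI.partialDensity {L : SuperOp ι} (hL : IsTNI L) {ρ : Matrix ι ι ℂ}
    (h : IsPartialDensity ρ) : IsPartialDensity (L ρ) := by
  rw [isPartialDensity_iff] at h ⊢
  exact ⟨hL.nonneg _ h.1, (hL.rtr_le _ h.1).trans h.2⟩

theorem isTNI_one : IsTNI (1 : SuperOp ι) := ⟨fun _ h => h, fun _ _ => le_rfl⟩

theorem IsTNI.mul {L L' : SuperOp ι} (hL : IsTNI L) (hL' : IsTNI L') : IsTNI (L * L') :=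
  ⟨fun ρ h => hL.nonneg _ (hL'.nonneg ρ h),
    fun ρ h => (hL.rtr_le _ (hL'.nonneg ρ h)).trans (hL'.rtr_le ρ h)⟩

theorem IsTNI.pow {L : SuperOp ι} (hL : IsTNI L) (n : ℕ) : IsTNI (L ^ n) := by
  induction n with
  | zero => exact isTNI_one
  | succ n ih => rw [pow_succ]; exact ih.mul hL

/-- `ρ ↦ A ρ A†` as a linear map. -/
def sandwichL (A : Matrix ι ι ℂ) : SuperOp ι where
  toFun ρ := sandwich A ρ
  map_add' ρ ρ' := by simp only [sandwich_eq_mul, mul_add, add_mul]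
  map_smul' c ρ := by simp [sandwich_eq_mul]

@[simp]
theorem sandwichL_apply (A ρ : Matrix ι ι ℂ) : sandwichL A ρ = sandwich A ρ := rfl

theorem sandwich_nonneg (A : Matrix ι ι ℂ) {ρ : Matrix ι ι ℂ} (hρ : 0 ≤ ρ) : 0 ≤ sandwich A ρ := by
  rw [sandwich_eq_mul]
  exact ((Matrix.nonneg_iff_posSemidef.1 hρ).mul_mul_conjTranspose_same A).nonneg

theorem sum_rtr_sandwich {α : Type*} [Fintype α] {M : α → Matrix ι ι ℂ}
    (hM : ∑ a, imul (M a).conjTranspose (M a) = iid ι) (ρ : Matrix ι ι ℂ) :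
    ∑ a, rtr (sandwich (M a) ρ) = rtr ρ := by
  classical
  simp_rw [imul_eq_mul, iid_eq_one] at hM
  rw [← rtr_sum, rtr, rtr, Matrix.trace_sum]
  congr 1
  simp_rw [sandwich_eq_mul, Matrix.trace_mul_comm _ (M _).conjTranspose, ← mul_assoc]
  rw [← Matrix.trace_sum, ← Finset.sum_mul, hM, one_mul]

theorem rtr_sandwich {U : Matrix ι ι ℂ} (hU : imul U.conjTranspose U = iid ι)
    (ρ : Matrix ι ι ℂ) : rtr (sandwich U ρ) = rtr ρ := by
  have := sum_rtr_sandwich (α := Unit) (M := fun _ => U) (by simpa using hU) ρ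
  simpa using this

theorem isTNI_sandwichL {U : Matrix ι ι ℂ} (hU : imul U.conjTranspose U = iid ι) :
    IsTNI (sandwichL U) :=
  ⟨fun _ h => sandwich_nonneg U h, fun ρ _ => (rtr_sandwich hU ρ).le⟩

/-- A pair of operators that is trace-nonincreasing. -/
structure IsTNIPair (E₀ E₁ : SuperOp ι) : Prop where
  nonneg₀ : ∀ ρ, 0 ≤ ρ → 0 ≤ E₀ ρ
  nonneg₁ : ∀ ρ, 0 ≤ ρ → 0 ≤ E₁ ρ
  rtr_add : ∀ ρ, rtr (E₀ ρ) + rtr (E₁ ρ) = rtr ρ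

theorem isTNIPair_sandwichL {M : Fin 2 → Matrix ι ι ℂ}
    (hM : ∑ a, imul (M a).conjTranspose (M a) = iid ι) :
    IsTNIPair (sandwichL (M 0)) (sandwichL (M 1)) :=
  ⟨fun _ => sandwich_nonneg _, fun _ => sandwich_nonneg _, fun ρ => by
    simpa using sum_rtr_sandwich hM ρ⟩

theorem IsTNIPair.left {E₀ E₁ : SuperOp ι} (h : IsTNIPair E₀ E₁) : IsTNI E₀ :=
  ⟨h.nonneg₀, fun ρ hρ => by linarith [h.rtr_add ρ, rtr_nonneg (h.nonneg₁ ρ hρ)]⟩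

theorem IsTNIPair.right {E₀ E₁ : SuperOp ι} (h : IsTNIPair E₀ E₁) : IsTNI E₁ :=
  ⟨h.nonneg₁, fun ρ hρ => by linarith [h.rtr_add ρ, rtr_nonneg (h.nonneg₀ ρ hρ)]⟩

/-- `n` rounds of a loop, `∑_{l < n} E₀ ∘ Wˡ`. -/
def loopL (E₀ W : SuperOp ι) (n : ℕ) : SuperOp ι := ∑ l ∈ Finset.range n, E₀ * W ^ l

omit [Fintype ι] in
theorem loopL_apply (E₀ W : SuperOp ι) (n : ℕ) (ρ : Matrix ι ι ℂ) :
    loopL E₀ W n ρ = ∑ l ∈ Finset.range n, E₀ ((W ^ l) ρ) := by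
  simp [loopL, LinearMap.sum_apply]

omit [Fintype ι] in
theorem loopL_zero (E₀ W : SuperOp ι) : loopL E₀ W 0 = 0 := by simp [loopL]

omit [Fintype ι] in
theorem loopL_succ (E₀ W : SuperOp ι) (n : ℕ) (ρ : Matrix ι ι ℂ) :
    loopL E₀ W (n + 1) ρ = loopL E₀ W n ρ + E₀ ((W ^ n) ρ) := by
  rw [loopL_apply, loopL_apply, Finset.sum_range_succ]

omit [Fintype ι] in
theorem loopL_succ' (E₀ W : SuperOp ι) (n : ℕ) (ρ : Matrix ι ι ℂ) :
    loopL E₀ W (n + 1) ρ = loopL E₀ W n (W ρ) + E₀ ρ := by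
  rw [loopL_apply, loopL_apply, Finset.sum_range_succ']
  simp [pow_succ]

/-- What exits through `E₀` and what enters the body add up to what is present, so the exits of any
number of rounds cannot exceed the input. -/
theorem isTNI_loopL {E₀ E₁ L : SuperOp ι} (hE : IsTNIPair E₀ E₁) (hL : IsTNI L) (n : ℕ) :
    IsTNI (loopL E₀ (L * E₁) n) := by
  have hW := hL.mul hE.right
  induction n with
  | zero => exact ⟨by simp [loopL_zero], fun ρ h => by simpa [loopL_zero, rtr_zero] using rtr_nonneg h⟩
  | succ n ih =>
    refine ⟨fun ρ h => ?_, fun ρ h => ?_⟩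
    · rw [loopL_succ']
      exact add_nonneg (ih.nonneg _ (hW.nonneg _ h)) (hE.nonneg₀ _ h)
    · rw [loopL_succ', rtr_add]
      have h1 := ih.rtr_le _ (hW.nonneg _ h)
      have h2 := hL.rtr_le _ (hE.nonneg₁ _ h)
      have h3 := hE.rtr_add ρ
      simp only [Module.End.mul_apply] at h1 h2 h3 ⊢
      linarith

theorem pow_le_pow_of_le {W W' : SuperOp ι} (hW : IsTNI W) (hW' : IsTNI W')
    (h : ∀ ρ, 0 ≤ ρ → W ρ ≤ W' ρ) (n : ℕ) {ρ : Matrix ι ι ℂ} (hρ : 0 ≤ ρ) :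
    (W ^ n) ρ ≤ (W' ^ n) ρ := by
  induction n with
  | zero => exact le_rfl
  | succ n ih =>
    rw [pow_succ', pow_succ', Module.End.mul_apply, Module.End.mul_apply]
    exact (hW.mono ih).trans (h _ ((hW'.pow n).nonneg _ hρ))

theorem loopL_le_loopL {E₀ E₁ L L' : SuperOp ι} (hE : IsTNIPair E₀ E₁) (hL : IsTNI L)
    (hL' : IsTNI L') (h : ∀ ρ, 0 ≤ ρ → L ρ ≤ L' ρ) (n : ℕ) {ρ : Matrix ι ι ℂ} (hρ : 0 ≤ ρ) :
    loopL E₀ (L * E₁) n ρ ≤ loopL E₀ (L' * E₁) n ρ := by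
  rw [loopL_apply, loopL_apply]
  exact Finset.sum_le_sum fun l _ => hE.left.mono
    (pow_le_pow_of_le (hL.mul hE.right) (hL'.mul hE.right)
      (fun ρ hρ => h _ (hE.nonneg₁ _ hρ)) l hρ)

theorem loopL_mono {E₀ E₁ L : SuperOp ι} (hE : IsTNIPair E₀ E₁) (hL : IsTNI L)
    {ρ : Matrix ι ι ℂ} (hρ : 0 ≤ ρ) : Monotone fun n => loopL E₀ (L * E₁) n ρ := by
  refine monotone_nat_of_le_succ fun n => ?_
  rw [loopL_succ]
  exact le_add_of_nonneg_right (hE.nonneg₀ _ (((hL.mul hE.right).pow n).nonneg _ hρ))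

/-- If one round of `L'` exceeds one round of `L` by at most the fraction `c` of the trace, then `n`
rounds of the loops differ by at most `n - 1` times that. -/
theorem rtr_loopL_sub_le {E₀ E₁ L L' : SuperOp ι} (hE : IsTNIPair E₀ E₁) (hL : IsTNI L)
    (hL' : IsTNI L') (h : ∀ ρ, 0 ≤ ρ → L ρ ≤ L' ρ) {c : ℝ} (hc : 0 ≤ c)
    (hd : ∀ ρ, IsPartialDensity ρ → rtr (L' ρ) - rtr (L ρ) ≤ c * rtr ρ) (n : ℕ)
    {ρ : Matrix ι ι ℂ} (hρ : IsPartialDensity ρ) :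
    rtr (loopL E₀ (L' * E₁) (n + 1) ρ) - rtr (loopL E₀ (L * E₁) (n + 1) ρ) ≤ n * c * rtr ρ := by
  induction n generalizing ρ with
  | zero => simp [loopL_succ, loopL_zero]
  | succ n ih =>
    rw [loopL_succ', loopL_succ' E₀ (L * E₁), rtr_add, rtr_add]
    simp only [Module.End.mul_apply]
    have hρ1 := hE.right.partialDensity hρ
    -- Two replacements are made: the body in all later rounds costs `h1`, and the first execution
    -- of the body costs `h2`, since the later rounds of `L` do not increase the trace of the
    -- difference (`h3`).
    have h1 := ih (hL'.partialDensity hρ1)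
    have h2 := hd _ hρ1
    have h3 := (isTNI_loopL hE hL (n + 1)).rtr_le _ (sub_nonneg.2 (h _ hρ1.nonneg))
    rw [map_sub, rtr_sub, rtr_sub] at h3
    have h4 := hL'.rtr_le _ hρ1.nonneg
    have h5 := hE.right.rtr_le _ hρ.nonneg
    have h6 : n * c * rtr (L' (E₁ ρ)) ≤ n * c * rtr ρ :=
      mul_le_mul_of_nonneg_left (h4.trans h5) (by positivity)
    have h7 : c * rtr (E₁ ρ) ≤ c * rtr ρ := mul_le_mul_of_nonneg_left h5 hc
    push_cast
    linarith

/-! ### Monotone approximation of matrices -/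

/-- The positive matrices `X k` are below `Y` and their traces tend to that of `Y`. -/
structure Approx (X : ℕ → Matrix ι ι ℂ) (Y : Matrix ι ι ℂ) : Prop where
  nonneg : ∀ k, 0 ≤ X k
  le : ∀ k, X k ≤ Y
  tendsto : Tendsto (fun k => rtr (X k)) atTop (𝓝 (rtr Y))

theorem Approx.const {Y : Matrix ι ι ℂ} (hY : 0 ≤ Y) : Approx (fun _ => Y) Y :=
  ⟨fun _ => hY, fun _ => le_rfl, tendsto_const_nhds⟩

/-- The maps may vary with `k`: the error made by feeding `X k` instead of `Y` has trace at most
tr(Y - X k), whatever trace-nonincreasing map is applied. -/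
theorem Approx.comp {X : ℕ → Matrix ι ι ℂ} {Y Z : Matrix ι ι ℂ} {L : ℕ → SuperOp ι}
    (h : Approx X Y) (hL : ∀ k, IsTNI (L k)) (hZ : Approx (fun k => L k Y) Z) :
    Approx (fun k => L k (X k)) Z := by
  refine ⟨fun k => (hL k).nonneg _ (h.nonneg k), fun k => ((hL k).mono (h.le k)).trans (hZ.le k), ?_⟩
  have h1 : Tendsto (fun k => rtr (L k Y) - (rtr Y - rtr (X k))) atTop (𝓝 (rtr Z)) := by
    have := hZ.tendsto.sub (h.tendsto.const_sub (rtr Y))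
    simpa using this
  refine tendsto_of_tendsto_of_tendsto_of_le_of_le h1 hZ.tendsto (fun k => ?_) fun k => ?_
  · have := (hL k).rtr_le _ (sub_nonneg.2 (h.le k))
    rw [map_sub, rtr_sub, rtr_sub] at this
    linarith
  · exact rtr_mono ((hL k).mono (h.le k))

theorem Approx.sum {α : Type*} {F : Finset α} {X : α → ℕ → Matrix ι ι ℂ} {Y : α → Matrix ι ι ℂ}
    (h : ∀ a ∈ F, Approx (X a) (Y a)) : Approx (fun k => ∑ a ∈ F, X a k) (∑ a ∈ F, Y a) := by
  refine ⟨fun k => Finset.sum_nonneg fun a ha => (h a ha).nonneg k,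
    fun k => Finset.sum_le_sum fun a ha => (h a ha).le k, ?_⟩
  simp_rw [rtr_sum]
  exact tendsto_finsetSum _ fun a ha => (h a ha).tendsto

end TNI

end

end QWhile

namespace QWhile

noncomputable section

open Filter Topology

/-! ### Loops of trace-nonincreasing maps -/

section Loops

variable {ι : Type}

theorem IsPartialDensity.trace_ne_top {A : Matrix ι ι ℂ} (hA : IsPartialDensity A) :
    trace A ≠ ⊤ := ne_top_of_le_ne_top ENNReal.one_ne_top hA.2

/-- The assumptions on the body and the guard of a loop. -/
structure IsLoop (F E₀ E₁ : Matrix ι ι ℂ → Matrix ι ι ℂ) : Prop where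
  body : ∀ ρ, IsPartialDensity ρ → IsPartialDensity (F ρ)
  body_trace : ∀ ρ, IsPartialDensity ρ → trace (F ρ) ≤ trace ρ
  exit : ∀ ρ, ρ.PosSemidef → (E₀ ρ).PosSemidef
  enter : ∀ ρ, ρ.PosSemidef → (E₁ ρ).PosSemidef
  guard_trace : ∀ ρ, ρ.PosSemidef → trace (E₀ ρ) + trace (E₁ ρ) = trace ρ

variable {F E₀ E₁ : Matrix ι ι ℂ → Matrix ι ι ℂ}

theorem IsLoop.enter_partialDensity (h : IsLoop F E₀ E₁) {ρ : Matrix ι ι ℂ}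
    (hρ : IsPartialDensity ρ) : IsPartialDensity (E₁ ρ) :=
  ⟨h.enter ρ hρ.1, (le_add_self.trans (h.guard_trace ρ hρ.1).le).trans hρ.2⟩

theorem IsLoop.iterate_partialDensity (h : IsLoop F E₀ E₁) {ρ : Matrix ι ι ℂ}
    (hρ : IsPartialDensity ρ) (n : ℕ) : IsPartialDensity ((fun ρ' => F (E₁ ρ'))^[n] ρ) := by
  induction n with
  | zero => exact hρ
  | succ n ih =>
    rw [Function.iterate_succ_apply']
    exact h.body _ (h.enter_partialDensity ih)

theorem IsLoop.sum_posSemidef (h : IsLoop F E₀ E₁) {ρ : Matrix ι ι ℂ}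
    (hρ : IsPartialDensity ρ) (n : ℕ) :
    (∑ l ∈ Finset.range n, E₀ ((fun ρ' => F (E₁ ρ'))^[l] ρ)).PosSemidef :=
  Matrix.posSemidef_sum _ fun l _ => h.exit _ (h.iterate_partialDensity hρ l).1

/-- A supermartingale bound: what has left the loop plus what still runs never exceeds the start.
The functional is abstract because the bound serves both the trace and the weighted masses `wmass`.
-/
theorem IsLoop.functional_le (h : IsLoop F E₀ E₁) {Φ : Matrix ι ι ℂ → ℝ≥0∞} (hΦ0 : Φ 0 = 0)
    (hΦ : ∀ A A' : Matrix ι ι ℂ, A.PosSemidef → A'.PosSemidef → Φ (A + A') = Φ A + Φ A')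
    (hE : ∀ ρ, ρ.PosSemidef → Φ (E₀ ρ) + Φ (E₁ ρ) = Φ ρ)
    (hF : ∀ ρ, IsPartialDensity ρ → Φ (F ρ) ≤ Φ ρ) {ρ : Matrix ι ι ℂ}
    (hρ : IsPartialDensity ρ) (n : ℕ) :
    Φ (∑ l ∈ Finset.range n, E₀ ((fun ρ' => F (E₁ ρ'))^[l] ρ)) +
      Φ ((fun ρ' => F (E₁ ρ'))^[n] ρ) ≤ Φ ρ := by
  induction n with
  | zero => simp [hΦ0]
  | succ n ih =>
    have hn := h.iterate_partialDensity hρ n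
    rw [Finset.sum_range_succ, hΦ _ _ (h.sum_posSemidef hρ n) (h.exit _ hn.1),
      Function.iterate_succ_apply', add_assoc]
    refine (add_le_add_right ?_ _).trans ih
    rw [← hE _ hn.1]
    exact add_le_add_right (hF _ (h.enter_partialDensity hn)) _

/-- Conservation of mass. It turns almost sure termination into the vanishing of the part that is
still running. -/
theorem IsLoop.trace_eq (h : IsLoop F E₀ E₁)
    (hF : ∀ ρ, IsPartialDensity ρ → trace (F ρ) = trace ρ) {ρ : Matrix ι ι ℂ}
    (hρ : IsPartialDensity ρ) (n : ℕ) :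
    trace (∑ l ∈ Finset.range n, E₀ ((fun ρ' => F (E₁ ρ'))^[l] ρ)) +
      trace ((fun ρ' => F (E₁ ρ'))^[n] ρ) = trace ρ := by
  induction n with
  | zero => simp [trace_zero]
  | succ n ih =>
    have hn := h.iterate_partialDensity hρ n
    rw [Finset.sum_range_succ, trace_add (h.sum_posSemidef hρ n) (h.exit _ hn.1),
      Function.iterate_succ_apply', add_assoc, hF _ (h.enter_partialDensity hn),
      h.guard_trace _ hn.1, ih]

theorem IsLoop.sum_partialDensity (h : IsLoop F E₀ E₁) {ρ : Matrix ι ι ℂ}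
    (hρ : IsPartialDensity ρ) (n : ℕ) :
    IsPartialDensity (∑ l ∈ Finset.range n, E₀ ((fun ρ' => F (E₁ ρ'))^[l] ρ)) := by
  refine ⟨h.sum_posSemidef hρ n, (le_self_add.trans
    (h.functional_le trace_zero (fun _ _ => trace_add) h.guard_trace h.body_trace hρ n)).trans hρ.2⟩

theorem IsLoop.sum_mono (h : IsLoop F E₀ E₁) {ρ : Matrix ι ι ℂ} (hρ : IsPartialDensity ρ) :
    Monotone fun n => ∑ l ∈ Finset.range n, E₀ ((fun ρ' => F (E₁ ρ'))^[l] ρ) := by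
  refine monotone_nat_of_le_succ fun n => ?_
  rw [Finset.sum_range_succ]
  exact le_add_of_nonneg_right (h.exit _ (h.iterate_partialDensity hρ n).1).nonneg

theorem IsLoop.loewnerSup_spec (h : IsLoop F E₀ E₁) {ρ : Matrix ι ι ℂ} (hρ : IsPartialDensity ρ) :
    IsPartialDensity (loewnerSup fun n => ∑ l ∈ Finset.range (n + 1),
        E₀ ((fun ρ' => F (E₁ ρ'))^[l] ρ)) ∧
      ∀ i j, Tendsto (fun n => (∑ l ∈ Finset.range (n + 1),
        E₀ ((fun ρ' => F (E₁ ρ'))^[l] ρ)) i j) atTop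
          (𝓝 ((loewnerSup fun n => ∑ l ∈ Finset.range (n + 1),
            E₀ ((fun ρ' => F (E₁ ρ'))^[l] ρ)) i j)) :=
  loewnerSup_tendsto (fun _ _ hmn => h.sum_mono hρ (Nat.succ_le_succ hmn))
    fun n => h.sum_partialDensity hρ (n + 1)

theorem IsLoop.sum_le_loewnerSup (h : IsLoop F E₀ E₁) {ρ : Matrix ι ι ℂ}
    (hρ : IsPartialDensity ρ) (n : ℕ) :
    ∑ l ∈ Finset.range n, E₀ ((fun ρ' => F (E₁ ρ'))^[l] ρ) ≤
      loewnerSup fun n => ∑ l ∈ Finset.range (n + 1), E₀ ((fun ρ' => F (E₁ ρ'))^[l] ρ) := by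
  refine posSemidef_of_tendsto (l := atTop) (S := fun m =>
    (∑ l ∈ Finset.range (m + 1), E₀ ((fun ρ' => F (E₁ ρ'))^[l] ρ)) -
      ∑ l ∈ Finset.range n, E₀ ((fun ρ' => F (E₁ ρ'))^[l] ρ)) ?_ fun i j => ?_
  · filter_upwards [eventually_ge_atTop n] with m hm
    exact h.sum_mono hρ (hm.trans (Nat.le_succ m))
  · exact ((h.loewnerSup_spec hρ).2 i j).sub_const _

theorem rtr_tendsto [Fintype ι] {S : ℕ → Matrix ι ι ℂ} {A : Matrix ι ι ℂ}
    (h : ∀ i j, Tendsto (fun n => S n i j) atTop (𝓝 (A i j))) :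
    Tendsto (fun n => rtr (S n)) atTop (𝓝 (rtr A)) := by
  simp_rw [rtr_eq_sum]
  exact tendsto_finsetSum _ fun i _ => (Complex.continuous_re.tendsto _).comp (h i i)

end Loops

/-! ### The truncated semantics -/

section Truncated

variable {V : Type} [Finite V] {B : V → Type} [∀ v, Finite (B v)]

/-- `ρ ↦ tr_q(ρ) ⊗ σ` as a linear map. -/
def assignL {I : Type} (q : I → V) (σ : RegOp B q) : SuperOp (Cfg B) where
  toFun ρ := assignReg q σ ρ
  map_add' ρ ρ' := by
    ext s t
    have := fun τ : Matrix (Cfg B) (Cfg B) ℂ => (Set.toFinite (Function.support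
      fun a : (∀ v : Set.range q, B v) =>
        τ (overwrite (Set.range q) a s) (overwrite (Set.range q) a t)))
    simp only [assignReg, Matrix.add_apply]
    rw [Summable.tsum_add (summable_of_hasFiniteSupport (this ρ))
      (summable_of_hasFiniteSupport (this ρ')), add_mul]
  map_smul' c ρ := by
    ext s t
    simp [assignReg, tsum_mul_left, mul_assoc]

@[simp]
theorem assignL_apply {I : Type} (q : I → V) (σ : RegOp B q) (ρ : Matrix (Cfg B) (Cfg B) ℂ) :
    assignL q σ ρ = assignReg q σ ρ := rfl

/-- `initVar` as a linear map. -/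
def initL [∀ v, Zero (B v)] (v : V) : SuperOp (Cfg B) :=
  assignL (fun _ : Unit => v) (zeroState v)

@[simp]
theorem initL_apply [∀ v, Zero (B v)] (v : V) (ρ : Matrix (Cfg B) (Cfg B) ℂ) :
    initL v ρ = initVar v ρ := by
  rw [initVar_eq_assignReg]
  rfl

end Truncated

variable {V : Type} [Fintype V] [DecidableEq V] {B : V → Type} [∀ v, Fintype (B v)]
  [∀ v, DecidableEq (B v)] [∀ v, Zero (B v)] {k : ℕ}

/-- The semantics in which every execution of a loop is cut off after `n` iterations. -/
def tsem (n : ℕ) (θ : Fin k → ℝ) : Prog k B → SuperOp (Cfg B)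
  | .skip => 1
  | .init v => initL v
  | .assign q σ => assignL q σ
  | .unitary q U => sandwichL (lift q U)
  | .rot j q σ => sandwichL (lift q (iexp ((-(Complex.I * (θ j : ℂ))) • σ)))
  | .seq P Q => tsem n θ Q * tsem n θ P
  | .branch q _ M P => ∑ a, tsem n θ (P a) * sandwichL (lift q (M a))
  | .loop q M Q => loopL (sandwichL (lift q (M 0))) (tsem n θ Q * sandwichL (lift q (M 1))) (n + 1)

theorem isTNI_assignL {I : Type} {q : I → V} (hq : Function.Injective q) {σ : RegOp B q}
    (hσ : IsDensity σ) : IsTNI (assignL q σ) := by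
  have h1 : ∀ ρ : Matrix (Cfg B) (Cfg B) ℂ, 0 ≤ ρ → 0 ≤ assignL q σ ρ := fun ρ hρ =>
    (posSemidef_assignReg hq hσ.1 (Matrix.nonneg_iff_posSemidef.1 hρ) trace_ne_top).nonneg
  refine ⟨h1, fun ρ hρ => ?_⟩
  rw [← trace_le_trace_iff (h1 ρ hρ) hρ, assignL_apply,
    trace_assignReg hq hσ.1 (Matrix.nonneg_iff_posSemidef.1 hρ) trace_ne_top, hσ.2, mul_one]

theorem isDensity_zeroState (v : V) : IsDensity (zeroState (B := B) v) :=
  ⟨posSemidef_zeroState v, trace_zeroState v⟩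

theorem isTNI_initL (v : V) : IsTNI (initL (B := B) v) :=
  isTNI_assignL (unitReg_injective v) (isDensity_zeroState v)

theorem rot_isometry {I : Type} [Finite I] {q : I → V} {σ : RegOp B q}
    (hσ : σ.PosSemidef) (x : ℝ) :
    imul (iexp ((-(Complex.I * (x : ℂ))) • σ)).conjTranspose
      (iexp ((-(Complex.I * (x : ℂ))) • σ)) = iid _ := by
  classical
  have := Fintype.ofFinite I
  refine iexp_isometry ?_
  have := conjTranspose_smul_of_isHermitian hσ.1 (-x)
  simpa using this

theorem isTNI_branch {m : ℕ} {M : Fin m → Matrix (Cfg B) (Cfg B) ℂ}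
    (hM : ∑ a, imul (M a).conjTranspose (M a) = iid (Cfg B)) {L : Fin m → SuperOp (Cfg B)}
    (hL : ∀ a, IsTNI (L a)) : IsTNI (∑ a, L a * sandwichL (M a)) := by
  refine ⟨fun ρ hρ => ?_, fun ρ hρ => ?_⟩
  · rw [LinearMap.sum_apply]
    exact Finset.sum_nonneg fun a _ => (hL a).nonneg _ (sandwich_nonneg _ hρ)
  · rw [LinearMap.sum_apply, rtr_sum, ← sum_rtr_sandwich hM ρ]
    exact Finset.sum_le_sum fun a _ => (hL a).rtr_le _ (sandwich_nonneg _ hρ)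

theorem isTNI_tsem (n : ℕ) (θ : Fin k → ℝ) : ∀ P : Prog k B, P.WF → IsTNI (tsem n θ P)
  | .skip, _ => isTNI_one
  | .init v, _ => isTNI_initL v
  | .assign _ _, h => isTNI_assignL h.2.1 h.2.2
  | .unitary _ _, h => isTNI_sandwichL (imul_lift_of_isometry h.2.1 h.2.2.1)
  | .rot _ _ _, h => by
    have := h.1
    exact isTNI_sandwichL (imul_lift_of_isometry h.2.1 (rot_isometry h.2.2.1 _))
  | .seq P Q, h => (isTNI_tsem n θ Q h.2).mul (isTNI_tsem n θ P h.1)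
  | .branch _ _ _ P, h => isTNI_branch (sum_imul_lift_of_isMeasurement h.2.1 h.2.2.1) fun a =>
    isTNI_tsem n θ (P a) (h.2.2.2 a)
  | .loop _ _ Q, h => isTNI_loopL
    (isTNIPair_sandwichL (sum_imul_lift_of_isMeasurement h.2.1 h.2.2.1)) (isTNI_tsem n θ Q h.2.2.2) _

/-- Loops grow for two reasons: the truncated body grows, and one more round is allowed. -/
theorem tsem_le_succ (n : ℕ) (θ : Fin k → ℝ) : ∀ P : Prog k B, P.WF →
    ∀ ρ, 0 ≤ ρ → tsem n θ P ρ ≤ tsem (n + 1) θ P ρ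
  | .skip, _, _, _ => le_rfl
  | .init _, _, _, _ => le_rfl
  | .assign _ _, _, _, _ => le_rfl
  | .unitary _ _, _, _, _ => le_rfl
  | .rot _ _ _, _, _, _ => le_rfl
  | .seq P Q, h, ρ, hρ =>
    ((isTNI_tsem n θ Q h.2).mono (tsem_le_succ n θ P h.1 ρ hρ)).trans
      (tsem_le_succ n θ Q h.2 _ ((isTNI_tsem (n + 1) θ P h.1).nonneg ρ hρ))
  | .branch q m M P, h, ρ, hρ => by
    simp only [tsem, LinearMap.sum_apply]
    exact Finset.sum_le_sum fun a _ => tsem_le_succ n θ (P a) (h.2.2.2 a) _ (sandwich_nonneg _ hρ)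
  | .loop q M Q, h, ρ, hρ => by
    have hE := isTNIPair_sandwichL (sum_imul_lift_of_isMeasurement h.2.1 h.2.2.1)
    have hQ := fun n => isTNI_tsem n θ Q h.2.2.2
    exact (loopL_le_loopL hE (hQ n) (hQ (n + 1)) (tsem_le_succ n θ Q h.2.2.2) _ hρ).trans
      (loopL_mono hE (hQ (n + 1)) hρ (Nat.le_succ _))

end

end QWhile

namespace QWhile

noncomputable section

open Filter Topology

variable {V : Type} [Fintype V] [DecidableEq V] {B : V → Type} [∀ v, Fintype (B v)]
  [∀ v, DecidableEq (B v)] [∀ v, Zero (B v)] {k : ℕ}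

/-! ### The truncated semantics approximates the semantics -/

section Finite

variable {ι : Type} [Fintype ι]

theorem trace_add_trace_of_isMeasurement {M : Fin 2 → Matrix ι ι ℂ}
    (hM : ∑ a, imul (M a).conjTranspose (M a) = iid ι) (ρ : Matrix ι ι ℂ) (hρ : ρ.PosSemidef) :
    trace (sandwich (M 0) ρ) + trace (sandwich (M 1) ρ) = trace ρ := by
  have h0 := sandwich_nonneg (M 0) hρ.nonneg
  have h1 := sandwich_nonneg (M 1) hρ.nonneg
  rw [trace_eq_ofReal h0, trace_eq_ofReal h1, trace_eq_ofReal hρ.nonneg,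
    ← ENNReal.ofReal_add (rtr_nonneg h0) (rtr_nonneg h1)]
  congr 1
  simpa using sum_rtr_sandwich hM ρ

theorem isLoop_of_isMeasurement {M : Fin 2 → Matrix ι ι ℂ}
    (hM : ∑ a, imul (M a).conjTranspose (M a) = iid ι) {F : Matrix ι ι ℂ → Matrix ι ι ℂ}
    (hF : ∀ ρ, IsPartialDensity ρ → IsPartialDensity (F ρ) ∧ rtr (F ρ) ≤ rtr ρ) :
    IsLoop F (sandwich (M 0)) (sandwich (M 1)) where
  body ρ hρ := (hF ρ hρ).1
  body_trace ρ hρ := (trace_le_trace_iff (hF ρ hρ).1.nonneg hρ.nonneg).2 (hF ρ hρ).2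
  exit _ hρ := Matrix.nonneg_iff_posSemidef.1 (sandwich_nonneg _ hρ.nonneg)
  enter _ hρ := Matrix.nonneg_iff_posSemidef.1 (sandwich_nonneg _ hρ.nonneg)
  guard_trace := trace_add_trace_of_isMeasurement hM

variable {F : Matrix ι ι ℂ → Matrix ι ι ℂ} {E₀ E₁ : SuperOp ι} {L : ℕ → SuperOp ι}

theorem approx_iterate (hE : IsTNIPair E₀ E₁) (hl : IsLoop F E₀ E₁) (hL : ∀ n, IsTNI (L n))
    (hF : ∀ ρ, IsPartialDensity ρ → Approx (fun n => L n ρ) (F ρ)) {ρ : Matrix ι ι ℂ}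
    (hρ : IsPartialDensity ρ) (l : ℕ) :
    Approx (fun n => ((L n * E₁) ^ l) ρ) ((fun ρ' => F (E₁ ρ'))^[l] ρ) := by
  induction l with
  | zero => exact Approx.const hρ.nonneg
  | succ l ih =>
    simp_rw [pow_succ', Module.End.mul_apply, Function.iterate_succ_apply']
    have hl' := hl.iterate_partialDensity hρ l
    refine Approx.comp (L := L) (ih.comp (L := fun _ => E₁) (fun _ => hE.right)
      (Approx.const (hl.enter _ hl'.1).nonneg)) hL ?_
    exact hF _ (hl.enter_partialDensity hl')

/-- An exchange of limits. For a fixed number of rounds the truncated bodies converge; finitely many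
rounds already come close to the trace of the supremum, and all later truncations contain those
rounds. -/
theorem approx_loop (hE : IsTNIPair E₀ E₁) (hl : IsLoop F E₀ E₁) (hL : ∀ n, IsTNI (L n))
    (hF : ∀ ρ, IsPartialDensity ρ → Approx (fun n => L n ρ) (F ρ)) {ρ : Matrix ι ι ℂ}
    (hρ : IsPartialDensity ρ) :
    Approx (fun n => loopL E₀ (L n * E₁) (n + 1) ρ)
      (loewnerSup fun n => ∑ l ∈ Finset.range (n + 1), E₀ ((fun ρ' => F (E₁ ρ'))^[l] ρ)) := by
  have hsum : ∀ m, Approx (fun n => loopL E₀ (L n * E₁) m ρ)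
      (∑ l ∈ Finset.range m, E₀ ((fun ρ' => F (E₁ ρ'))^[l] ρ)) := by
    intro m
    simp_rw [loopL_apply]
    refine Approx.sum fun l _ => (approx_iterate hE hl hL hF hρ l).comp (L := fun _ => E₀)
      (fun _ => hE.left) (Approx.const (hl.exit _ (hl.iterate_partialDensity hρ l).1).nonneg)
  have hle : ∀ n, loopL E₀ (L n * E₁) (n + 1) ρ ≤
      loewnerSup fun n => ∑ l ∈ Finset.range (n + 1), E₀ ((fun ρ' => F (E₁ ρ'))^[l] ρ) :=
    fun n => ((hsum (n + 1)).le n).trans (hl.sum_le_loewnerSup hρ (n + 1))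
  refine ⟨fun n => (isTNI_loopL hE (hL n) _).nonneg _ hρ.nonneg, hle, ?_⟩
  refine tendsto_order.2 ⟨fun a ha => ?_, fun a ha => ?_⟩
  · have h1 := rtr_tendsto (hl.loewnerSup_spec hρ).2
    obtain ⟨m, hm⟩ := (h1.eventually (lt_mem_nhds ha)).exists
    filter_upwards [(hsum (m + 1)).tendsto.eventually (lt_mem_nhds hm), eventually_ge_atTop m]
      with n hn hmn
    exact hn.trans_le (rtr_mono (loopL_mono hE (hL n) hρ.nonneg (Nat.succ_le_succ hmn)))
  · exact .of_forall fun n => (rtr_mono (hle n)).trans_lt ha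

end Finite

/-! ### Consequences for the semantics: approximation from below and preservation of the trace -/

theorem Approx.rtr_le {ι : Type} [Fintype ι] {X : ℕ → Matrix ι ι ℂ} {Y : Matrix ι ι ℂ} {c : ℝ}
    (h : Approx X Y) (hc : ∀ n, rtr (X n) ≤ c) : rtr Y ≤ c := le_of_tendsto' h.tendsto hc

theorem Approx.partialDensity {ι : Type} [Fintype ι] {X : ℕ → Matrix ι ι ℂ} {Y ρ : Matrix ι ι ℂ}
    (h : Approx X Y) (hρ : IsPartialDensity ρ) (hc : ∀ n, rtr (X n) ≤ rtr ρ) :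
    IsPartialDensity Y ∧ rtr Y ≤ rtr ρ := by
  have h1 := h.rtr_le hc
  rw [isPartialDensity_iff] at hρ ⊢
  exact ⟨⟨(h.nonneg 0).trans (h.le 0), h1.trans hρ.2⟩, h1⟩

/-- This is the bridge between `sem`, controlled only on partial density operators because of the
supremum, and the linear maps `tsem n`, to which positivity and trace arguments apply. -/
theorem approx_sem (θ : Fin k → ℝ) : ∀ P : Prog k B, P.WF → ∀ ρ, IsPartialDensity ρ →
    Approx (fun n => tsem n θ P ρ) (P.sem θ ρ)
  | .skip, _, ρ, hρ => Approx.const hρ.nonneg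
  | .init v, _, ρ, hρ => by
    simp only [tsem, Prog.sem, initL_apply]
    have h := Approx.const ((isTNI_initL v).partialDensity hρ).nonneg
    rwa [initL_apply] at h
  | .assign q σ, h, ρ, hρ => Approx.const ((isTNI_tsem 0 θ (.assign q σ) h).nonneg ρ hρ.nonneg)
  | .unitary q U, h, ρ, hρ => Approx.const ((isTNI_tsem 0 θ (.unitary q U) h).nonneg ρ hρ.nonneg)
  | .rot j q σ, h, ρ, hρ => Approx.const ((isTNI_tsem 0 θ (.rot j q σ) h).nonneg ρ hρ.nonneg)
  | .seq P Q, h, ρ, hρ => by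
    have hP := approx_sem θ P h.1 ρ hρ
    have hPd := hP.partialDensity hρ fun n => (isTNI_tsem n θ P h.1).rtr_le ρ hρ.nonneg
    exact hP.comp (fun n => isTNI_tsem n θ Q h.2) (approx_sem θ Q h.2 _ hPd.1)
  | .branch q m M P, h, ρ, hρ => by
    simp only [tsem, Prog.sem, LinearMap.sum_apply]
    refine Approx.sum fun a _ => approx_sem θ (P a) (h.2.2.2 a) _ ?_
    have hM := sum_imul_lift_of_isMeasurement h.2.1 h.2.2.1
    rw [isPartialDensity_iff] at hρ ⊢
    refine ⟨sandwich_nonneg _ hρ.1, le_trans ?_ hρ.2⟩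
    rw [← sum_rtr_sandwich hM ρ]
    exact Finset.single_le_sum (f := fun a => rtr (sandwich (lift q (M a)) ρ))
      (fun a _ => rtr_nonneg (sandwich_nonneg _ hρ.1)) (Finset.mem_univ a)
  | .loop q M Q, h, ρ, hρ => by
    have hM := sum_imul_lift_of_isMeasurement h.2.1 h.2.2.1
    have hQ := fun n => isTNI_tsem n θ Q h.2.2.2
    have hA := approx_sem θ Q h.2.2.2
    exact approx_loop (isTNIPair_sandwichL hM) (isLoop_of_isMeasurement hM fun ρ hρ =>
      (hA ρ hρ).partialDensity hρ fun n => (hQ n).rtr_le ρ hρ.nonneg) hQ hA hρ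

theorem sem_partialDensity (θ : Fin k → ℝ) {P : Prog k B} (hP : P.WF)
    {ρ : Matrix (Cfg B) (Cfg B) ℂ} (hρ : IsPartialDensity ρ) :
    IsPartialDensity (P.sem θ ρ) ∧ rtr (P.sem θ ρ) ≤ rtr ρ :=
  (approx_sem θ P hP ρ hρ).partialDensity hρ fun n => (isTNI_tsem n θ P hP).rtr_le ρ hρ.nonneg

theorem isLoop_sem (θ : Fin k → ℝ) {I : Type} {q : I → V} {M : Fin 2 → RegOp B q} {Q : Prog k B}
    (h : (Prog.loop q M Q).WF) :
    IsLoop (Q.sem θ) (sandwich (lift q (M 0))) (sandwich (lift q (M 1))) :=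
  isLoop_of_isMeasurement (sum_imul_lift_of_isMeasurement h.2.1 h.2.2.1) fun _ =>
    sem_partialDensity θ h.2.2.2

theorem branch_partialDensity {I : Type} {q : I → V} {m : ℕ} {M : Fin m → RegOp B q}
    (hM : ∑ a, imul (lift q (M a)).conjTranspose (lift q (M a)) = iid (Cfg B))
    {ρ : Matrix (Cfg B) (Cfg B) ℂ} (hρ : IsPartialDensity ρ) (a : Fin m) :
    IsPartialDensity (sandwich (lift q (M a)) ρ) := by
  rw [isPartialDensity_iff] at hρ ⊢
  refine ⟨sandwich_nonneg _ hρ.1, le_trans ?_ hρ.2⟩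
  rw [← sum_rtr_sandwich hM ρ]
  exact Finset.single_le_sum (f := fun a => rtr (sandwich (lift q (M a)) ρ))
    (fun a _ => rtr_nonneg (sandwich_nonneg _ hρ.1)) (Finset.mem_univ a)

theorem rtr_assignReg {I : Type} {q : I → V} (hq : Function.Injective q) {σ : RegOp B q}
    (hσ : IsDensity σ) {ρ : Matrix (Cfg B) (Cfg B) ℂ} (hρ : 0 ≤ ρ) :
    rtr (assignReg q σ ρ) = rtr ρ := by
  have h := (isTNI_assignL hq hσ).nonneg ρ hρ
  rw [assignL_apply] at h
  rw [← trace_eq_trace_iff h hρ, trace_assignReg hq hσ.1 (Matrix.nonneg_iff_posSemidef.1 hρ) trace_ne_top, hσ.2, mul_one]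

theorem rtr_sem (θ : Fin k → ℝ) : ∀ P : Prog k B, P.WF → P.AllLoopsTerminate θ →
    ∀ ρ, IsPartialDensity ρ → rtr (P.sem θ ρ) = rtr ρ
  | .skip, _, _, _, _ => rfl
  | .init v, _, _, ρ, hρ => by
    rw [Prog.sem, initVar_eq_assignReg]
    exact rtr_assignReg (unitReg_injective v) (isDensity_zeroState v) hρ.nonneg
  | .assign _ _, h, _, _, hρ => rtr_assignReg h.2.1 h.2.2 hρ.nonneg
  | .unitary _ _, h, _, _, _ => rtr_sandwich (imul_lift_of_isometry h.2.1 h.2.2.1) _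
  | .rot _ _ _, h, _, _, _ => by
    have := h.1
    exact rtr_sandwich (imul_lift_of_isometry h.2.1 (rot_isometry h.2.2.1 _)) _
  | .seq P Q, h, ht, ρ, hρ =>
    (rtr_sem θ Q h.2 ht.2 _ (sem_partialDensity θ h.1 hρ).1).trans (rtr_sem θ P h.1 ht.1 ρ hρ)
  | .branch q m M P, h, ht, ρ, hρ => by
    have hM := sum_imul_lift_of_isMeasurement h.2.1 h.2.2.1
    rw [Prog.sem, rtr_sum, ← sum_rtr_sandwich hM ρ]
    exact Finset.sum_congr rfl fun a _ =>
      rtr_sem θ (P a) (h.2.2.2 a) (ht a) _ (branch_partialDensity hM hρ a)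
  | .loop q M Q, h, ht, ρ, hρ => by
    rw [← trace_eq_trace_iff (sem_partialDensity θ h hρ).1.nonneg hρ.nonneg]
    exact ht.1 ρ hρ

theorem tendsto_rtr_tsem (θ : Fin k → ℝ) {P : Prog k B} (hP : P.WF) (ht : P.AllLoopsTerminate θ)
    {ρ : Matrix (Cfg B) (Cfg B) ℂ} (hρ : IsPartialDensity ρ) :
    Tendsto (fun n => rtr (tsem n θ P ρ)) atTop (𝓝 (rtr ρ)) := by
  rw [← rtr_sem θ P hP ht ρ hρ]
  exact (approx_sem θ P hP ρ hρ).tendsto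

/-! ### Decay of the loops -/

section Decay

variable {ι : Type} [Fintype ι] [DecidableEq ι]

theorem le_smul_one {A : Matrix ι ι ℂ} (hA : A.IsHermitian) {r : ℝ}
    (h : ∀ x ∈ spectrum ℝ A, x ≤ r) : A ≤ (r : ℂ) • (1 : Matrix ι ι ℂ) := by
  have := le_algebraMap_of_spectrum_le h (show IsSelfAdjoint A from hA)
  rw [Algebra.algebraMap_eq_smul_one] at this
  convert this using 1
  ext i j
  simp [Matrix.smul_apply]

theorem le_rtr_smul_one {A : Matrix ι ι ℂ} (hA : 0 ≤ A) :
    A ≤ (rtr A : ℂ) • (1 : Matrix ι ι ℂ) := by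
  have hA' := Matrix.nonneg_iff_posSemidef.1 hA
  refine le_smul_one hA'.1 fun x hx => ?_
  rw [hA'.1.spectrum_real_eq_range_eigenvalues] at hx
  obtain ⟨i, rfl⟩ := hx
  have : rtr A = ∑ i, hA'.1.eigenvalues i := by
    rw [rtr, hA'.1.trace_eq_sum_eigenvalues]
    simp
  rw [this]
  exact Finset.single_le_sum (f := hA'.1.eigenvalues) (fun i _ => hA'.eigenvalues_nonneg i)
    (Finset.mem_univ i)

variable {F : Matrix ι ι ℂ → Matrix ι ι ℂ} {E₀ E₁ : SuperOp ι} {L : ℕ → SuperOp ι}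

/-- Every `ρ` is at most tr(ρ) · I, a multiple of the maximally mixed state `ρ₁`. It is enough to
wait until the loop has almost terminated on `ρ₁`; the same number of rounds then works for all
inputs. Linearity and monotonicity are used on the truncations, and the bound passes to the limit.
-/
theorem exists_iterate_contraction [Nonempty ι] (hE : IsTNIPair E₀ E₁) (hl : IsLoop F E₀ E₁)
    (hL : ∀ n, IsTNI (L n)) (hF : ∀ ρ, IsPartialDensity ρ → Approx (fun n => L n ρ) (F ρ))
    (hFt : ∀ ρ, IsPartialDensity ρ → rtr (F ρ) = rtr ρ)
    (ht : ∀ ρ, IsPartialDensity ρ → rtr (loewnerSup fun n => ∑ l ∈ Finset.range (n + 1),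
      E₀ ((fun ρ' => F (E₁ ρ'))^[l] ρ)) = rtr ρ) {ε : ℝ} (hε : 0 < ε) :
    ∃ N : ℕ, 0 < N ∧ ∀ ρ, IsPartialDensity ρ →
      rtr ((fun ρ' => F (E₁ ρ'))^[N] ρ) ≤ ε * rtr ρ := by
  set W := fun ρ' => F (E₁ ρ') with hW
  set d : ℝ := (Fintype.card ι : ℝ) with hd
  have hd0 : 0 < d := by simp [d, Fintype.card_pos]
  set ρ₁ : Matrix ι ι ℂ := ((d⁻¹ : ℝ) : ℂ) • (1 : Matrix ι ι ℂ) with hρ₁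
  have h1 : rtr (1 : Matrix ι ι ℂ) = d := by simp [rtr, d]
  have hρ₁d : IsPartialDensity ρ₁ := by
    rw [isPartialDensity_iff]
    refine ⟨(Matrix.PosSemidef.one.smul ?_).nonneg, ?_⟩
    · exact Complex.zero_le_real.2 (by positivity)
    · rw [rtr_smul, h1, inv_mul_cancel₀ hd0.ne']
  -- The running mass is the total mass minus the mass that has exited, and the latter tends to all
  -- of it by termination.
  have hlim : Tendsto (fun n => rtr (W^[n] ρ₁)) atTop (𝓝 0) := by
    rw [← tendsto_add_atTop_iff_nat 1]
    have h2 := (rtr_tendsto (hl.loewnerSup_spec hρ₁d).2).const_sub (rtr ρ₁)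
    rw [ht ρ₁ hρ₁d, sub_self] at h2
    refine h2.congr fun n => ?_
    have h3 := hl.trace_eq (fun ρ hρ => (trace_eq_trace_iff (hl.body ρ hρ).nonneg hρ.nonneg).2
      (hFt ρ hρ)) hρ₁d (n + 1)
    have h4 := (hl.sum_partialDensity hρ₁d (n + 1)).nonneg
    have h5 := (hl.iterate_partialDensity hρ₁d (n + 1)).nonneg
    rw [trace_eq_ofReal h4, trace_eq_ofReal h5, trace_eq_ofReal hρ₁d.nonneg,
      ← ENNReal.ofReal_add (rtr_nonneg h4) (rtr_nonneg h5),
      ENNReal.ofReal_eq_ofReal_iff (add_nonneg (rtr_nonneg h4) (rtr_nonneg h5))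
        (rtr_nonneg hρ₁d.nonneg)] at h3
    rw [← h3]
    exact add_sub_cancel_left _ _
  obtain ⟨N, hN, hN1⟩ := ((hlim.eventually (gt_mem_nhds (show 0 < ε / d by positivity))).and
    (eventually_gt_atTop 0)).exists
  refine ⟨N, hN1, fun ρ hρ => ?_⟩
  refine (approx_iterate hE hl hL hF hρ N).rtr_le fun n => ?_
  have hWn := ((hL n).mul hE.right).pow N
  have h2 := rtr_mono (hWn.mono (le_rtr_smul_one hρ.nonneg))
  -- Rescaling I to a state brings in the factor `d`, which the threshold ε / d for `ρ₁`
  -- compensates.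
  have h3 : (rtr ρ : ℂ) • (1 : Matrix ι ι ℂ) = ((rtr ρ * d : ℝ) : ℂ) • ρ₁ := by
    rw [hρ₁, smul_smul, ← Complex.ofReal_mul, mul_assoc, mul_inv_cancel₀ hd0.ne', mul_one]
  rw [h3, map_smul, rtr_smul] at h2
  have h4 := rtr_mono ((approx_iterate hE hl hL hF hρ₁d N).le n)
  have h5 := rtr_nonneg hρ.nonneg
  refine h2.trans ?_
  calc rtr ρ * d * rtr (((L n * E₁) ^ N) ρ₁) ≤ rtr ρ * d * (ε / d) := by
        gcongr
        exact h4.trans hN.le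
    _ = ε * rtr ρ := by field_simp

/-- Split n as n % N plus N · (n / N): each full block of `N` rounds contracts by `ε`, and the
remaining rounds do not increase the trace. -/
theorem rtr_iterate_le_pow (hE : IsTNIPair E₀ E₁) (hl : IsLoop F E₀ E₁)
    (hFt : ∀ ρ, IsPartialDensity ρ → rtr (F ρ) ≤ rtr ρ) {ε : ℝ} (hε : 0 ≤ ε) {N : ℕ}
    (hN : ∀ ρ, IsPartialDensity ρ → rtr ((fun ρ' => F (E₁ ρ'))^[N] ρ) ≤ ε * rtr ρ) (n : ℕ)
    {ρ : Matrix ι ι ℂ} (hρ : IsPartialDensity ρ) :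
    rtr ((fun ρ' => F (E₁ ρ'))^[n] ρ) ≤ ε ^ (n / N) * rtr ρ := by
  have h1 : ∀ m (ρ : Matrix ι ι ℂ), IsPartialDensity ρ →
      rtr ((fun ρ' => F (E₁ ρ'))^[m] ρ) ≤ rtr ρ := by
    intro m ρ hρ
    induction m with
    | zero => exact le_rfl
    | succ m ih =>
      rw [Function.iterate_succ_apply']
      have hm := hl.iterate_partialDensity hρ m
      exact ((hFt _ (hl.enter_partialDensity hm)).trans (hE.right.rtr_le _ hm.nonneg)).trans ih
  have h2 : ∀ m (ρ : Matrix ι ι ℂ), IsPartialDensity ρ →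
      rtr ((fun ρ' => F (E₁ ρ'))^[N * m] ρ) ≤ ε ^ m * rtr ρ := by
    intro m ρ hρ
    induction m with
    | zero => simp
    | succ m ih =>
      rw [Nat.mul_succ, Nat.add_comm, Function.iterate_add_apply, pow_succ', mul_assoc]
      exact (hN _ (hl.iterate_partialDensity hρ _)).trans (mul_le_mul_of_nonneg_left ih hε)
  conv_lhs => rw [← Nat.mod_add_div n N, Function.iterate_add_apply]
  exact (h1 _ _ (hl.iterate_partialDensity hρ _)).trans (h2 _ ρ hρ)

end Decay

/-- A larger `N` lowers the exponent and so weakens the bound, as ε < 1. The maximum of the values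
found for the finitely many loops therefore serves them all. -/
theorem AllLoopsDecay.mono {θ : Fin k → ℝ} {ε : ℝ} (hε₀ : 0 < ε) (hε₁ : ε < 1) {N N' : ℕ}
    (hN : 0 < N) (hNN' : N ≤ N') : ∀ P : Prog k B, P.AllLoopsDecay θ ε N → P.AllLoopsDecay θ ε N'
  | .skip, _ => trivial
  | .init _, _ => trivial
  | .assign _ _, _ => trivial
  | .unitary _ _, _ => trivial
  | .rot _ _ _, _ => trivial
  | .seq P Q, h => ⟨AllLoopsDecay.mono hε₀ hε₁ hN hNN' P h.1, AllLoopsDecay.mono hε₀ hε₁ hN hNN' Q h.2⟩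
  | .branch _ _ _ P, h => fun a => AllLoopsDecay.mono hε₀ hε₁ hN hNN' (P a) (h a)
  | .loop q M Q, h => by
    refine ⟨fun n ρ hρ => (h.1 n ρ hρ).trans ?_, AllLoopsDecay.mono hε₀ hε₁ hN hNN' Q h.2⟩
    gcongr ENNReal.ofReal ?_ * _
    exact pow_le_pow_of_le_one hε₀.le hε₁.le (Nat.div_le_div_left hNN' hN)

theorem exists_allLoopsDecay {θ : Fin k → ℝ} {ε : ℝ} (hε₀ : 0 < ε) (hε₁ : ε < 1) :
    ∀ P : Prog k B, P.WF → P.AllLoopsTerminate θ → ∃ N : ℕ, 0 < N ∧ P.AllLoopsDecay θ ε N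
  | .skip, _, _ => ⟨1, one_pos, trivial⟩
  | .init _, _, _ => ⟨1, one_pos, trivial⟩
  | .assign _ _, _, _ => ⟨1, one_pos, trivial⟩
  | .unitary _ _, _, _ => ⟨1, one_pos, trivial⟩
  | .rot _ _ _, _, _ => ⟨1, one_pos, trivial⟩
  | .seq P Q, h, ht => by
    obtain ⟨N, hN, hP⟩ := exists_allLoopsDecay hε₀ hε₁ P h.1 ht.1
    obtain ⟨N', hN', hQ⟩ := exists_allLoopsDecay hε₀ hε₁ Q h.2 ht.2
    exact ⟨max N N', lt_max_of_lt_left hN,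
      AllLoopsDecay.mono hε₀ hε₁ hN (le_max_left _ _) P hP,
      AllLoopsDecay.mono hε₀ hε₁ hN' (le_max_right _ _) Q hQ⟩
  | .branch _ m _ P, h, ht => by
    have := fun a => exists_allLoopsDecay hε₀ hε₁ (P a) (h.2.2.2 a) (ht a)
    choose N hN hP using this
    refine ⟨Finset.univ.sup N + 1, Nat.succ_pos _, fun a => AllLoopsDecay.mono hε₀ hε₁ (hN a) ?_
      (P a) (hP a)⟩
    exact (Finset.le_sup (Finset.mem_univ a)).trans (Nat.le_succ _)
  | .loop q M Q, h, ht => by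
    obtain ⟨N', hN', hQ⟩ := exists_allLoopsDecay hε₀ hε₁ Q h.2.2.2 ht.2
    have hM := sum_imul_lift_of_isMeasurement h.2.1 h.2.2.1
    have hE := isTNIPair_sandwichL hM
    have hl := isLoop_sem θ h
    obtain ⟨N, hN, hc⟩ := exists_iterate_contraction hE hl
      (fun n => isTNI_tsem n θ Q h.2.2.2) (approx_sem θ Q h.2.2.2)
      (rtr_sem θ Q h.2.2.2 ht.2) (fun ρ hρ => rtr_sem θ _ h ht ρ hρ) hε₀
    refine ⟨max N N', lt_max_of_lt_left hN, fun n ρ hρ => ?_,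
      AllLoopsDecay.mono hε₀ hε₁ hN' (le_max_right _ _) Q hQ⟩
    have hi := hl.iterate_partialDensity hρ n
    have h1 := rtr_iterate_le_pow hE hl (fun ρ hρ => (rtr_sem θ Q h.2.2.2 ht.2 ρ hρ).le) hε₀.le hc
      n hρ
    refine (le_self_add.trans (hl.guard_trace _ hi.1).le).trans ?_
    rw [trace_eq_ofReal hi.nonneg, trace_eq_ofReal hρ.nonneg, ← ENNReal.ofReal_mul (by positivity)]
    refine ENNReal.ofReal_le_ofReal (h1.trans (mul_le_mul_of_nonneg_right ?_ (rtr_nonneg hρ.nonneg)))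
    exact pow_le_pow_of_le_one hε₀.le hε₁.le (Nat.div_le_div_left (le_max_left _ _) hN)

end

end QWhile

namespace QWhile

noncomputable section

open Filter Topology

/-! ### The difference of consecutive truncations -/

/-- The coefficient `a + m (m + 1)^(a - 1) - m` for `a` loops, of which the longest runs `m + 1`
iterations. -/
def loopCoeff (m : ℕ) : ℕ → ℝ
  | 0 => 0
  | a + 1 => a + 1 + m * ((m + 1 : ℝ) ^ a - 1)

theorem loopCoeff_eq (m a : ℕ) :
    loopCoeff m a = (a : ℝ) + (((m + 1 : ℕ) : ℝ) - 1) *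
      max 0 ((((m + 1 : ℕ) : ℝ)) ^ ((a : ℤ) - 1) - 1) := by
  have hm : (1 : ℝ) ≤ (m + 1 : ℕ) := by exact_mod_cast Nat.succ_le_succ (Nat.zero_le m)
  cases a with
  | zero =>
    -- Without loops the exponent is -1 and the power is at most 1, so the positive part vanishes.
    rw [max_eq_left]
    · simp [loopCoeff]
    · have : ((m + 1 : ℕ) : ℝ) ^ (((0 : ℕ) : ℤ) - 1) ≤ 1 := by
        rw [Nat.cast_zero, zero_sub, zpow_neg, zpow_one]
        exact inv_le_one_of_one_le₀ hm
      linarith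
  | succ a =>
    rw [Nat.cast_succ a, Nat.cast_succ a, add_sub_cancel_right, zpow_natCast, max_eq_right]
    · simp [loopCoeff]
    · linarith [one_le_pow₀ (n := a) hm]

theorem loopCoeff_nonneg (m a : ℕ) : 0 ≤ loopCoeff m a := by
  cases a with
  | zero => exact le_rfl
  | succ a =>
    have : (1 : ℝ) ≤ ((m : ℝ) + 1) ^ a := one_le_pow₀ (by linarith [m.cast_nonneg (α := ℝ)])
    have : 0 ≤ (m : ℝ) * (((m : ℝ) + 1) ^ a - 1) := mul_nonneg m.cast_nonneg (by linarith)
    rw [loopCoeff]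
    positivity

/-- Superadditivity serves sequences and branches, where loop counts add. With x = (m+1)^a and y =
(m+1)^b both at least 1, it reduces to x + y ≤ xy + 1 ≤ (m+1)xy + 1. -/
theorem loopCoeff_add_le (m a b : ℕ) : loopCoeff m a + loopCoeff m b ≤ loopCoeff m (a + b) := by
  cases a with
  | zero => simp [loopCoeff]
  | succ a =>
    cases b with
    | zero => simp [loopCoeff]
    | succ b =>
      have hm : (0 : ℝ) ≤ m := m.cast_nonneg
      have ha : (1 : ℝ) ≤ ((m : ℝ) + 1) ^ a := one_le_pow₀ (by linarith)
      have hb : (1 : ℝ) ≤ ((m : ℝ) + 1) ^ b := one_le_pow₀ (by linarith)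
      rw [show a + 1 + (b + 1) = a + b + 1 + 1 by ring]
      simp only [loopCoeff]
      have : ((m : ℝ) + 1) ^ a + ((m : ℝ) + 1) ^ b ≤ ((m : ℝ) + 1) ^ (a + b + 1) + 1 := by
        rw [pow_succ, pow_add]
        nlinarith [mul_nonneg (sub_nonneg.2 ha) (sub_nonneg.2 hb),
          mul_nonneg hm (mul_nonneg (zero_le_one.trans ha) (zero_le_one.trans hb))]
      have := mul_le_mul_of_nonneg_left this hm
      push_cast
      linarith

/-- The recursion for a loop around `a` loops: 1 pays for the additional round and `m` copies of the
coefficient pay for the executions of the body. After Bernoulli's inequality for (m+1)^a, what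
remains is (a+1)(m² - m + 1) ≥ 0. -/
theorem one_add_loopCoeff_le (m a : ℕ) : 1 + m * loopCoeff m a ≤ loopCoeff m (a + 1) := by
  cases a with
  | zero => simp [loopCoeff]
  | succ a =>
    simp only [loopCoeff]
    have hm : (0 : ℝ) ≤ m := m.cast_nonneg
    have ha : (0 : ℝ) ≤ a := a.cast_nonneg
    have hX : 1 + a * (m : ℝ) ≤ ((m : ℝ) + 1) ^ a := by
      rw [add_comm (m : ℝ) 1]
      exact one_add_mul_le_pow (by linarith) a
    have h1 := mul_le_mul_of_nonneg_left hX hm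
    have h2 : 0 ≤ ((a : ℝ) + 1) * ((m : ℝ) * m - m + 1) :=
      mul_nonneg (by positivity) (by nlinarith [sq_nonneg ((m : ℝ) - 1)])
    rw [pow_succ]
    push_cast
    nlinarith

theorem sum_loopCoeff_le {α : Type*} (m : ℕ) (F : Finset α) (a : α → ℕ) :
    ∑ i ∈ F, loopCoeff m (a i) ≤ loopCoeff m (∑ i ∈ F, a i) := by
  classical
  induction F using Finset.induction_on with
  | empty => simp [loopCoeff]
  | insert i F hi ih =>
    rw [Finset.sum_insert hi, Finset.sum_insert hi]
    linarith [loopCoeff_add_le m (a i) (∑ i ∈ F, a i)]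

variable {V : Type} [Fintype V] [DecidableEq V] {B : V → Type} [∀ v, Fintype (B v)]
  [∀ v, DecidableEq (B v)] [∀ v, Zero (B v)] {k : ℕ}

theorem rtr_le_of_trace_le {ι : Type} [Fintype ι] {A ρ : Matrix ι ι ℂ} {c : ℝ} (hc : 0 ≤ c)
    (hA : 0 ≤ A) (hρ : 0 ≤ ρ) (h : trace A ≤ ENNReal.ofReal c * trace ρ) :
    rtr A ≤ c * rtr ρ := by
  rwa [trace_eq_ofReal hA, trace_eq_ofReal hρ, ← ENNReal.ofReal_mul hc,
    ENNReal.ofReal_le_ofReal_iff (mul_nonneg hc (rtr_nonneg hρ))] at h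

/-- Passing from `m` to `m + 1` changes a loop in two ways: its body is truncated later in the
common rounds, handled by induction through `rtr_loopL_sub_le`, and one round is added, handled by
the decay hypothesis. The coefficients combine by the inequalities for `loopCoeff`. -/
theorem rtr_tsem_succ_sub_le (θ : Fin k → ℝ) {ε : ℝ} (hε : 0 < ε) (N m : ℕ) :
    ∀ P : Prog k B, P.WF → P.AllLoopsDecay θ ε N → ∀ ρ, IsPartialDensity ρ →
      rtr (tsem (m + 1) θ P ρ) - rtr (tsem m θ P ρ) ≤
        loopCoeff m P.loopCount * ε ^ ((m + 1) / N) * rtr ρ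
  | .skip, _, _, _, _ => by simp [tsem, loopCoeff, Prog.loopCount]
  | .init _, _, _, _, _ => by simp [tsem, loopCoeff, Prog.loopCount]
  | .assign _ _, _, _, _, _ => by simp [tsem, loopCoeff, Prog.loopCount]
  | .unitary _ _, _, _, _, _ => by simp [tsem, loopCoeff, Prog.loopCount]
  | .rot _ _ _, _, _, _, _ => by simp [tsem, loopCoeff, Prog.loopCount]
  | .seq P Q, h, hd, ρ, hρ => by
    have hP := rtr_tsem_succ_sub_le θ hε N m P h.1 hd.1 ρ hρ
    have hPd := (isTNI_tsem (m + 1) θ P h.1).partialDensity hρ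
    have hQ := rtr_tsem_succ_sub_le θ hε N m Q h.2 hd.2 _ hPd
    have hle := (isTNI_tsem m θ Q h.2).rtr_le _
      (sub_nonneg.2 (tsem_le_succ m θ P h.1 ρ hρ.nonneg))
    rw [map_sub, rtr_sub, rtr_sub] at hle
    have h1 := (isTNI_tsem (m + 1) θ P h.1).rtr_le ρ hρ.nonneg
    have he : 0 ≤ ε ^ ((m + 1) / N) := by positivity
    have h2 := mul_le_mul_of_nonneg_left h1 (mul_nonneg (loopCoeff_nonneg m Q.loopCount) he)
    have h3 := mul_le_mul_of_nonneg_right (loopCoeff_add_le m P.loopCount Q.loopCount)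
      (mul_nonneg he (rtr_nonneg hρ.nonneg))
    simp only [tsem, Module.End.mul_apply, Prog.loopCount]
    linarith
  | .branch q n M P, h, hd, ρ, hρ => by
    have hM := sum_imul_lift_of_isMeasurement h.2.1 h.2.2.1
    simp only [tsem, LinearMap.sum_apply, Module.End.mul_apply, sandwichL_apply, Prog.loopCount,
      rtr_sum]
    rw [← Finset.sum_sub_distrib]
    have he : 0 ≤ ε ^ ((m + 1) / N) := by positivity
    -- Charging every branch with the whole trace is wasteful but harmless, because the loop count
    -- adds over branches.
    have h1 : ∀ a, rtr (sandwich (lift q (M a)) ρ) ≤ rtr ρ := fun a => by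
      rw [← sum_rtr_sandwich hM ρ]
      exact Finset.single_le_sum (f := fun a => rtr (sandwich (lift q (M a)) ρ))
        (fun a _ => rtr_nonneg (sandwich_nonneg _ hρ.nonneg)) (Finset.mem_univ a)
    calc _ ≤ ∑ a, loopCoeff m (P a).loopCount * ε ^ ((m + 1) / N) * rtr ρ :=
          Finset.sum_le_sum fun a _ => (rtr_tsem_succ_sub_le θ hε N m (P a) (h.2.2.2 a) (hd a) _
            (branch_partialDensity hM hρ a)).trans (mul_le_mul_of_nonneg_left (h1 a)
              (mul_nonneg (loopCoeff_nonneg m _) he))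
      _ = (∑ a, loopCoeff m (P a).loopCount) * ε ^ ((m + 1) / N) * rtr ρ := by
          rw [Finset.sum_mul, Finset.sum_mul]
      _ ≤ _ := mul_le_mul_of_nonneg_right (mul_le_mul_of_nonneg_right
          (sum_loopCoeff_le m _ _) he) (rtr_nonneg hρ.nonneg)
  | .loop q M Q, h, hd, ρ, hρ => by
    have hM := sum_imul_lift_of_isMeasurement h.2.1 h.2.2.1
    have hE := isTNIPair_sandwichL hM
    have hQ := fun n => isTNI_tsem n θ Q h.2.2.2
    have he : 0 ≤ ε ^ ((m + 1) / N) := by positivity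
    have h1 := rtr_loopL_sub_le hE (hQ m) (hQ (m + 1)) (tsem_le_succ m θ Q h.2.2.2)
      (mul_nonneg (loopCoeff_nonneg m Q.loopCount) he)
      (rtr_tsem_succ_sub_le θ hε N m Q h.2.2.2 hd.2) m hρ
    have hl := isLoop_sem θ h
    have hit := hl.iterate_partialDensity hρ (m + 1)
    -- The added round is compared with the exit of the true loop after `m + 1` iterations, which
    -- lies above its truncation (`h3`) and is controlled by the decay hypothesis.
    have h2 := rtr_le_of_trace_le he (sandwich_nonneg _ hit.nonneg) hρ.nonneg (hd.1 (m + 1) ρ hρ)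
    have h3 := rtr_mono (hE.left.mono ((approx_iterate hE hl hQ (approx_sem θ Q h.2.2.2) hρ
      (m + 1)).le (m + 1)))
    have h4 := mul_le_mul_of_nonneg_right (one_add_loopCoeff_le m Q.loopCount)
      (mul_nonneg he (rtr_nonneg hρ.nonneg))
    simp only [tsem, Prog.loopCount]
    rw [loopL_succ _ _ (m + 1), rtr_add]
    simp only [sandwichL_apply] at h3 ⊢
    linarith

end

end QWhile

namespace QWhile

noncomputable section

open Filter Topology

/-! ### Operators on registers with finitely supported rows -/

section LiftRows

variable {V I κ : Type} {B : V → Type} {q : I → V}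

theorem rowSupport_lift (hq : Function.Injective q) {A : RegOp B q}
    {φ : (∀ i, B (q i)) → κ → ∀ i, B (q i)} (h : RowSupport A φ) :
    RowSupport (lift q A) fun s k => setReg q (φ (fun i => s (q i)) k) s where
  inj s k k' hkk' := h.inj _ (setReg_injective hq s hkk')
  mem s u hu := by
    have hag := agree_of_lift_ne_zero hu
    rw [lift_apply_of_agree _ hag] at hu
    obtain ⟨k, hk⟩ := h.mem _ _ hu
    refine ⟨k, (eq_setReg hq (fun i => ?_) fun v hv => (hag v hv).symm).symm⟩
    rw [hk]

theorem sandwich_lift_apply [Fintype κ] (hq : Function.Injective q) {A : RegOp B q}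
    {φ : (∀ i, B (q i)) → κ → ∀ i, B (q i)} (h : RowSupport A φ)
    (τ : Matrix (Cfg B) (Cfg B) ℂ) (s t : Cfg B) :
    sandwich (lift q A) τ s t = ∑ k, ∑ k',
      A (fun i => s (q i)) (φ (fun i => s (q i)) k) *
        τ (setReg q (φ (fun i => s (q i)) k) s) (setReg q (φ (fun i => t (q i)) k') t) *
        star (A (fun i => t (q i)) (φ (fun i => t (q i)) k')) := by
  rw [(rowSupport_lift hq h).sandwich_apply]
  simp_rw [lift_setReg hq]

theorem posSemidef_sandwich_lift [Fintype κ] (hq : Function.Injective q) {A : RegOp B q}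
    {φ : (∀ i, B (q i)) → κ → ∀ i, B (q i)} (h : RowSupport A φ)
    {τ : Matrix (Cfg B) (Cfg B) ℂ} (hτ : τ.PosSemidef) : (sandwich (lift q A) τ).PosSemidef :=
  (rowSupport_lift hq h).posSemidef_sandwich hτ

theorem rowSupport_univ {ι : Type} (A : Matrix ι ι ℂ) : RowSupport A fun _ k => k :=
  ⟨fun _ _ _ h => h, fun _ u _ => ⟨u, rfl⟩⟩

end LiftRows

/-! ### Configurations of the differential program -/

section Mk

variable {V : Type} {B : V → Type}

/-- The labels of `qc`, `q₁`, `q₂`. -/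
abbrev Ctl : Type := ℤ × Fin 2 × Fin 2

/-- The label with the values `s` of the program variables, `r` of their copies, and `p` of
`qc, q₁, q₂`. -/
def mk (s r : Cfg B) (p : Ctl) : Cfg (DiffB B)
  | .inl v => s v
  | .inr (.copy v) => r v
  | .inr .qc => p.1
  | .inr .q1 => p.2.1
  | .inr .q2 => p.2.2

/-- The label of `qc, q₁, q₂` in a configuration. -/
def ctl (u : Cfg (DiffB B)) : Ctl := (u (.inr .qc), u (.inr .q1), u (.inr .q2))

/-- The label of the program variables in a configuration. -/
def progPart (u : Cfg (DiffB B)) : Cfg B := fun v => u (.inl v)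

/-- The label of the copies in a configuration. -/
def copyPart (u : Cfg (DiffB B)) : Cfg B := fun v => u (.inr (.copy v))

theorem mk_eta (u : Cfg (DiffB B)) : mk (progPart u) (copyPart u) (ctl u) = u := by
  funext w
  rcases w with v | (v | _ | _ | _) <;> rfl

/-- Configurations of the differential program as triples. -/
def mkEquiv : Ctl × (Cfg B × Cfg B) ≃ Cfg (DiffB B) where
  toFun x := mk x.2.1 x.2.2 x.1
  invFun u := (ctl u, progPart u, copyPart u)
  left_inv _ := rfl
  right_inv u := mk_eta u

theorem mk_ext {u : Cfg (DiffB B)} {s r : Cfg B} {p : Ctl} (hs : progPart u = s)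
    (hr : copyPart u = r) (hp : ctl u = p) : u = mk s r p := by
  rw [← mk_eta u, hs, hr, hp]

/-- The block of `τ` between the given labels of the fresh variables. -/
def slice (τ : Matrix (Cfg (DiffB B)) (Cfg (DiffB B)) ℂ) (r r' : Cfg B) (p p' : Ctl) :
    Matrix (Cfg B) (Cfg B) ℂ := fun s t => τ (mk s r p) (mk t r' p')

variable [Fintype V] [DecidableEq V] [∀ v, Fintype (B v)]

/-- The diagonal block of `τ` at `p`, with the copies traced out. -/
def blk (τ : Matrix (Cfg (DiffB B)) (Cfg (DiffB B)) ℂ) (p : Ctl) : Matrix (Cfg B) (Cfg B) ℂ :=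
  ∑ r, slice τ r r p p

theorem blk_apply (τ : Matrix (Cfg (DiffB B)) (Cfg (DiffB B)) ℂ) (p : Ctl) (s t : Cfg B) :
    blk τ p s t = ∑ r, τ (mk s r p) (mk t r p) := by
  rw [blk, Matrix.sum_apply]
  rfl

theorem rtr_blk (τ : Matrix (Cfg (DiffB B)) (Cfg (DiffB B)) ℂ) (p : Ctl) :
    rtr (blk τ p) = ∑ s, ∑ r, (τ (mk s r p) (mk s r p)).re := by
  simp [rtr_eq_sum, blk_apply]

theorem blk_nonneg {τ : Matrix (Cfg (DiffB B)) (Cfg (DiffB B)) ℂ} (hτ : τ.PosSemidef) (p : Ctl) :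
    0 ≤ blk τ p :=
  Finset.sum_nonneg fun r _ => (hτ.submatrix fun s => mk s r p).nonneg

theorem blk_add (τ τ' : Matrix (Cfg (DiffB B)) (Cfg (DiffB B)) ℂ) (p : Ctl) :
    blk (τ + τ') p = blk τ p + blk τ' p := by
  ext s t
  simp [blk_apply, Finset.sum_add_distrib]

theorem blk_sub (τ τ' : Matrix (Cfg (DiffB B)) (Cfg (DiffB B)) ℂ) (p : Ctl) :
    blk (τ - τ') p = blk τ p - blk τ' p := by
  ext s t
  simp [blk_apply, Finset.sum_sub_distrib]

theorem blk_zero (p : Ctl) : blk (0 : Matrix (Cfg (DiffB B)) (Cfg (DiffB B)) ℂ) p = 0 := by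
  ext s t
  simp [blk_apply]

theorem blk_sum {α : Type*} (F : Finset α) (τ : α → Matrix (Cfg (DiffB B)) (Cfg (DiffB B)) ℂ)
    (p : Ctl) : blk (∑ a ∈ F, τ a) p = ∑ a ∈ F, blk (τ a) p := by
  classical
  induction F using Finset.induction_on with
  | empty => simp [blk_zero]
  | insert a F ha ih => rw [Finset.sum_insert ha, Finset.sum_insert ha, blk_add, ih]

theorem blk_tendsto {S : ℕ → Matrix (Cfg (DiffB B)) (Cfg (DiffB B)) ℂ}
    {A : Matrix (Cfg (DiffB B)) (Cfg (DiffB B)) ℂ}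
    (h : ∀ i j, Tendsto (fun n => S n i j) atTop (𝓝 (A i j))) (p : Ctl) (s t : Cfg B) :
    Tendsto (fun n => blk (S n) p s t) atTop (𝓝 (blk A p s t)) := by
  simp_rw [blk_apply]
  exact tendsto_finsetSum _ fun r _ => h _ _

/-- Reduces traces over the infinite space to a sum over control labels of finite-dimensional
traces. -/
theorem trace_eq_tsum_blk {τ : Matrix (Cfg (DiffB B)) (Cfg (DiffB B)) ℂ} (hτ : τ.PosSemidef) :
    trace τ = ∑' p, ENNReal.ofReal (rtr (blk τ p)) := by
  rw [trace, ← mkEquiv.tsum_eq, ENNReal.tsum_prod']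
  refine tsum_congr fun p => ?_
  rw [tsum_fintype, rtr_blk, Fintype.sum_prod_type,
    ENNReal.ofReal_sum_of_nonneg fun s _ => Finset.sum_nonneg fun r _ => hτ.re_diag_nonneg _]
  refine Finset.sum_congr rfl fun s _ => ?_
  rw [ENNReal.ofReal_sum_of_nonneg fun r _ => hτ.re_diag_nonneg _]
  rfl

end Mk

/-! ### Operations on the program variables -/

section Orig

variable {V I : Type} {B : V → Type} {q : I → V}

theorem origReg_injective (hq : Function.Injective q) : Function.Injective (origReg q) :=
  fun _ _ h => hq (Sum.inl_injective h)

theorem notMem_range_of_origReg {v : V} (hv : Sum.inl v ∉ Set.range (origReg q)) :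
    v ∉ Set.range q := by
  rintro ⟨i, rfl⟩
  exact hv ⟨i, rfl⟩

theorem setReg_origReg (hq : Function.Injective q) (x : ∀ i, B (q i)) (s r : Cfg B) (p : Ctl) :
    setReg (B := DiffB B) (origReg q) x (mk s r p) = mk (setReg q x s) r p := by
  refine (eq_setReg (origReg_injective hq) (fun i => setReg_apply hq x s i) fun w hw => ?_).symm
  rcases w with v | (v | _ | _ | _)
  · exact setReg_of_notMem x s (notMem_range_of_origReg hw)
  all_goals rfl

/-- Operations on the program variables do not touch the fresh labels, so they act on each slice
separately; by linearity they then act on each `blk`. -/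
theorem slice_assignReg_origReg (hq : Function.Injective q) (σ : RegOp B q)
    (τ : Matrix (Cfg (DiffB B)) (Cfg (DiffB B)) ℂ) (r r' : Cfg B) (p p' : Ctl) :
    slice (assignReg (B := DiffB B) (origReg q) σ τ) r r' p p' =
      assignReg q σ (slice τ r r' p p') := by
  ext s t
  rw [assignReg_apply hq]
  refine (assignReg_apply (B := DiffB B) (origReg_injective hq) σ τ (mk s r p) (mk t r' p')).trans ?_
  refine congrArg (· * σ (fun i => s (q i)) (fun i => t (q i))) (tsum_congr fun x => ?_)
  exact congrArg₂ τ (setReg_origReg hq x s r p) (setReg_origReg hq x t r' p')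

theorem initVar_inl [∀ v, Zero (B v)] (v : V) (τ : Matrix (Cfg (DiffB B)) (Cfg (DiffB B)) ℂ) :
    initVar (.inl v) τ = assignReg (B := DiffB B) (origReg fun _ : Unit => v) (zeroState v) τ :=
  initVar_eq_assignReg (B := DiffB B) (.inl v) τ

variable [Fintype V] [DecidableEq V] [∀ v, Fintype (B v)] [∀ v, DecidableEq (B v)]

theorem blk_assignReg_origReg (hq : Function.Injective q) (σ : RegOp B q)
    (τ : Matrix (Cfg (DiffB B)) (Cfg (DiffB B)) ℂ) (p : Ctl) :
    blk (assignReg (B := DiffB B) (origReg q) σ τ) p = assignL q σ (blk τ p) := by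
  simp_rw [blk, slice_assignReg_origReg hq]
  rw [map_sum]
  rfl

variable [Finite I]

theorem slice_sandwich_origReg (hq : Function.Injective q) (A : RegOp B q)
    (τ : Matrix (Cfg (DiffB B)) (Cfg (DiffB B)) ℂ) (r r' : Cfg B) (p p' : Ctl) :
    slice (sandwich (lift (B := DiffB B) (origReg q) A) τ) r r' p p' =
      sandwich (lift q A) (slice τ r r' p p') := by
  classical
  have := Fintype.ofFinite I
  ext s t
  rw [sandwich_lift_apply hq (rowSupport_univ A)]
  refine (sandwich_lift_apply (B := DiffB B) (κ := ∀ i, B (q i)) (origReg_injective hq)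
    (rowSupport_univ A) τ _ _).trans ?_
  refine Finset.sum_congr rfl fun x _ => Finset.sum_congr rfl fun y _ => ?_
  have h := congrArg₂ τ (setReg_origReg hq x s r p) (setReg_origReg hq y t r' p')
  exact congrArg (fun z => A (fun i => s (q i)) x * z * star (A (fun i => t (q i)) y)) h

theorem blk_sandwich_origReg (hq : Function.Injective q) (A : RegOp B q)
    (τ : Matrix (Cfg (DiffB B)) (Cfg (DiffB B)) ℂ) (p : Ctl) :
    blk (sandwich (lift (B := DiffB B) (origReg q) A) τ) p = sandwichL (lift q A) (blk τ p) := by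
  simp_rw [blk, slice_sandwich_origReg hq]
  rw [map_sum]
  rfl

theorem posSemidef_sandwich_origReg (hq : Function.Injective q) (A : RegOp B q)
    {τ : Matrix (Cfg (DiffB B)) (Cfg (DiffB B)) ℂ} (hτ : τ.PosSemidef) :
    (sandwich (lift (B := DiffB B) (origReg q) A) τ).PosSemidef := by
  classical
  have := Fintype.ofFinite I
  exact posSemidef_sandwich_lift (B := DiffB B) (κ := ∀ i, B (q i)) (origReg_injective hq)
    (rowSupport_univ A) hτ

end Orig

end

end QWhile

namespace QWhile

noncomputable section

open Filter Topology

/-! ### Operations on the fresh variables -/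

section FreshRegisters

variable {V : Type} {B : V → Type}

theorem ancReg_injective (a : Anc V) : Function.Injective (ancReg a) := fun _ _ _ => rfl

theorem regQ1Q2_injective : Function.Injective (regQ1Q2 (V := V)) := by
  rintro (_ | _) (_ | _) h <;> simp_all [regQ1Q2]

theorem regQcQ2_injective : Function.Injective (regQcQ2 (V := V)) := by
  rintro (_ | _) (_ | _) h <;> simp_all [regQcQ2]

theorem setReg_qc (x : Unit → ℤ) (s r : Cfg B) (p : Ctl) :
    setReg (B := DiffB B) (ancReg .qc) x (mk s r p) = mk s r (x (), p.2) := by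
  refine (eq_setReg (B := DiffB B) (u := mk s r (x (), p.2)) (ancReg_injective .qc)
    (fun i => rfl) fun w hw => ?_).symm
  rcases w with v | (v | _ | _ | _)
  · rfl
  · rfl
  · exact absurd ⟨(), rfl⟩ hw
  · rfl
  · rfl

theorem setReg_q1 (x : Unit → Fin 2) (s r : Cfg B) (p : Ctl) :
    setReg (B := DiffB B) (ancReg .q1) x (mk s r p) = mk s r (p.1, x (), p.2.2) := by
  refine (eq_setReg (B := DiffB B) (u := mk s r (p.1, x (), p.2.2)) (ancReg_injective .q1)
    (fun i => rfl) fun w hw => ?_).symm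
  rcases w with v | (v | _ | _ | _)
  · rfl
  · rfl
  · rfl
  · exact absurd ⟨(), rfl⟩ hw
  · rfl

theorem setReg_q2 (x : Unit → Fin 2) (s r : Cfg B) (p : Ctl) :
    setReg (B := DiffB B) (ancReg .q2) x (mk s r p) = mk s r (p.1, p.2.1, x ()) := by
  refine (eq_setReg (B := DiffB B) (u := mk s r (p.1, p.2.1, x ())) (ancReg_injective .q2)
    (fun i => rfl) fun w hw => ?_).symm
  rcases w with v | (v | _ | _ | _)
  · rfl
  · rfl
  · rfl
  · rfl
  · exact absurd ⟨(), rfl⟩ hw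

/-- The value of `qc`. -/
def valQc (s : ∀ i, DiffB B (ancReg (V := V) .qc i)) : ℤ := s ()

/-- The value of `q₁`. -/
def valQ1 (s : ∀ i, DiffB B (ancReg (V := V) .q1 i)) : Fin 2 := s ()

/-- The values of `q₁, q₂`. -/
def valQ1Q2 (s : ∀ i, DiffB B (regQ1Q2 (V := V) i)) : Fin 2 × Fin 2 := (s (.inl ()), s (.inr ()))

/-- The values of `qc, q₂`. -/
def valQcQ2 (s : ∀ i, DiffB B (regQcQ2 (V := V) i)) : ℤ × Fin 2 := (s (.inl ()), s (.inr ()))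

/-- The label of `qc` with the given value. -/
def labelQc (c : ℤ) : ∀ i, DiffB B (ancReg (V := V) .qc i) := fun _ => c

/-- The label of `q₁` with the given value. -/
def labelQ1 (x : Fin 2) : ∀ i, DiffB B (ancReg (V := V) .q1 i) := fun _ => x

/-- The label of `qc, q₂` with the given values. -/
def labelQcQ2 (c : ℤ) (y : Fin 2) : ∀ i, DiffB B (regQcQ2 i)
  | .inl _ => c
  | .inr _ => y

theorem setReg_qcq2 (c : ℤ) (y : Fin 2) (s r : Cfg B) (p : Ctl) :
    setReg (B := DiffB B) regQcQ2 (labelQcQ2 c y) (mk s r p) = mk s r (c, p.2.1, y) := by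
  refine (eq_setReg regQcQ2_injective (fun i => ?_) fun w hw => ?_).symm
  · rcases i with _ | _ <;> rfl
  rcases w with v | (v | _ | _ | _)
  · rfl
  · rfl
  · exact absurd ⟨.inl (), rfl⟩ hw
  · rfl
  · exact absurd ⟨.inr (), rfl⟩ hw

/-- The indicator of the outcome `a` of the measurement of `q₁, q₂`. -/
def outcome (a : Fin 3) (p : Ctl) : ℂ :=
  if if p.2.1 = 1 then a = 2 else if p.2.2 = 1 then a = 1 else a = 0 then 1 else 0

theorem opM_apply (a : Fin 3) (s u : ∀ i, DiffB B (regQ1Q2 (V := V) i)) :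
    opM B a s u = if (valQ1Q2 s).1 = (valQ1Q2 u).1 ∧ (valQ1Q2 s).2 = (valQ1Q2 u).2 ∧
      (if (valQ1Q2 s).1 = 1 then a = 2 else if (valQ1Q2 s).2 = 1 then a = 1 else a = 0)
      then 1 else 0 := rfl

theorem opC_apply (s u : ∀ i, DiffB B (ancReg (V := V) .qc i)) :
    opC B s u = if valQc s = valQc u + 1 then 1 else 0 := rfl

theorem opX_apply (s u : ∀ i, DiffB B (ancReg (V := V) .q1 i)) :
    opX B s u = if valQ1 s = valQ1 u then 0 else 1 := rfl

theorem rowSupport_opM (a : Fin 3) : RowSupport (opM (V := V) B a) fun s (_ : Unit) => s := by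
  refine ⟨fun _ _ _ _ => rfl, fun s u h => ⟨(), ?_⟩⟩
  rw [opM_apply] at h
  have h' := (ite_ne_right_iff.1 h).1
  funext i
  rcases i with _ | _
  · exact h'.1
  · exact h'.2.1

theorem sandwich_opM (a : Fin 3) (τ : Matrix (Cfg (DiffB B)) (Cfg (DiffB B)) ℂ)
    (u v : Cfg (DiffB B)) : sandwich (lift regQ1Q2 (opM B a)) τ u v =
      outcome a (ctl u) * τ u v * outcome a (ctl v) := by
  rw [sandwich_lift_apply regQ1Q2_injective (rowSupport_opM a)]
  have h : ∀ w : Cfg (DiffB B), opM (V := V) B a (fun i => w (regQ1Q2 i)) (fun i => w (regQ1Q2 i)) =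
      outcome a (ctl w) := fun w => by
    rw [opM_apply, outcome]
    exact if_congr ⟨fun h => h.2.2, fun h => ⟨rfl, rfl, h⟩⟩ rfl rfl
  simp only [Finset.univ_unique, Finset.sum_singleton, setReg_self regQ1Q2_injective, h]
  congr 1
  rw [outcome]
  split_ifs <;> simp

theorem posSemidef_sandwich_opM (a : Fin 3) {τ : Matrix (Cfg (DiffB B)) (Cfg (DiffB B)) ℂ}
    (hτ : τ.PosSemidef) : (sandwich (lift regQ1Q2 (opM B a)) τ).PosSemidef :=
  posSemidef_sandwich_lift regQ1Q2_injective (rowSupport_opM a) hτ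

theorem rowSupport_opC : RowSupport (opC (V := V) B) fun s (_ : Unit) =>
    labelQc (valQc s - 1) := by
  refine ⟨fun _ _ _ _ => rfl, fun s u h => ⟨(), ?_⟩⟩
  rw [opC_apply] at h
  have h' := (ite_ne_right_iff.1 h).1
  funext i
  exact sub_eq_iff_eq_add.2 h'

theorem sandwich_opC (τ : Matrix (Cfg (DiffB B)) (Cfg (DiffB B)) ℂ) (s r t r' : Cfg B)
    (p p' : Ctl) : sandwich (lift (ancReg .qc) (opC B)) τ (mk s r p) (mk t r' p') =
      τ (mk s r (p.1 - 1, p.2)) (mk t r' (p'.1 - 1, p'.2)) := by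
  rw [sandwich_lift_apply (ancReg_injective _) rowSupport_opC]
  have h : ∀ c : ℤ, opC (V := V) B (labelQc c) (labelQc (c - 1)) = 1 := fun c => by
    rw [opC_apply]
    exact if_pos (sub_add_cancel c 1).symm
  simp only [Finset.univ_unique, Finset.sum_singleton]
  refine (congrArg₂ (fun a b => a * _ * star b) (h p.1) (h p'.1)).trans ?_
  rw [one_mul, star_one, mul_one]
  exact congrArg₂ τ (setReg_qc _ s r p) (setReg_qc _ t r' p')

theorem posSemidef_sandwich_opC {τ : Matrix (Cfg (DiffB B)) (Cfg (DiffB B)) ℂ}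
    (hτ : τ.PosSemidef) : (sandwich (lift (ancReg .qc) (opC B)) τ).PosSemidef :=
  posSemidef_sandwich_lift (ancReg_injective _) rowSupport_opC hτ

theorem rowSupport_opX : RowSupport (opX (V := V) B) fun s (_ : Unit) =>
    labelQ1 (1 - valQ1 s) := by
  refine ⟨fun _ _ _ _ => rfl, fun s u h => ⟨(), ?_⟩⟩
  rw [opX_apply] at h
  have h' := (ite_ne_left_iff.1 h).1
  have key : ∀ x y : Fin 2, x ≠ y → 1 - x = y := by decide
  funext i
  exact key _ _ h'

theorem sandwich_opX (τ : Matrix (Cfg (DiffB B)) (Cfg (DiffB B)) ℂ) (s r t r' : Cfg B)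
    (p p' : Ctl) : sandwich (lift (ancReg .q1) (opX B)) τ (mk s r p) (mk t r' p') =
      τ (mk s r (p.1, 1 - p.2.1, p.2.2)) (mk t r' (p'.1, 1 - p'.2.1, p'.2.2)) := by
  rw [sandwich_lift_apply (ancReg_injective _) rowSupport_opX]
  have key : ∀ x : Fin 2, x ≠ 1 - x := by decide
  have h : ∀ c : Fin 2, opX (V := V) B (labelQ1 c) (labelQ1 (1 - c)) = 1 := fun c => by
    rw [opX_apply]
    exact if_neg (key c)
  simp only [Finset.univ_unique, Finset.sum_singleton]
  refine (congrArg₂ (fun a b => a * _ * star b) (h p.2.1) (h p'.2.1)).trans ?_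
  rw [one_mul, star_one, mul_one]
  exact congrArg₂ τ (setReg_q1 _ s r p) (setReg_q1 _ t r' p')

theorem posSemidef_sandwich_opX {τ : Matrix (Cfg (DiffB B)) (Cfg (DiffB B)) ℂ}
    (hτ : τ.PosSemidef) : (sandwich (lift (ancReg .q1) (opX B)) τ).PosSemidef :=
  posSemidef_sandwich_lift (ancReg_injective _) rowSupport_opX hτ

/-- The operator on `q₂` that `GP` applies for the value `c` of `qc`. -/
def gpMatrix (μ : ℕ → ℝ) (c : ℤ) (y z : Fin 2) : ℂ :=
  if 1 ≤ c then rotY (2 * Real.arcsin (Real.sqrt (bCoeff μ c.toNat))) y z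
  else if y = z then 1 else 0

theorem opGP_apply (μ : ℕ → ℝ) (s u : ∀ i, DiffB B (regQcQ2 (V := V) i)) :
    opGP B μ s u = if (valQcQ2 s).1 = (valQcQ2 u).1 then
      gpMatrix μ (valQcQ2 u).1 (valQcQ2 s).2 (valQcQ2 u).2 else 0 := rfl

theorem rowSupport_opGP (μ : ℕ → ℝ) : RowSupport (opGP (V := V) B μ)
    fun s (z : Fin 2) => labelQcQ2 (valQcQ2 s).1 z := by
  refine ⟨fun s z z' h => congrFun h (.inr ()), fun s u h => ⟨u (.inr ()), ?_⟩⟩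
  rw [opGP_apply] at h
  have h' := (ite_ne_right_iff.1 h).1
  funext i
  rcases i with _ | _
  · exact h'
  · rfl

theorem sandwich_opGP (μ : ℕ → ℝ) (τ : Matrix (Cfg (DiffB B)) (Cfg (DiffB B)) ℂ)
    (s r t r' : Cfg B) (p p' : Ctl) :
    sandwich (lift regQcQ2 (opGP B μ)) τ (mk s r p) (mk t r' p') =
      ∑ z, ∑ z', gpMatrix μ p.1 p.2.2 z *
        τ (mk s r (p.1, p.2.1, z)) (mk t r' (p'.1, p'.2.1, z')) *
          star (gpMatrix μ p'.1 p'.2.2 z') := by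
  rw [sandwich_lift_apply regQcQ2_injective (rowSupport_opGP μ)]
  have h : ∀ (s r : Cfg B) (p : Ctl) (z : Fin 2),
      opGP (V := V) B μ (fun i => mk s r p (regQcQ2 i)) (labelQcQ2 p.1 z) =
        gpMatrix μ p.1 p.2.2 z := fun s r p z => by
    rw [opGP_apply]
    exact if_pos rfl
  refine Finset.sum_congr rfl fun z _ => Finset.sum_congr rfl fun z' _ => ?_
  refine (congrArg₂ (fun a b => a * _ * star b) (h s r p z) (h t r' p' z')).trans ?_
  exact congrArg (fun a => gpMatrix μ p.1 p.2.2 z * a * star (gpMatrix μ p'.1 p'.2.2 z'))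
    (congrArg₂ τ (setReg_qcq2 _ _ s r p) (setReg_qcq2 _ _ t r' p'))

theorem posSemidef_sandwich_opGP (μ : ℕ → ℝ) {τ : Matrix (Cfg (DiffB B)) (Cfg (DiffB B)) ℂ}
    (hτ : τ.PosSemidef) : (sandwich (lift regQcQ2 (opGP B μ)) τ).PosSemidef :=
  posSemidef_sandwich_lift regQcQ2_injective (rowSupport_opGP μ) hτ

end FreshRegisters

/-! ### The counting step -/

section Step

/-- The probability that `GP` leaves `q₂` in the state `|0⟩`, for the value `c` of `qc`. -/
def stay (μ : ℕ → ℝ) (c : ℤ) : ℝ := if 1 ≤ c then 1 - bCoeff μ c.toNat else 1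

/-- The coefficients `b_j` are probabilities. -/
def IsRate (μ : ℕ → ℝ) : Prop := ∀ n, 1 ≤ n → 0 ≤ bCoeff μ n ∧ bCoeff μ n ≤ 1

variable {μ : ℕ → ℝ}

theorem IsRate.stay_mem (hμ : IsRate μ) (c : ℤ) : 0 ≤ stay μ c ∧ stay μ c ≤ 1 := by
  rw [stay]
  split_ifs with h
  · have := hμ c.toNat (by omega)
    constructor <;> linarith
  · simp

/-- Since cos² (arcsin √b) = 1 - b, the squared amplitudes of `GP` are the transition probabilities
of the counter. Only the column of q₂ = 0 is needed, as a block that is still counting has this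
value. -/
theorem gpMatrix_zero (hμ : IsRate μ) (c : ℤ) :
    gpMatrix μ c 0 0 * star (gpMatrix μ c 0 0) = (stay μ c : ℂ) := by
  rw [gpMatrix, stay]
  by_cases h : 1 ≤ c
  · rw [if_pos h, if_pos h]
    have hb := hμ c.toNat (by omega)
    simp only [rotY, Matrix.cons_val_zero, Matrix.cons_val', Matrix.of_apply]
    rw [mul_div_cancel_left₀ _ two_ne_zero, Real.cos_arcsin, Real.sq_sqrt hb.1, Complex.star_def,
      Complex.conj_ofReal, ← Complex.ofReal_mul, Real.mul_self_sqrt (by linarith)]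
  · rw [if_neg h, if_neg h]
    simp

theorem gpMatrix_one (hμ : IsRate μ) (c : ℤ) :
    gpMatrix μ c 1 0 * star (gpMatrix μ c 1 0) = ((1 - stay μ c : ℝ) : ℂ) := by
  rw [gpMatrix, stay]
  by_cases h : 1 ≤ c
  · rw [if_pos h, if_pos h]
    have hb := hμ c.toNat (by omega)
    simp only [rotY, Matrix.cons_val_zero, Matrix.cons_val_one, Matrix.cons_val', Matrix.of_apply]
    have h0 := Real.sqrt_nonneg (bCoeff μ c.toNat)
    rw [mul_div_cancel_left₀ _ two_ne_zero, Real.sin_arcsin (by linarith)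
      (Real.sqrt_le_one.2 hb.2), Complex.star_def, Complex.conj_ofReal, ← Complex.ofReal_mul,
      Real.mul_self_sqrt hb.1]
    simp
  · rw [if_neg h, if_neg h]
    simp

variable {V : Type} {B : V → Type} [∀ v, Zero (B v)] {k : ℕ}

theorem posSemidef_stepProg (μ : ℕ → ℝ) (θ : Fin k → ℝ)
    {τ : Matrix (Cfg (DiffB B)) (Cfg (DiffB B)) ℂ} (hτ : τ.PosSemidef) :
    ((stepProg μ).sem θ τ).PosSemidef :=
  posSemidef_sandwich_opGP μ (posSemidef_sandwich_opC hτ)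

theorem stepProg_apply (μ : ℕ → ℝ) (θ : Fin k → ℝ)
    (τ : Matrix (Cfg (DiffB B)) (Cfg (DiffB B)) ℂ) (s r t r' : Cfg B) (c c' : ℤ)
    (x x' y y' : Fin 2) :
    (stepProg μ).sem θ (sandwich (lift regQ1Q2 (opM B 0)) τ) (mk s r (c, x, y))
      (mk t r' (c', x', y')) =
      if x = 0 ∧ x' = 0 then gpMatrix μ c y 0 * τ (mk s r (c - 1, 0, 0)) (mk t r' (c' - 1, 0, 0)) *
        star (gpMatrix μ c' y' 0) else 0 := by
  refine (sandwich_opGP μ (sandwich (lift (ancReg .qc) (opC B))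
    (sandwich (lift regQ1Q2 (opM B 0)) τ)) s r t r' (c, x, y) (c', x', y')).trans ?_
  simp_rw [sandwich_opC, sandwich_opM]
  have h : ∀ (s r : Cfg B) (c : ℤ) (x z : Fin 2),
      outcome 0 (ctl (mk s r (c - 1, x, z))) = if x = 0 ∧ z = 0 then 1 else 0 := by
    intro s r c x z
    change outcome 0 (c - 1, x, z) = _
    rw [outcome]
    fin_cases x <;> fin_cases z <;> simp
  simp only [h, Fin.sum_univ_two]
  fin_cases x <;> fin_cases x' <;> simp

variable [Fintype V] [DecidableEq V] [∀ v, Fintype (B v)]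

theorem blk_stepProg_zero (hμ : IsRate μ) (θ : Fin k → ℝ)
    (τ : Matrix (Cfg (DiffB B)) (Cfg (DiffB B)) ℂ) (c : ℤ) :
    blk ((stepProg μ).sem θ (sandwich (lift regQ1Q2 (opM B 0)) τ)) (c, 0, 0) =
      (stay μ c : ℂ) • blk τ (c - 1, 0, 0) := by
  ext s t
  rw [blk_apply, Matrix.smul_apply, blk_apply, smul_eq_mul, Finset.mul_sum]
  refine Finset.sum_congr rfl fun r _ => ?_
  rw [stepProg_apply, if_pos ⟨rfl, rfl⟩, ← gpMatrix_zero hμ]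
  ring

theorem blk_stepProg_one (hμ : IsRate μ) (θ : Fin k → ℝ)
    (τ : Matrix (Cfg (DiffB B)) (Cfg (DiffB B)) ℂ) (c : ℤ) :
    blk ((stepProg μ).sem θ (sandwich (lift regQ1Q2 (opM B 0)) τ)) (c, 0, 1) =
      ((1 - stay μ c : ℝ) : ℂ) • blk τ (c - 1, 0, 0) := by
  ext s t
  rw [blk_apply, Matrix.smul_apply, blk_apply, smul_eq_mul, Finset.mul_sum]
  refine Finset.sum_congr rfl fun r _ => ?_
  rw [stepProg_apply, if_pos ⟨rfl, rfl⟩, ← gpMatrix_one hμ]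
  ring

theorem blk_stepProg_flagged (μ : ℕ → ℝ) (θ : Fin k → ℝ)
    (τ : Matrix (Cfg (DiffB B)) (Cfg (DiffB B)) ℂ) (c : ℤ) (y : Fin 2) :
    blk ((stepProg μ).sem θ (sandwich (lift regQ1Q2 (opM B 0)) τ)) (c, 1, y) = 0 := by
  ext s t
  rw [blk_apply]
  exact Finset.sum_eq_zero fun r _ => by rw [stepProg_apply, if_neg (by simp)]

end Step

end

end QWhile

namespace QWhile

noncomputable section

open Filter Topology

/-! ### The commutator gadget -/

section AS

variable {V I : Type} {B : V → Type}

/-- The values of `q₂, q, q'`. -/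
def valAS (q : I → V) : (∀ i, DiffB B (regAS q i)) ≃
    Fin 2 × ((∀ i, B (q i)) × (∀ i, B (q i))) where
  toFun s := (s (.inl ()), fun i => s (.inr (.inl i)), fun i => s (.inr (.inr i)))
  invFun x
    | .inl _ => x.1
    | .inr (.inl i) => x.2.1 i
    | .inr (.inr i) => x.2.2 i
  left_inv s := by
    funext i
    rcases i with _ | i | i <;> rfl
  right_inv _ := rfl

/-- The operator `AS` on `q₂` and two copies of a register with labels in `X`. -/
def asMatrix (X : Type) : Matrix (Fin 2 × (X × X)) (Fin 2 × (X × X)) ℂ := fun a b =>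
  if a.1 = b.1 then
    if a.1 = 0 then iexp ((-(Complex.I * (Real.pi / 4 : ℂ))) • swapOp X) a.2 b.2
    else iexp ((Complex.I * (Real.pi / 4 : ℂ)) • swapOp X) a.2 b.2
  else 0

theorem opAS_apply (q : I → V) (s t : ∀ i, DiffB B (regAS q i)) :
    opAS B q s t = asMatrix (∀ i, B (q i)) (valAS q s) (valAS q t) := rfl

theorem isHermitian_swapOp (X : Type) : (swapOp X).IsHermitian := by
  classical
  ext a b
  rw [Matrix.conjTranspose_apply, swapOp, swapOp]
  rw [apply_ite star, star_one, star_zero]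
  exact if_congr ⟨fun h => ⟨h.2.symm, h.1.symm⟩, fun h => ⟨h.2.symm, h.1.symm⟩⟩ rfl rfl

theorem asMatrix_isometry (X : Type) [Fintype X] :
    imul (asMatrix X).conjTranspose (asMatrix X) = iid _ := by
  classical
  have hsw : ∀ x : ℝ, imul (iexp ((Complex.I * (x : ℂ)) • swapOp X)).conjTranspose
      (iexp ((Complex.I * (x : ℂ)) • swapOp X)) = 1 := fun x => by
    rw [iexp_isometry (conjTranspose_smul_of_isHermitian (isHermitian_swapOp X) x), iid_eq_one]
  have hU := hsw (Real.pi / 4)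
  have hU' := hsw (-(Real.pi / 4))
  simp only [Complex.ofReal_neg, mul_neg, Complex.ofReal_div, Complex.ofReal_ofNat,
    imul_eq_mul] at hU hU'
  rw [imul_eq_mul, iid_eq_one]
  ext ⟨x, a⟩ ⟨y, b⟩
  have h1 := congrFun (congrFun hU a) b
  have h2 := congrFun (congrFun hU' a) b
  simp only [Matrix.mul_apply, Matrix.conjTranspose_apply] at h1 h2 ⊢
  rw [Fintype.sum_prod_type, Fin.sum_univ_two]
  simp only [asMatrix]
  generalize iexp ((Complex.I * (Real.pi / 4 : ℂ)) • swapOp X) = U at h1 ⊢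
  generalize iexp ((-(Complex.I * (Real.pi / 4 : ℂ))) • swapOp X) = U' at h2 ⊢
  fin_cases x <;> fin_cases y
  · simpa [Matrix.one_apply] using h2
  · simp
  · simp
  · simpa [Matrix.one_apply] using h1

theorem opAS_isometry (q : I → V) [Finite I] [∀ v, Finite (B v)] :
    imul (opAS B q).conjTranspose (opAS B q) = iid _ := by
  have := Fintype.ofFinite (∀ i, B (q i))
  ext s t
  have h := congrFun (congrFun (asMatrix_isometry (∀ i, B (q i))) (valAS q s)) (valAS q t)
  refine Eq.trans ?_ (h.trans ?_)
  · rw [imul, imul, ← (valAS q).tsum_eq]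
    rfl
  · rw [iid, iid]
    by_cases hst : s = t
    · rw [if_pos hst, if_pos (congrArg _ hst)]
    · rw [if_neg hst, if_neg ((valAS q).injective.ne hst)]

theorem regAS_injective {q : I → V} (hq : Function.Injective q) :
    Function.Injective (regAS q) := by
  rintro (_ | i | i) (_ | j | j) h <;> simp_all [regAS, hq.eq_iff]

theorem rowSupport_lift_opAS {q : I → V} :
    RowSupport (lift (B := DiffB B) (regAS q) (opAS B q))
      fun u (k : Cfg B × Cfg B) => mk k.1 k.2 (ctl u) where
  inj u k k' h := by
    have h1 : progPart (mk k.1 k.2 (ctl u)) = progPart (mk k'.1 k'.2 (ctl u)) :=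
      congrArg progPart h
    have h2 : copyPart (mk k.1 k.2 (ctl u)) = copyPart (mk k'.1 k'.2 (ctl u)) :=
      congrArg copyPart h
    exact Prod.ext h1 h2
  mem u u' h := by
    have hag := agree_of_lift_ne_zero h
    rw [lift_apply_of_agree _ hag, opAS_apply] at h
    have h2 := (ite_ne_right_iff.1 h).1
    refine ⟨(progPart u', copyPart u'), (mk_ext rfl rfl ?_).symm⟩
    have hc : u (.inr .qc) = u' (.inr .qc) := hag _ (by rintro ⟨_ | i | i, h⟩ <;> cases h)
    have h1 : u (.inr .q1) = u' (.inr .q1) := hag _ (by rintro ⟨_ | i | i, h⟩ <;> cases h)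
    have h2' : u (.inr .q2) = u' (.inr .q2) := h2
    simp only [ctl, hc, h1, h2']

variable [Fintype V] [DecidableEq V] [∀ v, Fintype (B v)] [∀ v, DecidableEq (B v)]

theorem posSemidef_sandwich_opAS {q : I → V}
    {τ : Matrix (Cfg (DiffB B)) (Cfg (DiffB B)) ℂ} (hτ : τ.PosSemidef) :
    (sandwich (lift (B := DiffB B) (regAS q) (opAS B q)) τ).PosSemidef :=
  rowSupport_lift_opAS.posSemidef_sandwich hτ

theorem trace_blk (τ : Matrix (Cfg (DiffB B)) (Cfg (DiffB B)) ℂ) (p : Ctl) :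
    Matrix.trace (blk τ p) = ∑ a : Cfg B × Cfg B, τ (mk a.1 a.2 p) (mk a.1 a.2 p) := by
  simp [Matrix.trace, blk_apply, Fintype.sum_prod_type]

/-- `AS` is diagonal in the control labels, so at each label it restricts to an isometry of program
variables and copies. It may change the block itself, which is why flagged blocks are followed only
through their traces. -/
theorem rtr_blk_sandwich_opAS [Finite I] {q : I → V} (hq : Function.Injective q)
    (τ : Matrix (Cfg (DiffB B)) (Cfg (DiffB B)) ℂ) (p : Ctl) :
    rtr (blk (sandwich (lift (B := DiffB B) (regAS q) (opAS B q)) τ) p) = rtr (blk τ p) := by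
  set L := lift (B := DiffB B) (regAS q) (opAS B q) with hL
  set m : Cfg B × Cfg B → Cfg (DiffB B) := fun a => mk a.1 a.2 p with hm
  have hinj : Function.Injective m := fun k k' h =>
    Prod.ext (congrArg progPart h : progPart (m k) = progPart (m k'))
      (congrArg copyPart h : copyPart (m k) = copyPart (m k'))
  have hcol : ∀ k k', ∑ a, star (L (m a) (m k')) * L (m a) (m k) =
      if k' = k then 1 else 0 := fun k k' => by
    have h := congrFun (congrFun (imul_lift_of_isometry (B := DiffB B) (regAS_injective hq)
      (opAS_isometry (B := B) q)) (m k')) (m k)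
    rw [imul, ← hinj.tsum_eq, tsum_fintype] at h
    · refine h.trans ?_
      simp only [iid, hinj.eq_iff]
    · intro u hu
      obtain ⟨x, hx⟩ := (rowSupport_lift_opAS (q := q)).mem u (m k)
        (right_ne_zero_of_mul (Function.mem_support.1 hu))
      have hc : ctl u = p := congrArg ctl hx
      exact ⟨(progPart u, copyPart u), (mk_ext rfl rfl hc).symm⟩
  have hs : ∀ a, sandwich L τ (m a) (m a) =
      ∑ k, ∑ k', L (m a) (m k) * τ (m k) (m k') * star (L (m a) (m k')) := fun a =>
    rowSupport_lift_opAS.sandwich_apply τ (m a) (m a)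
  rw [rtr, rtr, trace_blk, trace_blk]
  refine congrArg Complex.re ?_
  calc ∑ a, sandwich L τ (m a) (m a)
      = ∑ k, ∑ k', τ (m k) (m k') * ∑ a, star (L (m a) (m k')) * L (m a) (m k) := by
        simp_rw [hs, Finset.mul_sum]
        rw [Finset.sum_comm]
        refine Finset.sum_congr rfl fun k _ => ?_
        rw [Finset.sum_comm]
        refine Finset.sum_congr rfl fun k' _ => Finset.sum_congr rfl fun a _ => ?_
        ring
    _ = ∑ k, τ (m k) (m k) := by simp_rw [hcol]; simp

end AS

/-! ### Blocks after the operations on the fresh variables -/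

section Blocks

variable {V I : Type} {B : V → Type} [Fintype V] [DecidableEq V] [∀ v, Fintype (B v)]
  [∀ v, DecidableEq (B v)]

theorem blk_sandwich_opM (a : Fin 3) (τ : Matrix (Cfg (DiffB B)) (Cfg (DiffB B)) ℂ) (p : Ctl) :
    blk (sandwich (lift regQ1Q2 (opM B a)) τ) p = outcome a p • blk τ p := by
  ext s t
  rw [blk_apply, Matrix.smul_apply, blk_apply, smul_eq_mul, Finset.mul_sum]
  refine Finset.sum_congr rfl fun r _ => ?_
  rw [sandwich_opM]
  change outcome a p * _ * outcome a p = _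
  rw [outcome]
  split_ifs <;> simp

theorem blk_sandwich_opX (τ : Matrix (Cfg (DiffB B)) (Cfg (DiffB B)) ℂ) (c : ℤ) (x y : Fin 2) :
    blk (sandwich (lift (ancReg .q1) (opX B)) τ) (c, x, y) = blk τ (c, 1 - x, y) := by
  ext s t
  simp_rw [blk_apply, sandwich_opX]

theorem posSemidef_halfId : (halfId (V := V) B).PosSemidef := by
  have h : (Matrix.diagonal fun _ : Fin 2 => (1 / 2 : ℂ)).PosSemidef :=
    Matrix.PosSemidef.diagonal fun _ => by positivity
  exact h.submatrix fun s : (∀ i, DiffB B (ancReg (V := V) .q2 i)) => (s () : Fin 2)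

theorem trace_halfId : trace (halfId (V := V) B) = 1 := by
  refine ((Equiv.funUnique Unit (Fin 2)).symm.tsum_eq
    (fun i : Unit → Fin 2 => ENNReal.ofReal (halfId (V := V) B i i).re)).symm.trans ?_
  rw [tsum_fintype, Fin.sum_univ_two]
  have h : ∀ i : Unit → Fin 2, halfId (V := V) B i i = 1 / 2 := fun i => if_pos rfl
  rw [h, h, ← ENNReal.ofReal_add] <;> norm_num

theorem blk_assignReg_halfId (τ : Matrix (Cfg (DiffB B)) (Cfg (DiffB B)) ℂ) (c : ℤ)
    (x y : Fin 2) :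
    blk (assignReg (ancReg .q2) (halfId B) τ) (c, x, y) = (1 / 2 : ℂ) • ∑ z, blk τ (c, x, z) := by
  ext s t
  rw [Matrix.smul_apply, Matrix.sum_apply]
  simp_rw [blk_apply]
  rw [Finset.sum_comm, smul_eq_mul, Finset.mul_sum]
  refine Finset.sum_congr rfl fun r _ => ?_
  rw [assignReg_apply (ancReg_injective _), mul_comm]
  have h : ∀ i : Unit → Fin 2, halfId (V := V) B i i = 1 / 2 := fun i => if_pos rfl
  refine congrArg₂ (· * ·) (h fun _ => y) ?_
  refine ((Equiv.funUnique Unit (Fin 2)).symm.tsum_eq (fun i : Unit → Fin 2 =>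
    τ (setReg (B := DiffB B) (ancReg .q2) i (mk s r (c, x, y)))
      (setReg (B := DiffB B) (ancReg .q2) i (mk t r (c, x, y))))).symm.trans ?_
  rw [tsum_fintype]
  refine Finset.sum_congr rfl fun z _ => ?_
  rw [setReg_q2, setReg_q2]
  rfl

theorem copyReg_injective {q : I → V} (hq : Function.Injective q) :
    Function.Injective (copyReg q) := fun i j h => hq (by simpa [copyReg] using h)

theorem setReg_copyReg {q : I → V} (hq : Function.Injective q) (x : ∀ i, B (q i)) (s r : Cfg B)
    (p : Ctl) : setReg (B := DiffB B) (copyReg q) x (mk s r p) = mk s (setReg q x r) p := by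
  refine (eq_setReg (B := DiffB B) (u := mk s (setReg q x r) p) (copyReg_injective hq)
    (fun i => setReg_apply hq x r i) fun w hw => ?_).symm
  rcases w with v | (v | _ | _ | _)
  · rfl
  · refine setReg_of_notMem x r ?_
    rintro ⟨i, rfl⟩
    exact hw ⟨i, rfl⟩
  all_goals rfl

theorem rtr_blk_assignReg_copyReg [∀ v, Zero (B v)] [Finite I] {q : I → V} (hq : Function.Injective q) {σ : RegOp B q}
    (hσ : IsDensity σ) {τ : Matrix (Cfg (DiffB B)) (Cfg (DiffB B)) ℂ} (hτ : τ.PosSemidef)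
    (p : Ctl) : rtr (blk (assignReg (B := DiffB B) (copyReg q) σ τ) p) = rtr (blk τ p) := by
  rw [rtr_blk, rtr_blk]
  refine Finset.sum_congr rfl fun s _ => ?_
  have h := rtr_assignReg hq hσ (hτ.submatrix fun r => mk s r p).nonneg
  rw [rtr_eq_sum, rtr_eq_sum] at h
  refine Eq.trans (Finset.sum_congr rfl fun r _ => congrArg Complex.re ?_) h
  rw [assignReg_apply hq]
  refine (assignReg_apply (B := DiffB B) (copyReg_injective hq) σ τ (mk s r p) (mk s r p)).trans ?_
  refine congrArg (· * σ (fun i => r (q i)) (fun i => r (q i))) (tsum_congr fun x => ?_)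
  exact congrArg₂ τ (setReg_copyReg hq x s r p) (setReg_copyReg hq x s r p)

theorem trace_sandwich_opM_le (a : Fin 3) {τ : Matrix (Cfg (DiffB B)) (Cfg (DiffB B)) ℂ}
    (hτ : τ.PosSemidef) : trace (sandwich (lift regQ1Q2 (opM B a)) τ) ≤ trace τ := by
  refine ENNReal.tsum_le_tsum fun u => ENNReal.ofReal_le_ofReal ?_
  have h := hτ.re_diag_nonneg u
  rw [sandwich_opM, outcome]
  split_ifs <;> simp [h]

theorem trace_sandwich_opX (τ : Matrix (Cfg (DiffB B)) (Cfg (DiffB B)) ℂ) (hτ : τ.PosSemidef) :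
    trace (sandwich (lift (ancReg .q1) (opX B)) τ) = trace τ := by
  rw [trace_eq_tsum_blk (posSemidef_sandwich_opX hτ), trace_eq_tsum_blk hτ]
  let e : Ctl ≃ Ctl := (Equiv.refl ℤ).prodCongr ((Equiv.subLeft 1).prodCongr (Equiv.refl (Fin 2)))
  refine Eq.trans (tsum_congr fun ⟨c, x, y⟩ => ?_)
    (e.tsum_eq fun p => ENNReal.ofReal (rtr (blk τ p)))
  rw [blk_sandwich_opX]
  rfl

variable [∀ v, Zero (B v)] {k : ℕ}

/-- The `X` on q₁ sets the flag, and the reset of q₂ to I/2 splits the mass evenly between the two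
flagged labels. The other two statements preserve the trace at each label. -/
theorem commutatorProg_spec [Finite I] {q : I → V} (hq : Function.Injective q) {σ : RegOp B q}
    (hσ : IsDensity σ) (θ : Fin k → ℝ) {τ : Matrix (Cfg (DiffB B)) (Cfg (DiffB B)) ℂ}
    (hτ : IsPartialDensity τ) :
    ((commutatorProg q σ).sem θ (sandwich (lift regQ1Q2 (opM B 1)) τ)).PosSemidef ∧
      (∀ c y, blk ((commutatorProg q σ).sem θ
        (sandwich (lift regQ1Q2 (opM B 1)) τ)) (c, 0, y) = 0) ∧
      ∀ c y, rtr (blk ((commutatorProg q σ).sem θ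
        (sandwich (lift regQ1Q2 (opM B 1)) τ)) (c, 1, y)) = 1 / 2 * rtr (blk τ (c, 0, 1)) := by
  have p1 := posSemidef_sandwich_opM 1 hτ.1
  have t1 := ne_top_of_le_ne_top hτ.trace_ne_top (trace_sandwich_opM_le 1 hτ.1)
  have p2 := posSemidef_sandwich_opX p1
  have t2 := t1
  rw [← trace_sandwich_opX _ p1] at t2
  have p3 := posSemidef_assignReg (ancReg_injective .q2) (posSemidef_halfId (B := B)) p2 t2
  have t3 := t2
  rw [← mul_one (trace _), ← trace_halfId (B := B), ← trace_assignReg (ancReg_injective .q2)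
    (posSemidef_halfId (B := B)) p2 t2] at t3
  have p4 := posSemidef_assignReg (B := DiffB B) (q := copyReg q) (σ := σ) (copyReg_injective hq)
    hσ.1 p3 t3
  have p5 := posSemidef_sandwich_opAS (q := q) p4
  have key : ∀ c x y, rtr (blk ((commutatorProg q σ).sem θ
      (sandwich (lift regQ1Q2 (opM B 1)) τ)) (c, x, y)) =
      1 / 2 * (rtr (outcome 1 (c, 1 - x, 0) • blk τ (c, 1 - x, 0)) +
        rtr (outcome 1 (c, 1 - x, 1) • blk τ (c, 1 - x, 1))) := by
    intro c x y
    refine (rtr_blk_sandwich_opAS hq _ _).trans ?_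
    refine (rtr_blk_assignReg_copyReg hq hσ p3 _).trans ?_
    rw [blk_assignReg_halfId, Fin.sum_univ_two, blk_sandwich_opX, blk_sandwich_opX,
      blk_sandwich_opM, blk_sandwich_opM, show (1 / 2 : ℂ) = ((1 / 2 : ℝ) : ℂ) by simp, rtr_smul,
      rtr_add]
  refine ⟨p5, fun c y => ?_, fun c y => ?_⟩
  · have h0 := blk_nonneg p5 (c, 0, y)
    have h := key c 0 y
    simp only [outcome, sub_zero, if_true, Fin.isValue, one_ne_zero] at h
    have h' : rtr (blk ((commutatorProg q σ).sem θ
      (sandwich (lift regQ1Q2 (opM B 1)) τ)) (c, 0, y)) = 0 := by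
      rw [h]
      simp [rtr_zero]
    -- A positive block with trace zero is zero.
    have h1 := Matrix.nonneg_iff_posSemidef.1 h0
    refine (h1.trace_eq_zero_iff).1 (Complex.ext h' ?_)
    simpa using (Complex.le_def.1 h1.trace_nonneg).2.symm
  · have h := key c 1 y
    rw [h]
    simp [outcome, rtr_zero]

/-! ### The counting gadget -/

/-- The statement that the transform inserts in front of `q := e^{-iθσ}[q]`. -/
def gadget (μ : ℕ → ℝ) (q : I → V) (σ : RegOp B q) : Prog k (DiffB B) :=
  .branch regQ1Q2 3 (opM B) ![stepProg μ, commutatorProg q σ, .skip]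

theorem gadget_sem (μ : ℕ → ℝ) (q : I → V) (σ : RegOp B q) (θ : Fin k → ℝ)
    (τ : Matrix (Cfg (DiffB B)) (Cfg (DiffB B)) ℂ) :
    (gadget μ q σ).sem θ τ = (stepProg μ).sem θ (sandwich (lift regQ1Q2 (opM B 0)) τ) +
      (commutatorProg q σ).sem θ (sandwich (lift regQ1Q2 (opM B 1)) τ) +
      sandwich (lift regQ1Q2 (opM B 2)) τ := by
  rw [gadget, Prog.sem, Fin.sum_univ_three]
  rfl

variable [Finite I] {μ : ℕ → ℝ} {q : I → V} {σ : RegOp B q}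
  {τ : Matrix (Cfg (DiffB B)) (Cfg (DiffB B)) ℂ}

theorem posSemidef_gadget (hq : Function.Injective q) (hσ : IsDensity σ) (θ : Fin k → ℝ)
    (hτ : IsPartialDensity τ) : ((gadget μ q σ).sem θ τ).PosSemidef := by
  rw [gadget_sem]
  exact ((posSemidef_stepProg μ θ (posSemidef_sandwich_opM 0 hτ.1)).add
    (commutatorProg_spec hq hσ θ hτ).1).add (posSemidef_sandwich_opM 2 hτ.1)

theorem blk_gadget_zero (hμ : IsRate μ) (hq : Function.Injective q) (hσ : IsDensity σ)
    (θ : Fin k → ℝ) (hτ : IsPartialDensity τ) (c : ℤ) :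
    blk ((gadget μ q σ).sem θ τ) (c, 0, 0) = (stay μ c : ℂ) • blk τ (c - 1, 0, 0) := by
  rw [gadget_sem, blk_add, blk_add, blk_stepProg_zero hμ, (commutatorProg_spec hq hσ θ hτ).2.1,
    blk_sandwich_opM]
  simp [outcome]

theorem blk_gadget_one (hμ : IsRate μ) (hq : Function.Injective q) (hσ : IsDensity σ)
    (θ : Fin k → ℝ) (hτ : IsPartialDensity τ) (c : ℤ) :
    blk ((gadget μ q σ).sem θ τ) (c, 0, 1) =
      ((1 - stay μ c : ℝ) : ℂ) • blk τ (c - 1, 0, 0) := by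
  rw [gadget_sem, blk_add, blk_add, blk_stepProg_one hμ, (commutatorProg_spec hq hσ θ hτ).2.1,
    blk_sandwich_opM]
  simp [outcome]

theorem rtr_blk_gadget_flagged (hq : Function.Injective q) (hσ : IsDensity σ)
    (θ : Fin k → ℝ) (hτ : IsPartialDensity τ) (c : ℤ) (y : Fin 2) :
    rtr (blk ((gadget μ q σ).sem θ τ) (c, 1, y)) =
      1 / 2 * rtr (blk τ (c, 0, 1)) + rtr (blk τ (c, 1, y)) := by
  rw [gadget_sem, blk_add, blk_add, blk_stepProg_flagged, rtr_add, rtr_add,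
    (commutatorProg_spec hq hσ θ hτ).2.2, blk_sandwich_opM]
  simp [outcome, rtr_zero]

end Blocks

end

end QWhile

namespace QWhile

noncomputable section

open Filter Topology

/-! ### Weighted masses -/

section Weighted

variable {V : Type} {B : V → Type} [Fintype V] [DecidableEq V] [∀ v, Fintype (B v)]
  [∀ v, DecidableEq (B v)]

/-- The mass of `τ` with the weight `w` on the labels of `qc, q₁, q₂`. -/
def wmass (w : Ctl → ℝ) (τ : Matrix (Cfg (DiffB B)) (Cfg (DiffB B)) ℂ) : ℝ≥0∞ :=
  ∑' p, ENNReal.ofReal (w p * rtr (blk τ p))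

theorem wmass_one {τ : Matrix (Cfg (DiffB B)) (Cfg (DiffB B)) ℂ} (hτ : τ.PosSemidef) :
    wmass (fun _ => 1) τ = trace τ := by
  simp [wmass, trace_eq_tsum_blk hτ]

theorem wmass_zero (w : Ctl → ℝ) :
    wmass w (0 : Matrix (Cfg (DiffB B)) (Cfg (DiffB B)) ℂ) = 0 := by
  simp [wmass, blk_zero, rtr_zero]

theorem wmass_add {w : Ctl → ℝ} (hw : ∀ p, 0 ≤ w p)
    {τ τ' : Matrix (Cfg (DiffB B)) (Cfg (DiffB B)) ℂ} (hτ : τ.PosSemidef) (hτ' : τ'.PosSemidef) :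
    wmass w (τ + τ') = wmass w τ + wmass w τ' := by
  rw [wmass, wmass, wmass, ← ENNReal.tsum_add]
  refine tsum_congr fun p => ?_
  rw [blk_add, rtr_add, mul_add, ENNReal.ofReal_add
    (mul_nonneg (hw p) (rtr_nonneg (blk_nonneg hτ p)))
    (mul_nonneg (hw p) (rtr_nonneg (blk_nonneg hτ' p)))]

theorem wmass_sum {α : Type*} {w : Ctl → ℝ} (hw : ∀ p, 0 ≤ w p) (F : Finset α)
    {τ : α → Matrix (Cfg (DiffB B)) (Cfg (DiffB B)) ℂ} (hτ : ∀ a ∈ F, (τ a).PosSemidef) :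
    wmass w (∑ a ∈ F, τ a) = ∑ a ∈ F, wmass w (τ a) := by
  classical
  induction F using Finset.induction_on with
  | empty => simp [wmass_zero]
  | insert a F ha ih =>
    rw [Finset.sum_insert ha, Finset.sum_insert ha, wmass_add hw (hτ a (Finset.mem_insert_self a F))
      (Matrix.posSemidef_sum F fun b hb => hτ b (Finset.mem_insert_of_mem hb)),
      ih fun b hb => hτ b (Finset.mem_insert_of_mem hb)]

theorem wmass_le_of_tendsto {w : Ctl → ℝ} {S : ℕ → Matrix (Cfg (DiffB B)) (Cfg (DiffB B)) ℂ}
    {A : Matrix (Cfg (DiffB B)) (Cfg (DiffB B)) ℂ} {c : ℝ≥0∞} (hS : ∀ n, wmass w (S n) ≤ c)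
    (h : ∀ i j, Tendsto (fun n => S n i j) atTop (𝓝 (A i j))) : wmass w A ≤ c := by
  rw [wmass, ENNReal.tsum_eq_iSup_sum]
  refine iSup_le fun F => le_of_tendsto' (x := atTop)
    (f := fun n => ∑ p ∈ F, ENNReal.ofReal (w p * rtr (blk (S n) p))) ?_
    fun n => (ENNReal.sum_le_tsum F).trans (hS n)
  exact tendsto_finsetSum _ fun p _ => (ENNReal.continuous_ofReal.tendsto _).comp
    ((rtr_tendsto (blk_tendsto h p)).const_mul _)

theorem wmass_le_of_blk_le {w : Ctl → ℝ} (hw : ∀ p, 0 ≤ w p)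
    {τ τ' : Matrix (Cfg (DiffB B)) (Cfg (DiffB B)) ℂ}
    (h : ∀ p, rtr (blk τ' p) ≤ rtr (blk τ p)) : wmass w τ' ≤ wmass w τ :=
  ENNReal.tsum_le_tsum fun p => ENNReal.ofReal_le_ofReal (mul_le_mul_of_nonneg_left (h p) (hw p))

theorem wmass_eq_tsum (w : Ctl → ℝ) (τ : Matrix (Cfg (DiffB B)) (Cfg (DiffB B)) ℂ) :
    wmass w τ = ∑' c : ℤ, ENNReal.ofReal (w (c, 0, 0) * rtr (blk τ (c, 0, 0))) +
      ∑' c : ℤ, (ENNReal.ofReal (w (c, 0, 1) * rtr (blk τ (c, 0, 1))) +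
        (ENNReal.ofReal (w (c, 1, 0) * rtr (blk τ (c, 1, 0))) +
          ENNReal.ofReal (w (c, 1, 1) * rtr (blk τ (c, 1, 1))))) := by
  rw [wmass, ENNReal.tsum_prod', ← ENNReal.tsum_add]
  refine tsum_congr fun c => ?_
  rw [tsum_fintype, Fintype.sum_prod_type, Fin.sum_univ_two, Fin.sum_univ_two, Fin.sum_univ_two,
    add_assoc]

/-- The weights whose mass does not grow in the counting gadget. -/
structure IsSuperharmonic (μ : ℕ → ℝ) (w : Ctl → ℝ) : Prop where
  nonneg : ∀ p, 0 ≤ w p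
  step : ∀ c, stay μ c * w (c, 0, 0) + (1 - stay μ c) * w (c, 0, 1) ≤ w (c - 1, 0, 0)
  flag : ∀ c, 1 / 2 * (w (c, 1, 0) + w (c, 1, 1)) ≤ w (c, 0, 1)

theorem isSuperharmonic_one (μ : ℕ → ℝ) : IsSuperharmonic μ fun _ => 1 :=
  ⟨fun _ => zero_le_one, fun c => by linarith, fun _ => by norm_num⟩

variable {μ : ℕ → ℝ} {w : Ctl → ℝ} {τ τ' : Matrix (Cfg (DiffB B)) (Cfg (DiffB B)) ℂ}

theorem IsSuperharmonic.wmass_le (hw : IsSuperharmonic μ w) (hμ : IsRate μ) (hτ : τ.PosSemidef)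
    (h0 : ∀ c, blk τ' (c, 0, 0) = (stay μ c : ℂ) • blk τ (c - 1, 0, 0))
    (h1 : ∀ c, blk τ' (c, 0, 1) = ((1 - stay μ c : ℝ) : ℂ) • blk τ (c - 1, 0, 0))
    (h2 : ∀ c y, rtr (blk τ' (c, 1, y)) = 1 / 2 * rtr (blk τ (c, 0, 1)) + rtr (blk τ (c, 1, y))) :
    wmass w τ' ≤ wmass w τ := by
  have hb : ∀ p, 0 ≤ rtr (blk τ p) := fun p => rtr_nonneg (blk_nonneg hτ p)
  have hs := hμ.stay_mem
  rw [wmass_eq_tsum, wmass_eq_tsum w τ, ENNReal.tsum_add, ← add_assoc, ← ENNReal.tsum_add]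
  refine add_le_add ?_ ?_
  · refine (ENNReal.tsum_le_tsum fun c => ?_).trans_eq ((Equiv.subRight (1 : ℤ)).tsum_eq
      fun c => ENNReal.ofReal (w (c, 0, 0) * rtr (blk τ (c, 0, 0))))
    rw [h0, h1, rtr_smul, rtr_smul, ← ENNReal.ofReal_add]
    · refine ENNReal.ofReal_le_ofReal ?_
      have := mul_le_mul_of_nonneg_right (hw.step c) (hb (c - 1, 0, 0))
      simp only [Equiv.subRight_apply]
      linarith
    · exact mul_nonneg (hw.nonneg _) (mul_nonneg (hs c).1 (hb _))
    · exact mul_nonneg (hw.nonneg _) (mul_nonneg (sub_nonneg.2 (hs c).2) (hb _))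
  · refine ENNReal.tsum_le_tsum fun c => ?_
    have e0 := mul_nonneg (hw.nonneg (c, 0, 1)) (hb (c, 0, 1))
    have e1 := mul_nonneg (hw.nonneg (c, 1, 0)) (hb (c, 1, 0))
    have e2 := mul_nonneg (hw.nonneg (c, 1, 1)) (hb (c, 1, 1))
    have e3 := mul_nonneg (hw.nonneg (c, 1, 0)) (hb (c, 0, 1))
    have e4 := mul_nonneg (hw.nonneg (c, 1, 1)) (hb (c, 0, 1))
    rw [h2, h2, ← ENNReal.ofReal_add, ← ENNReal.ofReal_add e1 e2,
      ← ENNReal.ofReal_add e0 (add_nonneg e1 e2)]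
    · refine ENNReal.ofReal_le_ofReal ?_
      have := mul_le_mul_of_nonneg_right (hw.flag c) (hb (c, 0, 1))
      linarith
    · linarith
    · linarith

end Weighted

/-! ### The transformed program on weighted masses -/

section Transform

variable {V : Type} {B : V → Type} [Fintype V] [DecidableEq V] [∀ v, Fintype (B v)]
  [∀ v, DecidableEq (B v)] [∀ v, Zero (B v)] {k : ℕ} {μ : ℕ → ℝ}

/-- `F` maps `τ` to a partial density operator and does not increase superharmonic masses. -/
def Contracts (μ : ℕ → ℝ) (F : Matrix (Cfg (DiffB B)) (Cfg (DiffB B)) ℂ →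
    Matrix (Cfg (DiffB B)) (Cfg (DiffB B)) ℂ) : Prop :=
  ∀ τ, IsPartialDensity τ → IsPartialDensity (F τ) ∧
    ∀ w, IsSuperharmonic μ w → wmass w (F τ) ≤ wmass w τ

/-- The constant weight 1 is superharmonic and its mass is the trace, so the bound on the trace
needs no separate proof. -/
theorem Contracts.of_wmass {F : Matrix (Cfg (DiffB B)) (Cfg (DiffB B)) ℂ →
    Matrix (Cfg (DiffB B)) (Cfg (DiffB B)) ℂ}
    (h : ∀ τ, IsPartialDensity τ → (F τ).PosSemidef ∧
      ∀ w, IsSuperharmonic μ w → wmass w (F τ) ≤ wmass w τ) : Contracts μ F := fun τ hτ => by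
  refine ⟨⟨(h τ hτ).1, ?_⟩, (h τ hτ).2⟩
  rw [← wmass_one (h τ hτ).1]
  refine ((h τ hτ).2 _ (isSuperharmonic_one μ)).trans ?_
  rw [wmass_one hτ.1]
  exact hτ.2

theorem Contracts.of_blk {F : Matrix (Cfg (DiffB B)) (Cfg (DiffB B)) ℂ →
    Matrix (Cfg (DiffB B)) (Cfg (DiffB B)) ℂ} {L : SuperOp (Cfg B)} (hL : IsTNI L)
    (hF : ∀ τ, IsPartialDensity τ → (F τ).PosSemidef)
    (h : ∀ τ p, blk (F τ) p = L (blk τ p)) : Contracts μ F :=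
  .of_wmass fun τ hτ => ⟨hF τ hτ, fun w hw => wmass_le_of_blk_le hw.nonneg fun p => by
    rw [h]
    exact hL.rtr_le _ (blk_nonneg hτ.1 p)⟩

theorem Contracts.comp {F G : Matrix (Cfg (DiffB B)) (Cfg (DiffB B)) ℂ →
    Matrix (Cfg (DiffB B)) (Cfg (DiffB B)) ℂ} (hF : Contracts μ F) (hG : Contracts μ G) :
    Contracts μ fun τ => F (G τ) := fun τ hτ =>
  ⟨(hF _ (hG τ hτ).1).1, fun w hw => ((hF _ (hG τ hτ).1).2 w hw).trans ((hG τ hτ).2 w hw)⟩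

theorem contracts_assign {I : Type} [Finite I] {q : I → V} (hq : Function.Injective q)
    {σ : RegOp B q} (hσ : IsDensity σ) :
    Contracts μ (assignReg (B := DiffB B) (origReg q) σ) :=
  .of_blk (isTNI_assignL hq hσ) (fun _ hτ => posSemidef_assignReg (B := DiffB B)
    (origReg_injective hq) hσ.1 hτ.1 hτ.trace_ne_top) (blk_assignReg_origReg hq σ)

theorem contracts_unitary {I : Type} [Finite I] {q : I → V} (hq : Function.Injective q)
    {U : RegOp B q} (hU : imul U.conjTranspose U = iid _) :
    Contracts μ (sandwich (lift (B := DiffB B) (origReg q) U)) :=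
  .of_blk (isTNI_sandwichL (imul_lift_of_isometry hq hU)) (fun _ hτ =>
    posSemidef_sandwich_origReg hq U hτ.1) (blk_sandwich_origReg hq U)

theorem contracts_gadget {I : Type} [Finite I] (hμ : IsRate μ) {q : I → V}
    (hq : Function.Injective q) {σ : RegOp B q} (hσ : IsDensity σ) (θ : Fin k → ℝ) :
    Contracts μ ((gadget μ q σ).sem θ) :=
  .of_wmass fun _ hτ => ⟨posSemidef_gadget hq hσ θ hτ, fun _ hw => hw.wmass_le hμ hτ.1
    (blk_gadget_zero hμ hq hσ θ hτ) (blk_gadget_one hμ hq hσ θ hτ)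
    (rtr_blk_gadget_flagged hq hσ θ hτ)⟩

theorem sum_wmass_sandwich_origReg {I : Type} [Finite I] {q : I → V} (hq : Function.Injective q)
    {m : ℕ} {M : Fin m → RegOp B q} (hM : IsMeasurement M) {w : Ctl → ℝ} (hw : ∀ p, 0 ≤ w p)
    {τ : Matrix (Cfg (DiffB B)) (Cfg (DiffB B)) ℂ} (hτ : τ.PosSemidef) :
    ∑ a, wmass w (sandwich (lift (B := DiffB B) (origReg q) (M a)) τ) = wmass w τ := by
  rw [← wmass_sum hw _ fun a _ => posSemidef_sandwich_origReg hq (M a) hτ]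
  refine tsum_congr fun p => ?_
  rw [blk_sum, rtr_sum]
  simp_rw [blk_sandwich_origReg hq]
  rw [← sum_rtr_sandwich (sum_imul_lift_of_isMeasurement hq hM) (blk τ p)]
  rfl

theorem sandwich_origReg_partialDensity {I : Type} [Finite I] {q : I → V}
    (hq : Function.Injective q) {m : ℕ} {M : Fin m → RegOp B q} (hM : IsMeasurement M)
    {τ : Matrix (Cfg (DiffB B)) (Cfg (DiffB B)) ℂ} (hτ : IsPartialDensity τ) (a : Fin m) :
    IsPartialDensity (sandwich (lift (B := DiffB B) (origReg q) (M a)) τ) := by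
  have h := posSemidef_sandwich_origReg hq (M a) hτ.1
  refine ⟨h, le_trans ?_ hτ.2⟩
  rw [← wmass_one h, ← wmass_one hτ.1,
    ← sum_wmass_sandwich_origReg hq hM (fun _ => zero_le_one) hτ.1]
  exact Finset.single_le_sum (f := fun a => wmass (fun _ => 1)
    (sandwich (lift (B := DiffB B) (origReg q) (M a)) τ)) (fun _ _ => zero_le) (Finset.mem_univ a)

theorem isLoop_origReg {I : Type} [Finite I] {q : I → V} (hq : Function.Injective q)
    {M : Fin 2 → RegOp B q} (hM : IsMeasurement M)
    {F : Matrix (Cfg (DiffB B)) (Cfg (DiffB B)) ℂ → Matrix (Cfg (DiffB B)) (Cfg (DiffB B)) ℂ}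
    (hF : Contracts μ F) :
    IsLoop F (sandwich (lift (B := DiffB B) (origReg q) (M 0)))
      (sandwich (lift (B := DiffB B) (origReg q) (M 1))) where
  body τ hτ := (hF τ hτ).1
  body_trace τ hτ := by
    rw [← wmass_one (hF τ hτ).1.1, ← wmass_one hτ.1]
    exact (hF τ hτ).2 _ (isSuperharmonic_one μ)
  exit _ := posSemidef_sandwich_origReg hq (M 0)
  enter _ := posSemidef_sandwich_origReg hq (M 1)
  guard_trace τ hτ := by
    rw [← wmass_one hτ, ← sum_wmass_sandwich_origReg hq hM (fun _ => zero_le_one) hτ,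
      Fin.sum_univ_two, wmass_one (posSemidef_sandwich_origReg hq _ hτ),
      wmass_one (posSemidef_sandwich_origReg hq _ hτ)]

theorem transform_rot_self (μ : ℕ → ℝ) {I : Type} (j : Fin k) (q : I → V) (σ : RegOp B q) :
    transform μ j (.rot j q σ) = .seq (gadget μ q σ) (.rot j (origReg q) σ) := if_pos rfl

theorem transform_rot_of_ne (μ : ℕ → ℝ) {I : Type} {j j' : Fin k} (h : j' ≠ j) (q : I → V)
    (σ : RegOp B q) : transform μ j (.rot j' q σ) = .rot j' (origReg q) σ := if_neg h

/-- Measurements of program variables preserve every weighted mass, other operations on them do not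
increase it, and the gadget does not increase it for superharmonic weights. A loop inherits this
round by round, and in the limit by testing finitely many labels. -/
theorem contracts_transform (hμ : IsRate μ) (θ : Fin k → ℝ) (j : Fin k) :
    ∀ P : Prog k B, P.WF → Contracts μ ((transform μ j P).sem θ)
  | .skip, _ => fun _ hτ => ⟨hτ, fun _ _ => le_rfl⟩
  | .init v, _ => fun τ hτ => by
    have h := contracts_assign (μ := μ) (unitReg_injective v) (isDensity_zeroState (B := B) v) τ hτ
    rwa [← initVar_inl] at h
  | .assign _ _, h => have := h.1; contracts_assign h.2.1 h.2.2
  | .unitary _ _, h => have := h.1; contracts_unitary h.2.1 h.2.2.1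
  | .rot j' q σ, h => by
    have := h.1
    have hr := contracts_unitary (μ := μ) h.2.1 (rot_isometry h.2.2.1 (θ j'))
    by_cases hj : j' = j
    · subst hj
      rw [transform_rot_self]
      exact hr.comp (contracts_gadget hμ h.2.1 h.2.2 θ)
    · rw [transform_rot_of_ne μ hj]
      exact hr
  | .seq P Q, h => (contracts_transform hμ θ j Q h.2).comp (contracts_transform hμ θ j P h.1)
  | .branch q m M P, h => by
    have := h.1
    refine .of_wmass fun τ hτ => ?_
    have hs := fun a => contracts_transform hμ θ j (P a) (h.2.2.2 a) _
      (sandwich_origReg_partialDensity h.2.1 h.2.2.1 hτ a)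
    refine ⟨Matrix.posSemidef_sum _ fun a _ => (hs a).1.1, fun w hw => ?_⟩
    refine (wmass_sum hw.nonneg _ fun a _ => (hs a).1.1).trans_le ?_
    rw [← sum_wmass_sandwich_origReg h.2.1 h.2.2.1 hw.nonneg hτ.1]
    exact Finset.sum_le_sum fun a _ => (hs a).2 w hw
  | .loop q M Q, h => by
    have := h.1
    have hQ := contracts_transform hμ θ j Q h.2.2.2
    have hl := isLoop_origReg h.2.1 h.2.2.1 hQ
    intro τ hτ
    refine ⟨(hl.loewnerSup_spec hτ).1, fun w hw => wmass_le_of_tendsto (fun n => ?_)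
      (hl.loewnerSup_spec hτ).2⟩
    refine le_self_add.trans (hl.functional_le (wmass_zero w) (fun _ _ => wmass_add hw.nonneg)
      (fun ρ hρ => ?_) (fun ρ hρ => (hQ ρ hρ).2 w hw) hτ (n + 1))
    rw [← sum_wmass_sandwich_origReg h.2.1 h.2.2.1 hw.nonneg hρ, Fin.sum_univ_two]

end Transform

end

end QWhile

namespace QWhile

noncomputable section

open Filter Topology

/-! ### The mass that keeps counting -/

section Counting

/-- The tail `1 - ∑_{1 ≤ l ≤ c} μ(l)`. -/
def rest (μ : ℕ → ℝ) (c : ℕ) : ℝ := 1 - ∑ l ∈ Finset.Ico 1 (c + 1), μ l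

theorem rest_zero (μ : ℕ → ℝ) : rest μ 0 = 1 := by simp [rest]

theorem rest_succ (μ : ℕ → ℝ) (c : ℕ) : rest μ (c + 1) = rest μ c - μ (c + 1) := by
  rw [rest, rest, Finset.sum_Ico_succ_top (by omega)]
  ring

/-- The distribution `μ` has positive weights and tails. -/
structure IsPositiveRate (μ : ℕ → ℝ) : Prop where
  pos : ∀ n, 1 ≤ n → 0 < μ n
  rest_pos : ∀ n, 0 < rest μ n

variable {μ : ℕ → ℝ}

/-- The tail beyond n contains the positive term μ(n+1), so no denominator of a `bCoeff` or of a
`hit` vanishes. -/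
theorem IsPositiveRate.of_hasSum (hμ : ∀ n, 1 ≤ n → 0 < μ n)
    (h : HasSum (fun n => μ (n + 1)) 1) : IsPositiveRate μ := by
  refine ⟨hμ, fun n => ?_⟩
  have h1 := sum_le_hasSum (Finset.range (n + 1)) (fun i _ => (hμ (i + 1) (by omega)).le) h
  rw [Finset.sum_range_succ] at h1
  have h2 := hμ (n + 1) (by omega)
  rw [rest, Finset.sum_Ico_eq_sum_range]
  simp_rw [add_comm 1]
  simp only [Nat.add_sub_cancel]
  linarith

theorem bCoeff_succ (μ : ℕ → ℝ) (c : ℕ) : bCoeff μ (c + 1) = μ (c + 1) / rest μ c := rfl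

theorem IsPositiveRate.one_sub_bCoeff (hμ : IsPositiveRate μ) (c : ℕ) :
    1 - bCoeff μ (c + 1) = rest μ (c + 1) / rest μ c := by
  have := (hμ.rest_pos c).ne'
  rw [bCoeff_succ, rest_succ]
  field_simp

theorem IsPositiveRate.isRate (hμ : IsPositiveRate μ) : IsRate μ := fun n hn => by
  obtain ⟨c, rfl⟩ : ∃ c, n = c + 1 := ⟨n - 1, by omega⟩
  have h := hμ.one_sub_bCoeff c
  have h1 := div_nonneg (hμ.rest_pos (c + 1)).le (hμ.rest_pos c).le
  refine ⟨?_, by linarith⟩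
  rw [bCoeff_succ]
  exact div_nonneg (hμ.pos _ hn).le (hμ.rest_pos c).le

theorem stay_natCast_succ (μ : ℕ → ℝ) (c : ℕ) : stay μ ((c : ℤ) + 1) = 1 - bCoeff μ (c + 1) :=
  if_pos (by omega)

/-- The probability of ending with `qc = n`, for the value `c` of `qc`. -/
def hit (μ : ℕ → ℝ) (n c : ℕ) : ℝ := if c < n then μ n / rest μ c else 0

theorem IsPositiveRate.hit_nonneg (hμ : IsPositiveRate μ) (n c : ℕ) : 0 ≤ hit μ n c := by
  rw [hit]
  split_ifs with h
  · exact div_nonneg (hμ.pos n (by omega)).le (hμ.rest_pos c).le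
  · exact le_rfl

/-- First-step analysis of the counter: from `c` it moves to `c + 1`, where it either goes on
counting or stops. At `c + 1 = n` only stopping contributes, since `hit` vanishes from `n` on. -/
theorem IsPositiveRate.hit_step (hμ : IsPositiveRate μ) (n c : ℕ) :
    stay μ ((c : ℤ) + 1) * hit μ n (c + 1) + (1 - stay μ ((c : ℤ) + 1)) *
      (if c + 1 = n then 1 else 0) = hit μ n c := by
  rw [stay_natCast_succ, hμ.one_sub_bCoeff, hit, hit]
  have h0 := (hμ.rest_pos c).ne'
  have h1 := (hμ.rest_pos (c + 1)).ne'
  rcases lt_trichotomy (c + 1) n with h | h | h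
  · rw [if_pos h, if_neg h.ne, if_pos (by omega)]
    field_simp
    ring
  · rw [if_neg (by omega), if_pos h, if_pos (by omega), rest_succ, ← h]
    field_simp
    ring
  · rw [if_neg (by omega), if_neg (by omega), if_neg (by omega)]
    ring

variable {V : Type} {B : V → Type} [Fintype V] [DecidableEq V] [∀ v, Fintype (B v)]
  [∀ v, DecidableEq (B v)]

/-- The part of `τ` with `0 ≤ qc ≤ s` that is still counting, weighted by the probability of
ending with `qc = n`. -/
def counting (μ : ℕ → ℝ) (n s : ℕ) (τ : Matrix (Cfg (DiffB B)) (Cfg (DiffB B)) ℂ) :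
    Matrix (Cfg B) (Cfg B) ℂ :=
  ∑ c ∈ Finset.range (s + 1), (hit μ n c : ℂ) • blk τ ((c : ℤ), 0, 0) +
    (if s = n then 1 else 0 : ℂ) • blk τ ((n : ℤ), 0, 1)

variable {n s s' : ℕ} {τ τ' : Matrix (Cfg (DiffB B)) (Cfg (DiffB B)) ℂ}

theorem counting_sum {α : Type*} (F : Finset α) (τ : α → Matrix (Cfg (DiffB B)) (Cfg (DiffB B)) ℂ) :
    counting μ n s (∑ a ∈ F, τ a) = ∑ a ∈ F, counting μ n s (τ a) := by
  simp_rw [counting, blk_sum, Finset.smul_sum]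
  rw [Finset.sum_add_distrib, Finset.sum_comm]

theorem counting_of_blk {L : SuperOp (Cfg B)} (h : ∀ p, blk τ' p = L (blk τ p)) :
    counting μ n s τ' = L (counting μ n s τ) := by
  simp_rw [counting, h, map_add, map_sum, map_smul]

theorem smul_nonneg_of_nonneg {ι : Type} {A : Matrix ι ι ℂ} (hA : 0 ≤ A) {c : ℝ} (hc : 0 ≤ c) :
    0 ≤ (c : ℂ) • A :=
  ((Matrix.nonneg_iff_posSemidef.1 hA).smul (Complex.zero_le_real.2 hc)).nonneg

theorem counting_nonneg (hμ : IsPositiveRate μ) (hτ : τ.PosSemidef) : 0 ≤ counting μ n s τ := by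
  refine add_nonneg (Finset.sum_nonneg fun c _ =>
    smul_nonneg_of_nonneg (blk_nonneg hτ _) (hμ.hit_nonneg n c)) ?_
  split_ifs
  · rw [one_smul]
    exact blk_nonneg hτ _
  · rw [zero_smul]

theorem counting_sub : counting μ n s (τ - τ') = counting μ n s τ - counting μ n s τ' := by
  simp_rw [counting, blk_sub, smul_sub, Finset.sum_sub_distrib]
  abel

theorem counting_mono (hμ : IsPositiveRate μ) (h : τ ≤ τ') :
    counting μ n s τ ≤ counting μ n s τ' := by
  rw [← sub_nonneg, ← counting_sub]
  exact counting_nonneg hμ (Matrix.le_iff.1 h)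

/-- Enlarging the range adds positive blocks. The condition `s' ≤ n` matters: the stopped block at
`n` is present exactly when the range ends at `n`, and going beyond would drop it. -/
theorem counting_le (hμ : IsPositiveRate μ) (hτ : τ.PosSemidef) (h : s ≤ s') (hn : s' ≤ n) :
    counting μ n s τ ≤ counting μ n s' τ := by
  rcases h.eq_or_lt with rfl | h
  · exact le_rfl
  rw [counting, counting, if_neg (by omega), zero_smul, add_zero]
  refine le_add_of_le_of_nonneg (Finset.sum_le_sum_of_subset_of_nonneg (Finset.range_subset_range.2
    (by omega)) fun c _ _ => smul_nonneg_of_nonneg (blk_nonneg hτ _) (hμ.hit_nonneg n c)) ?_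
  split_ifs
  · rw [one_smul]
    exact blk_nonneg hτ _
  · rw [zero_smul]

/-- By `hit_step` the weight of each counting block is exactly redistributed to the blocks that it
feeds. If `s + 1 = n`, the top block is received by the stopped block at `n`. Only the new block at
counter 0 is discarded. -/
theorem counting_step (hμ : IsPositiveRate μ) (hτ : τ.PosSemidef) (hs : s + 1 ≤ n)
    (h0 : ∀ c, blk τ' (c, 0, 0) = (stay μ c : ℂ) • blk τ (c - 1, 0, 0))
    (h1 : ∀ c, blk τ' (c, 0, 1) = ((1 - stay μ c : ℝ) : ℂ) • blk τ (c - 1, 0, 0)) :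
    counting μ n s τ ≤ counting μ n (s + 1) τ' := by
  have hb : ∀ c, blk τ' (((c + 1 : ℕ) : ℤ), 0, 0) =
      (stay μ ((c : ℤ) + 1) : ℂ) • blk τ ((c : ℤ), 0, 0) := fun c => by
    rw [h0, Nat.cast_succ, add_sub_cancel_right]
  have hs1 := hμ.isRate.stay_mem
  rw [counting, counting, if_neg (by omega), zero_smul, add_zero, Finset.sum_range_succ' _ (s + 1)]
  have hlast : 0 ≤ (hit μ n 0 : ℂ) • blk τ' (((0 : ℕ) : ℤ), 0, 0) := by
    rw [h0]
    exact smul_nonneg_of_nonneg (smul_nonneg_of_nonneg (blk_nonneg hτ _) (hs1 _).1)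
      (hμ.hit_nonneg n 0)
  rw [add_right_comm]
  refine le_add_of_le_of_nonneg (le_of_eq ?_) hlast
  simp_rw [hb, smul_smul]
  rw [Finset.sum_range_succ, Finset.sum_range_succ, add_assoc]
  congr 1
  · refine Finset.sum_congr rfl fun c hc => ?_
    have hc' := Finset.mem_range.1 hc
    have h := hμ.hit_step n c
    rw [if_neg (by omega), mul_zero, add_zero] at h
    rw [← h, mul_comm, Complex.ofReal_mul]
  · have h := hμ.hit_step n s
    rw [← h]
    split_ifs with hn
    · have h1' : blk τ' ((n : ℤ), 0, 1) =
          ((1 - stay μ ((s : ℤ) + 1) : ℝ) : ℂ) • blk τ ((s : ℤ), 0, 0) := by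
        rw [h1, ← hn, Nat.cast_succ, add_sub_cancel_right]
      rw [h1', one_smul, ← add_smul, ← Complex.ofReal_mul, ← Complex.ofReal_add]
      congr 2
      ring
    · rw [zero_smul, add_zero, mul_zero, add_zero, mul_comm, Complex.ofReal_mul]

/-! ### The truncated program bounds the counting part from below -/

variable [∀ v, Zero (B v)] {k : ℕ}

/-- With at most `K` iterations in each run of a loop, at most `K ^ loopCount * runningCount`
rotations occur, so a counter starting in the range of `s` stays in that of `s'` and no weighted
mass is lost. The inequality is one of operators, not of traces, so that it can be fed into the next
statement. -/
theorem tsem_counting_le (hμ : IsPositiveRate μ) (θ : Fin k → ℝ) (j : Fin k) {K : ℕ} (hK : 1 ≤ K) :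
    ∀ P : Prog k B, P.WF → ∀ {s s' : ℕ}, s + K ^ P.loopCount * P.runningCount j ≤ s' → s' ≤ n →
      ∀ {τ}, IsPartialDensity τ →
        tsem K θ P (counting μ n s τ) ≤ counting μ n s' ((transform μ j P).sem θ τ)
  | .skip, _, s, s', hs, hn, τ, hτ => counting_le hμ hτ.1 (by omega) hn
  | .init v, h, s, s', hs, hn, τ, hτ => by
    refine ((isTNI_tsem K θ _ h).mono (counting_le hμ hτ.1 (by omega) hn)).trans_eq ?_
    refine (counting_of_blk (L := initL v) fun p => ?_).symm
    exact (congrArg (blk · p) (initVar_inl v τ)).trans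
      (blk_assignReg_origReg (unitReg_injective v) _ τ p)
  | .assign q σ, h, s, s', hs, hn, τ, hτ => by
    have := h.1
    refine ((isTNI_tsem K θ _ h).mono (counting_le hμ hτ.1 (by omega) hn)).trans_eq ?_
    exact (counting_of_blk (L := assignL q σ) (blk_assignReg_origReg h.2.1 σ τ)).symm
  | .unitary q U, h, s, s', hs, hn, τ, hτ => by
    have := h.1
    refine ((isTNI_tsem K θ _ h).mono (counting_le hμ hτ.1 (by omega) hn)).trans_eq ?_
    exact (counting_of_blk (blk_sandwich_origReg h.2.1 U τ)).symm
  | .rot j' q σ, h, s, s', hs, hn, τ, hτ => by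
    have := h.1
    by_cases hj : j' = j
    · subst hj
      have hs' : s + 1 ≤ s' := by simpa [Prog.loopCount, Prog.runningCount] using hs
      have hg := (contracts_gadget hμ.isRate h.2.1 h.2.2 θ τ hτ).1
      rw [transform_rot_self]
      refine ((isTNI_tsem K θ _ h).mono ((counting_step hμ hτ.1 (hs'.trans hn)
        (blk_gadget_zero hμ.isRate h.2.1 h.2.2 θ hτ)
        (blk_gadget_one hμ.isRate h.2.1 h.2.2 θ hτ)).trans
          (counting_le hμ hg.1 hs' hn))).trans_eq ?_
      exact (counting_of_blk (blk_sandwich_origReg h.2.1 _ _)).symm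
    · rw [transform_rot_of_ne μ hj]
      refine ((isTNI_tsem K θ _ h).mono (counting_le hμ hτ.1 (by omega) hn)).trans_eq ?_
      exact (counting_of_blk (blk_sandwich_origReg h.2.1 _ τ)).symm
  | .seq P Q, h, s, s', hs, hn, τ, hτ => by
    have hP := (contracts_transform hμ.isRate θ j P h.1 τ hτ).1
    simp only [Prog.loopCount, Prog.runningCount] at hs
    have e1 : K ^ P.loopCount * P.runningCount j ≤
        K ^ (P.loopCount + Q.loopCount) * P.runningCount j :=
      Nat.mul_le_mul_right _ (Nat.pow_le_pow_right hK (Nat.le_add_right _ _))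
    have e2 : K ^ Q.loopCount * Q.runningCount j ≤
        K ^ (P.loopCount + Q.loopCount) * Q.runningCount j :=
      Nat.mul_le_mul_right _ (Nat.pow_le_pow_right hK (Nat.le_add_left _ _))
    rw [mul_add] at hs
    exact ((isTNI_tsem K θ Q h.2).mono (tsem_counting_le hμ θ j hK P h.1
      (s' := s + K ^ (P.loopCount + Q.loopCount) * P.runningCount j) (by omega) (by omega) hτ)).trans
      (tsem_counting_le hμ θ j hK Q h.2 (by omega) hn hP)
  | .branch q m M P, h, s, s', hs, hn, τ, hτ => by
    have := h.1
    simp only [Prog.loopCount, Prog.runningCount] at hs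
    have he : (transform μ j (.branch q m M P)).sem θ τ = ∑ a, (transform μ j (P a)).sem θ
      (sandwich (lift (B := DiffB B) (origReg q) (M a)) τ) := rfl
    rw [he, tsem, LinearMap.sum_apply, counting_sum]
    refine Finset.sum_le_sum fun a _ => ?_
    have ha : counting μ n s (sandwich (lift (B := DiffB B) (origReg q) (M a)) τ) =
        sandwichL (lift q (M a)) (counting μ n s τ) :=
      counting_of_blk (blk_sandwich_origReg h.2.1 (M a) τ)
    rw [Module.End.mul_apply, ← ha]
    refine tsem_counting_le hμ θ j hK (P a) (h.2.2.2 a) (le_trans (Nat.add_le_add_left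
      (Nat.mul_le_mul (Nat.pow_le_pow_right hK ?_) ?_) s) hs) hn
      (sandwich_origReg_partialDensity h.2.1 h.2.2.1 hτ a)
    · exact Finset.single_le_sum (f := fun a => (P a).loopCount) (fun _ _ => Nat.zero_le _)
        (Finset.mem_univ a)
    · exact Finset.le_sup (f := fun a => (P a).runningCount j) (Finset.mem_univ a)
  | .loop q M Q, h, s, s', hs, hn, τ, hτ => by
    have := h.1
    simp only [Prog.loopCount, Prog.runningCount, pow_succ] at hs
    have hQ := contracts_transform hμ.isRate θ j Q h.2.2.2
    have hl := isLoop_origReg h.2.1 h.2.2.1 hQ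
    have hE := isTNIPair_sandwichL (sum_imul_lift_of_isMeasurement h.2.1 h.2.2.1)
    have hM : ∀ a s τ, counting μ n s (sandwich (lift (B := DiffB B) (origReg q) (M a)) τ) =
        sandwichL (lift q (M a)) (counting μ n s τ) := fun a s τ =>
      counting_of_blk (blk_sandwich_origReg h.2.1 (M a) τ)
    set r := K ^ Q.loopCount * Q.runningCount j with hr
    have hKr : s + K * r ≤ s' := by
      refine le_trans (le_of_eq ?_) hs
      rw [hr]
      ring
    -- Each iteration advances the counter by at most `r`. The induction stops at `K`, where the
    -- allowance `s + K * r ≤ s'` is used up.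
    have hit : ∀ l, l ≤ K → ((tsem K θ Q * sandwichL (lift q (M 1))) ^ l) (counting μ n s τ) ≤
        counting μ n (s + l * r) ((fun τ' => (transform μ j Q).sem θ
          (sandwich (lift (B := DiffB B) (origReg q) (M 1)) τ'))^[l] τ) := by
      intro l
      induction l with
      | zero => intro _; simp
      | succ l ih =>
        intro hlK
        have hi := hl.iterate_partialDensity hτ l
        have hlr : (l + 1) * r ≤ K * r := Nat.mul_le_mul_right r hlK
        rw [pow_succ', Module.End.mul_apply, Function.iterate_succ_apply', Module.End.mul_apply]
        refine ((isTNI_tsem K θ Q h.2.2.2).mono (hE.right.mono (ih (by omega)))).trans ?_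
        rw [← hM]
        exact tsem_counting_le hμ θ j hK Q h.2.2.2 (by rw [add_mul]; omega) (by omega)
          (hl.enter_partialDensity hi)
    rw [tsem]
    -- The truncated loop has `K + 1` exits but at most `K` executions of the body; it is compared
    -- with as many rounds of the transformed loop, and later exits only help.
    refine le_trans ?_ (counting_mono hμ (hl.sum_le_loewnerSup hτ (K + 1)))
    rw [loopL_apply, counting_sum]
    refine Finset.sum_le_sum fun l hlK => ?_
    have hlK' : l ≤ K := Nat.lt_succ_iff.1 (Finset.mem_range.1 hlK)
    rw [hM]
    refine hE.left.mono ((hit l hlK').trans (counting_le hμ (hl.iterate_partialDensity hτ l).1 ?_ hn))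
    have := Nat.mul_le_mul_right r hlK'
    omega

end Counting

end

end QWhile

namespace QWhile

noncomputable section

open Filter Topology

/-! ### The initial state -/

section Initial

variable {V : Type} {B : V → Type}

/-- The label of the fresh variables in a configuration. -/
def ancPart (u : Cfg (DiffB B)) : Cfg (AncB B) := fun a => u (.inr a)

theorem withAnc_apply (ρ : Matrix (Cfg B) (Cfg B) ℂ) (ρ₀ : Matrix (Cfg (AncB B)) (Cfg (AncB B)) ℂ)
    (u u' : Cfg (DiffB B)) : withAnc ρ ρ₀ u u' =
      ρ (progPart u) (progPart u') * ρ₀ (ancPart u) (ancPart u') := rfl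

theorem posSemidef_withAnc {ρ : Matrix (Cfg B) (Cfg B) ℂ}
    {ρ₀ : Matrix (Cfg (AncB B)) (Cfg (AncB B)) ℂ} (hρ : ρ.PosSemidef) (hρ₀ : ρ₀.PosSemidef) :
    (withAnc ρ ρ₀).PosSemidef :=
  (hρ.submatrix progPart).hadamard (hρ₀.submatrix ancPart)

theorem ancPart_update [DecidableEq (V ⊕ Anc V)] [DecidableEq (Anc V)] (u : Cfg (DiffB B))
    (a : Anc V) (n : AncB B a) :
    ancPart (Function.update (β := DiffB B) u (.inr a) n) = Function.update (ancPart u) a n := by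
  funext b
  by_cases h : b = a
  · subst h
    rw [Function.update_self]
    exact Function.update_self (β := DiffB B) (.inr b) n u
  · rw [Function.update_of_ne h]
    exact Function.update_of_ne (β := DiffB B) (fun h' => h (Sum.inr_injective h')) n u

theorem progPart_update [DecidableEq (V ⊕ Anc V)] (u : Cfg (DiffB B)) (a : Anc V) (n : AncB B a) :
    progPart (Function.update (β := DiffB B) u (.inr a) n) = progPart u := by
  funext v
  exact Function.update_of_ne (β := DiffB B) Sum.inl_ne_inr n u

theorem ancPart_mk (s s' r : Cfg B) (p : Ctl) : ancPart (mk s r p) = ancPart (mk s' r p) := by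
  funext a
  cases a <;> rfl

variable [∀ v, Zero (B v)]

theorem initVar_withAnc (a : Anc V) (ρ : Matrix (Cfg B) (Cfg B) ℂ)
    (ρ₀ : Matrix (Cfg (AncB B)) (Cfg (AncB B)) ℂ) :
    initVar (.inr a) (withAnc ρ ρ₀) = withAnc ρ (initVar a ρ₀) := by
  classical
  funext u u'
  rw [withAnc_apply, initVar, initVar, mul_ite, mul_zero, ← tsum_mul_left]
  refine if_congr Iff.rfl (tsum_congr fun n => ?_) rfl
  refine (withAnc_apply ρ ρ₀ _ _).trans ?_
  let d (W : Type) : DecidableEq W := fun a b => Classical.propDecidable (a = b)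
  exact congrArg₂ (· * ·)
    (congrArg₂ ρ (@progPart_update V B (d _) u a n) (@progPart_update V B (d _) u' a n))
    (congrArg₂ ρ₀ (@ancPart_update V B (d _) (d _) u a n) (@ancPart_update V B (d _) (d _) u' a n))

/-- `ρ` is supported on the labels with the value `0` at `w`. -/
def VanishesOff {W : Type} {A : W → Type} [∀ w, Zero (A w)] (w : W)
    (ρ : Matrix (Cfg A) (Cfg A) ℂ) : Prop :=
  ∀ s t, s w ≠ 0 ∨ t w ≠ 0 → ρ s t = 0

theorem vanishesOff_initVar {W : Type} {A : W → Type} [∀ w, Zero (A w)] (w : W)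
    (ρ : Matrix (Cfg A) (Cfg A) ℂ) : VanishesOff w (initVar w ρ) := fun _ _ h =>
  if_neg (not_and_or.2 h)

theorem VanishesOff.initVar {W : Type} {A : W → Type} [∀ w, Zero (A w)] {w w' : W} (hw : w ≠ w')
    {ρ : Matrix (Cfg A) (Cfg A) ℂ} (h : VanishesOff w ρ) : VanishesOff w (initVar w' ρ) := by
  classical
  intro s t hst
  by_cases h0 : s w' = 0 ∧ t w' = 0
  swap
  · exact if_neg h0
  refine (if_pos h0).trans ((tsum_congr fun n => h _ _ ?_).trans tsum_zero)
  rwa [Function.update_of_ne hw, Function.update_of_ne hw]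

/-- The state of the fresh variables after their initialization. -/
def initAnc (ρ₀ : Matrix (Cfg (AncB B)) (Cfg (AncB B)) ℂ) :
    Matrix (Cfg (AncB B)) (Cfg (AncB B)) ℂ :=
  initVar .qc (initVar .q2 (initVar .q1 ρ₀))

theorem initAnc_partialDensity {ρ₀ : Matrix (Cfg (AncB B)) (Cfg (AncB B)) ℂ}
    (h : IsPartialDensity ρ₀) : IsPartialDensity (initAnc ρ₀) := by
  have step : ∀ (a : Anc V) (ρ : Matrix (Cfg (AncB B)) (Cfg (AncB B)) ℂ), IsPartialDensity ρ →
      IsPartialDensity (initVar a ρ) := fun a ρ hρ =>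
    ⟨posSemidef_initVar a hρ.1 hρ.trace_ne_top,
      (trace_initVar a hρ.1 hρ.trace_ne_top).trans_le hρ.2⟩
  exact step _ _ (step _ _ (step _ _ h))

theorem initAnc_apply_of_ne (ρ₀ : Matrix (Cfg (AncB B)) (Cfg (AncB B)) ℂ) (u u' : Cfg (DiffB B))
    (h : ctl u ≠ 0 ∨ ctl u' ≠ 0) : initAnc ρ₀ (ancPart u) (ancPart u') = 0 := by
  have h1 : VanishesOff .q1 (initAnc ρ₀) :=
    ((vanishesOff_initVar _ _).initVar (by simp)).initVar (by simp)
  have h2 : VanishesOff .q2 (initAnc ρ₀) := (vanishesOff_initVar _ _).initVar (by simp)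
  have h3 : VanishesOff .qc (initAnc ρ₀) := vanishesOff_initVar _ _
  by_contra h0
  have hu : ∀ a, a = .qc ∨ a = .q1 ∨ a = .q2 → ancPart u a = 0 ∧ ancPart u' a = 0 := by
    rintro a (rfl | rfl | rfl) <;> by_contra hne <;> rw [not_and_or] at hne
    exacts [h0 (h3 _ _ hne), h0 (h1 _ _ hne), h0 (h2 _ _ hne)]
  have e3 := hu .qc (by simp)
  have e1 := hu .q1 (by simp)
  have e2 := hu .q2 (by simp)
  exact h.elim (fun h => h (Prod.ext e3.1 (Prod.ext e1.1 e2.1)))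
    fun h => h (Prod.ext e3.2 (Prod.ext e1.2 e2.2))

variable [Fintype V] [DecidableEq V] [∀ v, Fintype (B v)] [∀ v, DecidableEq (B v)]

/-- The state before the first counting step. -/
def initState (ρ : Matrix (Cfg B) (Cfg B) ℂ) (ρ₀ : Matrix (Cfg (AncB B)) (Cfg (AncB B)) ℂ) :
    Matrix (Cfg (DiffB B)) (Cfg (DiffB B)) ℂ := withAnc ρ (initAnc ρ₀)

/-- The mass of the initialized fresh variables. -/
def ancMass (ρ₀ : Matrix (Cfg (AncB B)) (Cfg (AncB B)) ℂ) : ℝ :=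
  ∑ r : Cfg B, (initAnc ρ₀ (ancPart (mk r r 0)) (ancPart (mk r r 0))).re

variable {ρ : Matrix (Cfg B) (Cfg B) ℂ} {ρ₀ : Matrix (Cfg (AncB B)) (Cfg (AncB B)) ℂ}

theorem ancMass_mem (hρ₀ : IsPartialDensity ρ₀) : 0 ≤ ancMass ρ₀ ∧ ancMass ρ₀ ≤ 1 := by
  have h := initAnc_partialDensity hρ₀
  refine ⟨Finset.sum_nonneg fun r _ => h.1.re_diag_nonneg _, ?_⟩
  rw [← ENNReal.ofReal_le_one, ancMass, ENNReal.ofReal_sum_of_nonneg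
    fun r _ => h.1.re_diag_nonneg _, ← tsum_fintype (L := .unconditional _)]
  refine (ENNReal.tsum_comp_le_tsum_of_injective
    (f := fun r : Cfg B => ancPart (mk r r 0)) (fun r r' hr => ?_)
    fun a => ENNReal.ofReal (initAnc ρ₀ a a).re).trans h.2
  funext v
  exact congrFun hr (.copy v)

theorem blk_initState_zero (hρ₀ : IsPartialDensity ρ₀) :
    blk (initState ρ ρ₀) 0 = (ancMass ρ₀ : ℂ) • ρ := by
  have h := (initAnc_partialDensity hρ₀).1
  ext s t
  rw [blk_apply, Matrix.smul_apply, smul_eq_mul, ancMass, Complex.ofReal_sum, Finset.sum_mul]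
  refine Finset.sum_congr rfl fun r _ => ?_
  rw [initState, withAnc_apply, mul_comm]
  refine congrArg (· * ρ s t) ?_
  rw [ancPart_mk s r, ancPart_mk t r]
  exact h.diag_eq (ancPart (mk r r 0))

theorem blk_initState_of_ne {p : Ctl} (hp : p ≠ 0) : blk (initState ρ ρ₀) p = 0 := by
  ext s t
  rw [blk_apply]
  refine Finset.sum_eq_zero fun r _ => ?_
  rw [initState, withAnc_apply, initAnc_apply_of_ne ρ₀ (mk s r p) (mk t r p) (.inl hp), mul_zero]

theorem wmass_initState (hρ₀ : IsPartialDensity ρ₀) (w : Ctl → ℝ) :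
    wmass w (initState ρ ρ₀) = ENNReal.ofReal (w 0 * (ancMass ρ₀ * rtr ρ)) := by
  rw [wmass, tsum_eq_single 0, blk_initState_zero hρ₀, rtr_smul]
  intro p hp
  rw [blk_initState_of_ne hp, rtr_zero, mul_zero, ENNReal.ofReal_zero]

theorem initState_partialDensity (hρ : IsPartialDensity ρ) (hρ₀ : IsPartialDensity ρ₀) :
    IsPartialDensity (initState ρ ρ₀) := by
  have h : (initState ρ ρ₀).PosSemidef :=
    posSemidef_withAnc hρ.1 (initAnc_partialDensity hρ₀).1
  refine ⟨h, ?_⟩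
  have hm := ancMass_mem hρ₀
  rw [isPartialDensity_iff] at hρ
  rw [← wmass_one h]
  refine (wmass_initState hρ₀ _).trans_le (ENNReal.ofReal_le_one.2 ?_)
  rw [one_mul]
  exact mul_le_one₀ hm.2 (rtr_nonneg hρ.1) hρ.2

/-- The initialized state always gives the outcome 00, so the opening `C` and `GP` can be read as a
first counting branch of the gadget and the same block formulas apply. -/
theorem sandwich_opM_initState : sandwich (lift regQ1Q2 (opM B 0)) (initState ρ ρ₀) =
    initState ρ ρ₀ := by
  ext u u'
  rw [sandwich_opM]
  by_cases h : ctl u ≠ 0 ∨ ctl u' ≠ 0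
  · rw [initState, withAnc_apply, initAnc_apply_of_ne _ _ _ h, mul_zero, mul_zero, zero_mul]
  · push Not at h
    rw [h.1, h.2]
    simp [outcome]

variable {k : ℕ} {μ : ℕ → ℝ}

theorem diffProg_sem (μ : ℕ → ℝ) (j : Fin k) (θ : Fin k → ℝ) (P : Prog k B) :
    (diffProg μ j P).sem θ (withAnc ρ ρ₀) =
      (transform μ j P).sem θ ((stepProg μ).sem θ (initState ρ ρ₀)) := by
  rw [initState, initAnc, ← initVar_withAnc, ← initVar_withAnc, ← initVar_withAnc]
  rfl

/-! ### Superharmonic weights for the final label and the two bounds on the flagged mass -/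

/-- The weight of the event of ending with `qc = n`. -/
def hitWeight (μ : ℕ → ℝ) (n : ℕ) (p : Ctl) : ℝ :=
  if p.2.1 = 0 ∧ p.2.2 = 0 then if p.1 < 0 then μ n else hit μ n p.1.toNat
  else if p.1 = n then 1 else 0

/-- For counters up to 0 nothing stops and the weight is constantly μ(n), the value of `hit` at 0.
For positive counters the step condition is the identity `hit_step`. Flagging keeps the counter,
hence also the weight. -/
theorem isSuperharmonic_hitWeight (hμ : IsPositiveRate μ) {n : ℕ} (hn : 1 ≤ n) :
    IsSuperharmonic μ (hitWeight μ n) := by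
  refine ⟨fun p => ?_, fun c => ?_, fun c => ?_⟩
  · rw [hitWeight]
    split_ifs
    exacts [(hμ.pos n hn).le, hμ.hit_nonneg _ _, zero_le_one, le_rfl]
  · have h0 : hitWeight μ n (c, 0, 0) = if c < 0 then μ n else hit μ n c.toNat := if_pos (by simp)
    have h0' : hitWeight μ n (c - 1, 0, 0) = if c - 1 < 0 then μ n else hit μ n (c - 1).toNat :=
      if_pos (by simp)
    have h1 : hitWeight μ n (c, 0, 1) = if c = n then 1 else 0 := if_neg (by simp)
    rw [h0, h0', h1]
    rcases lt_trichotomy c 0 with hc | rfl | hc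
    · have hs : stay μ c = 1 := if_neg (by omega)
      rw [if_pos hc, if_pos (show c - 1 < 0 by omega), hs]
      simp
    · have hs : stay μ 0 = 1 := if_neg (by omega)
      have hh : hit μ n 0 = μ n := by rw [hit, if_pos (by omega), rest_zero, div_one]
      rw [hs]
      simp [hh]
    · obtain ⟨m, rfl⟩ : ∃ m : ℕ, c = m + 1 := ⟨(c - 1).toNat, by omega⟩
      have hm : (m : ℤ) + 1 = n ↔ m + 1 = n := by omega
      have hm' : ((m : ℤ) + 1).toNat = m + 1 := by omega
      rw [if_neg (show ¬((m : ℤ) + 1 < 0) by omega), if_neg (show ¬((m : ℤ) + 1 - 1 < 0) by omega),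
        add_sub_cancel_right, Int.toNat_natCast, ← hμ.hit_step n m, hm']
      simp only [hm, le_refl]
  · have h : ∀ p : Ctl, ¬(p.2.1 = 0 ∧ p.2.2 = 0) → hitWeight μ n p = if p.1 = n then 1 else 0 :=
      fun p hp => if_neg hp
    rw [h _ (by simp), h _ (by simp), h _ (by simp)]
    split_ifs <;> norm_num

/-- The mass of the part of `τ` with `qc = n` that is flagged. -/
def flagged (n : ℕ) (τ : Matrix (Cfg (DiffB B)) (Cfg (DiffB B)) ℂ) : ℝ≥0∞ :=
  ENNReal.ofReal (rtr (blk τ ((n : ℤ), 1, 0))) + ENNReal.ofReal (rtr (blk τ ((n : ℤ), 1, 1)))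

/-- The two terms live on disjoint sets of labels, on which `hitWeight` agrees with their own
weights. Thus mass shown to be still counting or just stopped is not available for flagging. -/
theorem flagged_add_counting_le (hμ : IsPositiveRate μ) {n : ℕ}
    {τ : Matrix (Cfg (DiffB B)) (Cfg (DiffB B)) ℂ} (hτ : τ.PosSemidef) :
    flagged n τ + ENNReal.ofReal (rtr (counting μ n n τ)) ≤ wmass (hitWeight μ n) τ := by
  have hb : ∀ p, 0 ≤ rtr (blk τ p) := fun p => rtr_nonneg (blk_nonneg hτ p)
  have h : ∀ x y, ¬(x = 0 ∧ y = 0) → hitWeight μ n ((n : ℤ), x, y) = 1 := fun x y hp =>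
    (if_neg hp).trans (if_pos rfl)
  have h' : ∀ c : ℕ, hitWeight μ n ((c : ℤ), 0, 0) = hit μ n c := fun c =>
    (if_pos (by simp)).trans (if_neg (by simp))
  have e1 : ∑ c ∈ Finset.range (n + 1), ENNReal.ofReal (hit μ n c * rtr (blk τ ((c : ℤ), 0, 0))) ≤
      ∑' c : ℤ, ENNReal.ofReal (hitWeight μ n (c, 0, 0) * rtr (blk τ (c, 0, 0))) := by
    simp_rw [← h']
    exact (ENNReal.sum_le_tsum _).trans (ENNReal.tsum_comp_le_tsum_of_injective
      Nat.cast_injective fun c : ℤ =>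
        ENNReal.ofReal (hitWeight μ n (c, 0, 0) * rtr (blk τ (c, 0, 0))))
  rw [wmass_eq_tsum]
  refine le_trans (le_of_eq ?_) (add_le_add e1 (ENNReal.le_tsum (n : ℤ)))
  rw [h 0 1 (by simp), h 1 0 (by simp), h 1 1 (by simp), one_mul, one_mul, one_mul, counting,
    if_pos rfl, one_smul, rtr_add, rtr_sum, ENNReal.ofReal_add _ (hb _), ENNReal.ofReal_sum_of_nonneg,
    flagged]
  · simp_rw [rtr_smul]
    ring
  · intro c _
    rw [rtr_smul]
    exact mul_nonneg (hμ.hit_nonneg n c) (hb _)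
  · refine Finset.sum_nonneg fun c _ => ?_
    rw [rtr_smul]
    exact mul_nonneg (hμ.hit_nonneg n c) (hb _)

/-- The final state of the differential program. -/
theorem diffProg_spec (hμ : IsPositiveRate μ) (θ : Fin k → ℝ) (j : Fin k) {P : Prog k B}
    (hP : P.WF) (hρ : IsPartialDensity ρ) (hρ₀ : IsPartialDensity ρ₀) :
    ((diffProg μ j P).sem θ (withAnc ρ ρ₀)).PosSemidef ∧
      ∀ n, 1 ≤ n → flagged n ((diffProg μ j P).sem θ (withAnc ρ ρ₀)) ≤
          ENNReal.ofReal (μ n * rtr ρ) ∧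
        ∀ K, 1 ≤ K → K ^ P.loopCount * P.runningCount j < n →
          flagged n ((diffProg μ j P).sem θ (withAnc ρ ρ₀)) ≤
            ENNReal.ofReal (μ n * (rtr ρ - rtr (tsem K θ P ρ))) := by
  have hm := ancMass_mem hρ₀
  have h0 := initState_partialDensity hρ hρ₀
  have b0 := blk_stepProg_zero hμ.isRate θ (initState ρ ρ₀)
  have b1 := blk_stepProg_one hμ.isRate θ (initState ρ ρ₀)
  have b2 := blk_stepProg_flagged μ θ (initState ρ ρ₀)
  have p1 := posSemidef_stepProg μ θ h0.1
  rw [sandwich_opM_initState] at b0 b1 b2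
  rw [diffProg_sem]
  set τ₁ := (stepProg μ).sem θ (initState ρ ρ₀) with hτ₁
  have hstep : ∀ w, IsSuperharmonic μ w → wmass w τ₁ ≤ wmass w (initState ρ ρ₀) := fun w hw =>
    hw.wmass_le hμ.isRate h0.1 b0 b1 fun c y => by
      rw [b2, blk_initState_of_ne (by simp), blk_initState_of_ne (by simp), rtr_zero]
      simp
  have h1 : IsPartialDensity τ₁ := by
    refine ⟨p1, ?_⟩
    rw [← wmass_one p1]
    refine (hstep _ (isSuperharmonic_one μ)).trans ?_
    rw [wmass_one h0.1]
    exact h0.2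
  have hf := contracts_transform hμ.isRate θ j P hP τ₁ h1
  refine ⟨hf.1.1, fun n hn => ?_⟩
  have hw := isSuperharmonic_hitWeight hμ hn
  have hroot : hitWeight μ n 0 = μ n := by
    refine (if_pos (by simp)).trans ((if_neg (by simp)).trans ?_)
    refine (if_pos (show 0 < n by omega)).trans ?_
    rw [show (0 : Ctl).1.toNat = 0 from rfl, rest_zero, div_one]
  -- Superharmonicity of the weight along the whole program: the flagged and the counting masses
  -- together are at most the initial mass, μ(n) times the trace of the initial state.
  have key := (flagged_add_counting_le hμ (n := n) hf.1.1).trans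
    ((hf.2 _ hw).trans (hstep _ hw))
  rw [wmass_initState hρ₀, hroot] at key
  have hr := rtr_nonneg hρ.nonneg
  have hμn := (hμ.pos n hn).le
  refine ⟨(le_self_add.trans key).trans (ENNReal.ofReal_le_ofReal
    (mul_le_mul_of_nonneg_left (mul_le_of_le_one_left hr hm.2) hμn)), fun K hK hKn => ?_⟩
  have hc0 : counting μ n 0 (initState ρ ρ₀) = ((μ n * ancMass ρ₀ : ℝ) : ℂ) • ρ := by
    rw [counting, if_neg (by omega), zero_smul, add_zero, Finset.sum_range_one,
      show (((0 : ℕ) : ℤ), (0 : Fin 2), (0 : Fin 2)) = (0 : Ctl) from rfl,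
      blk_initState_zero hρ₀, smul_smul, hit, if_pos (by omega), rest_zero, div_one,
      ← Complex.ofReal_mul]
  -- The opening step already raises the counter to 1. The condition for the truncation is therefore
  -- 1 + K^a R ≤ n, which is the strict inequality assumed.
  have hc1 := counting_step hμ h0.1 (n := n) (s := 0) (by omega) b0 b1
  have hc := ((isTNI_tsem K θ P hP).mono hc1).trans
    (tsem_counting_le hμ θ j hK P hP (s' := n) (by omega) le_rfl h1)
  rw [hc0, map_smul] at hc
  have hc' := rtr_mono hc
  rw [rtr_smul] at hc'
  have hT := (isTNI_tsem K θ P hP).rtr_le ρ hρ.nonneg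
  have hT0 := rtr_nonneg ((isTNI_tsem K θ P hP).nonneg ρ hρ.nonneg)
  refine (ENNReal.le_sub_of_add_le_right ENNReal.ofReal_ne_top key).trans ?_
  rw [← ENNReal.ofReal_sub _ (le_trans (mul_nonneg (mul_nonneg hμn hm.1) hT0) hc')]
  refine ENNReal.ofReal_le_ofReal ?_
  -- Both masses carry the factor `ancMass ρ₀`, at most 1, which can be dropped because the
  -- truncated trace does not exceed tr ρ.
  have h2 : μ n * (ancMass ρ₀ * rtr ρ) - μ n * ancMass ρ₀ * rtr (tsem K θ P ρ) =
      μ n * (ancMass ρ₀ * (rtr ρ - rtr (tsem K θ P ρ))) := by ring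
  have h3 := mul_le_mul_of_nonneg_left (mul_le_of_le_one_left (sub_nonneg.2 hT) hm.2) hμn
  linarith

end Initial

end

end QWhile

namespace QWhile

noncomputable section

open Filter Topology

/-! ### The fourth moment and the flagged masses -/

section Bound

variable {ι : Type} [Fintype ι] [DecidableEq ι]

/-- Conjugating by the square root: A² = √A · A · √A ≤ M A ≤ M² I. Squaring is not monotone in
general, but here the upper bound is a scalar. -/
theorem mul_self_le_of_le_smul_one {A : Matrix ι ι ℂ} (hA : 0 ≤ A) {M : ℝ} (hM : 0 ≤ M)
    (h : A ≤ (M : ℂ) • (1 : Matrix ι ι ℂ)) : A * A ≤ ((M ^ 2 : ℝ) : ℂ) • (1 : Matrix ι ι ℂ) := by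
  obtain ⟨S, hs, hSS⟩ : ∃ S : Matrix ι ι ℂ, IsSelfAdjoint S ∧ S * S = A :=
    ⟨CFC.sqrt A, .of_nonneg (CFC.sqrt_nonneg A), CFC.sqrt_mul_sqrt_self A hA⟩
  have h1 := hs.conjugate_le_conjugate h
  rw [mul_smul_comm, mul_one, smul_mul_assoc, hSS] at h1
  have h2 : S * A * S = A * A := by
    rw [← hSS]
    simp only [mul_assoc]
  rw [h2] at h1
  refine h1.trans ?_
  have h3 := smul_nonneg_of_nonneg (sub_nonneg.2 h) hM
  rwa [smul_sub, smul_smul, ← Complex.ofReal_mul, ← pow_two, sub_nonneg] at h3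

/-- By cyclicity tr(XD) = tr(√X D √X), the trace of a positive operator. -/
theorem rtr_mul_nonneg {X D : Matrix ι ι ℂ} (hX : 0 ≤ X) (hD : 0 ≤ D) : 0 ≤ rtr (X * D) := by
  have hs : IsSelfAdjoint (CFC.sqrt X) := .of_nonneg (CFC.sqrt_nonneg X)
  have h := rtr_nonneg (hs.conjugate_nonneg hD)
  rwa [rtr, Matrix.trace_mul_comm, ← mul_assoc, CFC.sqrt_mul_sqrt_self X hX] at h

theorem rtr_sandwich_le {O : Matrix ι ι ℂ} (hO : O.IsHermitian) {c : ℝ}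
    (h : O * O ≤ (c : ℂ) • (1 : Matrix ι ι ℂ)) {X : Matrix ι ι ℂ} (hX : 0 ≤ X) :
    rtr (sandwich O X) ≤ c * rtr X := by
  have h1 := rtr_mul_nonneg hX (sub_nonneg.2 h)
  rw [mul_sub, rtr_sub, mul_smul_comm, mul_one, rtr_smul, ← mul_assoc] at h1
  rw [sandwich_eq_mul, hO.eq, rtr, mul_assoc, Matrix.trace_mul_comm]
  exact sub_nonneg.1 h1

theorem rtr_sandwich_sq_le {O : Matrix ι ι ℂ} (hO : O.IsHermitian) {c : ℝ} (hc : 0 ≤ c)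
    (h : O * O ≤ (c : ℂ) • (1 : Matrix ι ι ℂ)) {X : Matrix ι ι ℂ} (hX : 0 ≤ X) :
    rtr (sandwich (ipow O 2) X) ≤ c ^ 2 * rtr X := by
  have h1 : sandwich (ipow O 2) X = sandwich O (sandwich O X) := by
    simp only [ipow_eq_pow, sandwich_eq_mul, pow_two, Matrix.conjTranspose_mul, mul_assoc]
  rw [h1, pow_two, mul_assoc]
  exact (rtr_sandwich_le hO h (sandwich_nonneg O hX)).trans
    (mul_le_mul_of_nonneg_left (rtr_sandwich_le hO h hX) hc)

/-- The top of the spectrum bounds |O| by M I, and |O|² = O² as `O` is Hermitian. -/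
theorem isGreatest_eigenvalue_abs {O : Matrix ι ι ℂ} (hO : O.IsHermitian) {M : ℝ}
    (hM : IsGreatest
      {x : ℝ | Module.End.HasEigenvalue (Matrix.toLin' (CFC.abs O)) (x : ℂ)} M) :
    0 ≤ M ∧ O * O ≤ ((M ^ 2 : ℝ) : ℂ) • (1 : Matrix ι ι ℂ) := by
  have hspec : ∀ x : ℝ, Module.End.HasEigenvalue (Matrix.toLin' (CFC.abs O)) (x : ℂ) ↔
      x ∈ spectrum ℝ (CFC.abs O) := fun x => by
    rw [Module.End.hasEigenvalue_iff_mem_spectrum, Matrix.spectrum_toLin']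
    exact spectrum.algebraMap_mem_iff ℂ (R := ℝ) (a := CFC.abs O) (r := x)
  have h0 := CFC.abs_nonneg O
  have hM0 : 0 ≤ M := spectrum_nonneg_of_nonneg h0 ((hspec M).1 hM.1)
  refine ⟨hM0, ?_⟩
  have h1 : CFC.abs O ≤ (M : ℂ) • (1 : Matrix ι ι ℂ) :=
    le_smul_one (Matrix.nonneg_iff_posSemidef.1 h0).1 fun x hx => hM.2 ((hspec x).2 hx)
  have h2 := CFC.abs_mul_abs O
  rw [Matrix.star_eq_conjTranspose, hO.eq] at h2
  rw [← h2]
  exact mul_self_le_of_le_smul_one h0 hM0 h1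

end Bound

section Observable

/-- The eigenvalues of `O_d`. -/
def obsEig (μ : ℕ → ℝ) (p : Ctl) : ℝ :=
  if 1 ≤ p.1 ∧ p.2.1 = 1 then 2 / μ p.1.toNat * (if p.2.2 = 0 then 1 else -1) else 0

theorem obsD_eq (μ : ℕ → ℝ) : obsD μ = Matrix.diagonal fun p => (obsEig μ p : ℂ) := by
  rw [obsD]
  congr 1
  funext p
  rw [obsEig]
  split_ifs <;> simp

theorem imul_diagonal {ι : Type} [DecidableEq ι] (d : ι → ℂ) (A : Matrix ι ι ℂ) (i j : ι) :
    imul (Matrix.diagonal d) A i j = d i * A i j := by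
  rw [imul, tsum_eq_single i, Matrix.diagonal_apply_eq]
  intro b hb
  rw [Matrix.diagonal_apply_ne' _ hb, zero_mul]

theorem ipow_obsD (μ : ℕ → ℝ) (p p' : Ctl) :
    ipow (obsD μ) 2 p p' = if p = p' then ((obsEig μ p ^ 2 : ℝ) : ℂ) else 0 := by
  rw [obsD_eq, ipow, imul_diagonal, ipow, imul_diagonal, ipow, iid]
  split_ifs
  · push_cast
    ring
  · simp

theorem obsEig_pow_four (μ : ℕ → ℝ) (p : Ctl) :
    obsEig μ p ^ 4 = if 1 ≤ p.1 ∧ p.2.1 = 1 then 16 / μ p.1.toNat ^ 4 else 0 := by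
  rw [obsEig]
  split_ifs <;> ring

variable {V : Type} {B : V → Type}

theorem tensorObs_apply (D : Matrix Ctl Ctl ℂ) (A : Matrix (Cfg B) (Cfg B) ℂ)
    (u u' : Cfg (DiffB B)) : tensorObs D A u u' =
      D (ctl u) (ctl u') * iid (Cfg B) (copyPart u) (copyPart u') *
        A (progPart u) (progPart u') := rfl

theorem rowSupport_tensorObs (μ : ℕ → ℝ) (A : Matrix (Cfg B) (Cfg B) ℂ) :
    RowSupport (tensorObs (ipow (obsD μ) 2) A) fun u k => mk k (copyPart u) (ctl u) where
  inj u k k' h := (congrArg progPart h :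
    progPart (mk k (copyPart u) (ctl u)) = progPart (mk k' (copyPart u) (ctl u)))
  mem u u' h := by
    classical
    rw [tensorObs_apply, ipow_obsD] at h
    have h1 := left_ne_zero_of_mul h
    have h2 := (ite_ne_right_iff.1 (left_ne_zero_of_mul h1)).1
    have h3 := right_ne_zero_of_mul h1
    rw [iid] at h3
    exact ⟨progPart u', (mk_ext rfl (ite_ne_right_iff.1 h3).1.symm h2.symm).symm⟩

variable [Fintype V] [DecidableEq V] [∀ v, Fintype (B v)] [∀ v, DecidableEq (B v)]

/-- The observable is diagonal in the control labels and trivial on the copies, so it involves no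
coherences between labels and the diagonal blocks determine the moment. -/
theorem blk_sandwich_tensorObs (μ : ℕ → ℝ) (A : Matrix (Cfg B) (Cfg B) ℂ)
    (τ : Matrix (Cfg (DiffB B)) (Cfg (DiffB B)) ℂ) (p : Ctl) :
    blk (sandwich (tensorObs (ipow (obsD μ) 2) A) τ) p =
      ((obsEig μ p ^ 4 : ℝ) : ℂ) • sandwich A (blk τ p) := by
  have hval : ∀ s k r : Cfg B, tensorObs (ipow (obsD μ) 2) A (mk s r p) (mk k r p) =
      ((obsEig μ p ^ 2 : ℝ) : ℂ) * A s k := fun s k r => by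
    rw [tensorObs_apply, ipow_obsD]
    have h1 : iid (Cfg B) (copyPart (mk s r p)) (copyPart (mk k r p)) = 1 := if_pos rfl
    have h2 : (if ctl (mk s r p) = ctl (mk k r p) then ((obsEig μ (ctl (mk s r p)) ^ 2 : ℝ) : ℂ)
      else 0) = ((obsEig μ p ^ 2 : ℝ) : ℂ) := if_pos rfl
    rw [h1, h2, mul_one]
    rfl
  ext s t
  rw [blk_apply, Matrix.smul_apply, (rowSupport_univ A).sandwich_apply]
  have h : ∀ r : Cfg B, sandwich (tensorObs (ipow (obsD μ) 2) A) τ (mk s r p) (mk t r p) =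
      ∑ k, ∑ k', ((obsEig μ p ^ 2 : ℝ) : ℂ) * A s k * τ (mk k r p) (mk k' r p) *
        star (((obsEig μ p ^ 2 : ℝ) : ℂ) * A t k') := fun r => by
    refine ((rowSupport_tensorObs μ A).sandwich_apply τ _ _).trans ?_
    refine Finset.sum_congr rfl fun k _ => Finset.sum_congr rfl fun k' _ => ?_
    exact congrArg₂ (fun x y => x * τ (mk k r p) (mk k' r p) * star y) (hval s k r) (hval t k' r)
  simp_rw [h, blk_apply]
  rw [Finset.sum_comm, smul_eq_mul, Finset.mul_sum]
  refine Finset.sum_congr rfl fun k _ => ?_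
  rw [Finset.sum_comm, Finset.mul_sum]
  refine Finset.sum_congr rfl fun k' _ => ?_
  rw [Finset.mul_sum, Finset.sum_mul, Finset.mul_sum]
  refine Finset.sum_congr rfl fun r _ => ?_
  simp only [star_mul, Complex.star_def, Complex.conj_ofReal]
  push_cast
  ring

theorem expectSq_le {O : Matrix (Cfg B) (Cfg B) ℂ} (hO : O.IsHermitian) {M : ℝ}
    (hM : O * O ≤ ((M ^ 2 : ℝ) : ℂ) • (1 : Matrix (Cfg B) (Cfg B) ℂ)) (μ : ℕ → ℝ)
    {τ : Matrix (Cfg (DiffB B)) (Cfg (DiffB B)) ℂ} (hτ : τ.PosSemidef) :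
    expectSq (tensorObs (ipow (obsD μ) 2) (ipow O 2)) τ ≤
      ENNReal.ofReal (M ^ 4) * ∑' n : ℕ, ENNReal.ofReal (16 / μ (n + 1) ^ 4) * flagged (n + 1) τ := by
  have h1 : expectSq (tensorObs (ipow (obsD μ) 2) (ipow O 2)) τ ≤
      ENNReal.ofReal (M ^ 4) * wmass (fun p => obsEig μ p ^ 4) τ := by
    rw [expectSq, trace_eq_tsum_blk ((rowSupport_tensorObs μ _).posSemidef_sandwich hτ), wmass,
      ← ENNReal.tsum_mul_left]
    refine ENNReal.tsum_le_tsum fun p => ?_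
    rw [← ENNReal.ofReal_mul (by positivity), blk_sandwich_tensorObs, rtr_smul]
    refine ENNReal.ofReal_le_ofReal ?_
    have := rtr_sandwich_sq_le hO (sq_nonneg M) hM (blk_nonneg hτ p)
    have h2 := mul_le_mul_of_nonneg_left this (by positivity : 0 ≤ obsEig μ p ^ 4)
    calc _ ≤ _ := h2
      _ = _ := by ring
  refine h1.trans_eq (congrArg _ ?_)
  have hinj : Function.Injective fun n : ℕ => (n : ℤ) + 1 := fun m n h => by
    have : (m : ℤ) + 1 = n + 1 := h
    omega
  rw [wmass_eq_tsum]
  simp_rw [obsEig_pow_four]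
  simp only [zero_ne_one, and_false, if_false, zero_mul, ENNReal.ofReal_zero, tsum_zero, zero_add,
    and_true]
  rw [← hinj.tsum_eq]
  · refine tsum_congr fun n => ?_
    have e : ((n : ℤ) + 1).toNat = n + 1 := by omega
    rw [if_pos (by omega), e, flagged, mul_add, ENNReal.ofReal_mul (by positivity),
      ENNReal.ofReal_mul (by positivity)]
    norm_cast
  · intro c hc
    by_contra hne
    refine hc ?_
    have : ¬1 ≤ c := fun h => hne ⟨(c - 1).toNat, by simp only; omega⟩
    simp [this]

end Observable

/-! ### Summation -/

section Summation

theorem tsum_ite_inv_cube {μ : ℕ → ℝ} (hμ : ∀ n, 1 ≤ n → 0 < μ n) (L : ℕ) :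
    ∑' n : ℕ, (if n + 1 ≤ L then ENNReal.ofReal (16 / μ (n + 1) ^ 3) else 0) =
      ENNReal.ofReal (16 * sumInvCube μ L) := by
  rw [tsum_eq_sum (s := Finset.range L) fun n hn => if_neg (by simpa using hn), sumInvCube,
    Finset.mul_sum, ENNReal.ofReal_sum_of_nonneg]
  · have e : Finset.Icc 1 L = Finset.Ico 1 (L + 1) := by
      ext
      simp
    rw [e, Finset.sum_Ico_eq_sum_range, Nat.add_sub_cancel]
    refine Finset.sum_congr rfl fun n hn => ?_
    rw [if_pos (by simpa using hn), add_comm 1 n, mul_one_div]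
  · intro j hj
    have := hμ j (Finset.mem_Icc.1 hj).1
    positivity

theorem sumInvCube_mono {μ : ℕ → ℝ} (hμ : ∀ n, 1 ≤ n → 0 < μ n) : Monotone (sumInvCube μ) := by
  intro m n hmn
  refine Finset.sum_le_sum_of_subset_of_nonneg (Finset.Icc_subset_Icc_right hmn) fun j hj _ => ?_
  have := hμ j (Finset.mem_Icc.1 hj).1
  positivity

theorem sumInvCube_nonneg {μ : ℕ → ℝ} (hμ : ∀ n, 1 ≤ n → 0 < μ n) (n : ℕ) :
    0 ≤ sumInvCube μ n :=
  (sumInvCube_mono hμ (Nat.zero_le n)).trans' (by simp [sumInvCube])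

variable {T : ℕ → ℝ} {t : ℝ}

/-- Telescoping: the left side is the sum of the increments from `i₀` on. The predicate is the
device by which sums over `n` and over truncations are exchanged. -/
theorem ofReal_sub_le_tsum (hT : Monotone T) (ht : Tendsto T atTop (𝓝 t)) (i₀ : ℕ) {p : ℕ → Prop}
    [DecidablePred p] (hp : ∀ i, i₀ ≤ i → p i) :
    ENNReal.ofReal (t - T (i₀ + 1)) ≤
      ∑' i, if p i then ENNReal.ofReal (T (i + 2) - T (i + 1)) else 0 := by
  have h1 : Tendsto (fun L => ENNReal.ofReal (T (L + (i₀ + 1)) - T (i₀ + 1))) atTop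
      (𝓝 (ENNReal.ofReal (t - T (i₀ + 1)))) :=
    (ENNReal.continuous_ofReal.tendsto _).comp
      (((tendsto_add_atTop_iff_nat (i₀ + 1)).2 ht).sub_const _)
  refine le_of_tendsto' h1 fun L => ?_
  have h2 : ENNReal.ofReal (T (L + (i₀ + 1)) - T (i₀ + 1)) = ∑ l ∈ Finset.range L,
      if p (l + i₀) then ENNReal.ofReal (T (l + i₀ + 2) - T (l + i₀ + 1)) else 0 := by
    have h3 := Finset.sum_range_sub (fun l => T (l + (i₀ + 1))) L
    rw [zero_add] at h3
    rw [← h3, ENNReal.ofReal_sum_of_nonneg fun l _ => sub_nonneg.2 (hT (by omega))]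
    refine Finset.sum_congr rfl fun l _ => ?_
    rw [if_pos (hp _ (by omega))]
    congr 3
    ring
  rw [h2]
  exact (ENNReal.sum_le_tsum _).trans (ENNReal.tsum_comp_le_tsum_of_injective
    (add_left_injective i₀) fun i => if p i then ENNReal.ofReal (T (i + 2) - T (i + 1)) else 0)

/-- For n ≤ R only the trivial bound is available and gives S'(R). For larger n, write t - T_K as a
sum of increments with the largest admissible K; the increment from i + 1 to i + 2 is then charged
by those n with R < n ≤ (i+2)^a R. Dropping R < n after exchanging sums gives S'((i+2)^a R). -/
theorem tsum_flagged_le {μ : ℕ → ℝ} (hμ : ∀ n, 1 ≤ n → 0 < μ n) (hT : Monotone T)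
    (ht : Tendsto T atTop (𝓝 t)) (ht1 : t ≤ 1) {F : ℕ → ℝ≥0∞} {a R : ℕ}
    (hF : ∀ n, 1 ≤ n → F n ≤ ENNReal.ofReal (μ n * t))
    (hF' : ∀ n, 1 ≤ n → ∀ K, 1 ≤ K → K ^ a * R < n → F n ≤ ENNReal.ofReal (μ n * (t - T K))) :
    ∑' n, ENNReal.ofReal (16 / μ (n + 1) ^ 4) * F (n + 1) ≤
      ENNReal.ofReal (16 * sumInvCube μ R) +
        ∑' i, ENNReal.ofReal (16 * sumInvCube μ ((i + 2) ^ a * R)) *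
          ENNReal.ofReal (T (i + 2) - T (i + 1)) := by
  have hdiv : ∀ n, ENNReal.ofReal (16 / μ (n + 1) ^ 4) * ENNReal.ofReal (μ (n + 1)) =
      ENNReal.ofReal (16 / μ (n + 1) ^ 3) := fun n => by
    have := hμ (n + 1) (by omega)
    rw [← ENNReal.ofReal_mul (by positivity)]
    congr 1
    field_simp
  have hterm : ∀ n, ENNReal.ofReal (16 / μ (n + 1) ^ 4) * F (n + 1) ≤
      (if n + 1 ≤ R then ENNReal.ofReal (16 / μ (n + 1) ^ 3) else 0) +
        ∑' i, (if n + 1 ≤ (i + 2) ^ a * R then ENNReal.ofReal (16 / μ (n + 1) ^ 3) else 0) *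
          ENNReal.ofReal (T (i + 2) - T (i + 1)) := by
    intro n
    have hμn := hμ (n + 1) (by omega)
    by_cases hR : n + 1 ≤ R
    · rw [if_pos hR, ← hdiv]
      refine le_add_right (mul_le_mul_right ((hF _ (by omega)).trans ?_) _)
      exact ENNReal.ofReal_le_ofReal (mul_le_of_le_one_right hμn.le ht1)
    · rw [if_neg hR, zero_add]
      have hsum : F (n + 1) ≤ ENNReal.ofReal (μ (n + 1)) * ∑' i, if n + 1 ≤ (i + 2) ^ a * R then
          ENNReal.ofReal (T (i + 2) - T (i + 1)) else 0 := by
        by_cases hex : ∃ i, n + 1 ≤ (i + 2) ^ a * R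
        · classical
          -- Minimality of the first index `i` with n + 1 ≤ (i+2)^a R makes K = i + 1 admissible;
          -- for i = 0 admissibility is the assumption that n + 1 exceeds `R`.
          have hlt : (Nat.find hex + 1) ^ a * R < n + 1 := by
            rcases hi : Nat.find hex with _ | i
            · simpa using hR
            · exact not_le.1 (Nat.find_min hex (by omega : i < Nat.find hex))
          refine (hF' _ (by omega) _ (by omega) hlt).trans ?_
          rw [ENNReal.ofReal_mul hμn.le]
          refine mul_le_mul_right (ofReal_sub_le_tsum hT ht _ fun i hi => ?_) _
          exact (Nat.find_spec hex).trans
            (Nat.mul_le_mul_right _ (Nat.pow_le_pow_left (by omega) a))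
        -- Here every truncation is admissible, as happens when there are no loops or no rotations.
        -- Letting K tend to infinity, the flagged mass is zero.
        · push Not at hex
          have hlim : Tendsto (fun K => ENNReal.ofReal (μ (n + 1) * (t - T (K + 2)))) atTop
              (𝓝 (ENNReal.ofReal (μ (n + 1) * (t - t)))) :=
            (ENNReal.continuous_ofReal.tendsto _).comp
              ((((tendsto_add_atTop_iff_nat 2).2 ht).const_sub t).const_mul _)
          refine (ge_of_tendsto' hlim fun K => hF' _ (by omega) _ (by omega) (hex K)).trans ?_
          simp
      refine (mul_le_mul_right hsum _).trans_eq ?_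
      rw [← mul_assoc, hdiv, ← ENNReal.tsum_mul_left]
      refine tsum_congr fun i => ?_
      split_ifs <;> simp
  refine (ENNReal.tsum_le_tsum hterm).trans_eq ?_
  rw [ENNReal.tsum_add, tsum_ite_inv_cube hμ, ENNReal.tsum_comm]
  simp_rw [ENNReal.tsum_mul_right, tsum_ite_inv_cube hμ]

/-- The stated bound has slack: ε^(m-1) ≥ ε^m, so 4(2ε^m + 2ε^(m-1)) ≥ 16 ε^m, with m = (i+1)/N, and
ε^((i+2)/N) is smaller still. -/
theorem sumInvCube_mul_le {μ : ℕ → ℝ} (hμ : ∀ n, 1 ≤ n → 0 < μ n) {ε : ℝ} (hε₀ : 0 < ε)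
    (hε₁ : ε < 1) (ht1 : t ≤ 1) (a R N i : ℕ) {d : ℝ}
    (hd : d ≤ loopCoeff (i + 1) a * ε ^ ((i + 2) / N) * t) :
    16 * sumInvCube μ ((i + 2) ^ a * R) * d ≤
      4 * (loopCoeff (i + 1) a * sumInvCube μ ((i + 3) ^ a * R - 1) *
        (2 * ε ^ ((i + 1) / N) + 2 * ε ^ ((((i + 1) / N : ℕ) : ℤ) - 1))) := by
  have hS := sumInvCube_nonneg hμ
  have hc := loopCoeff_nonneg (i + 1) a
  have hε : ε ^ ((i + 2) / N) ≤ ε ^ ((i + 1) / N) :=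
    pow_le_pow_of_le_one hε₀.le hε₁.le (Nat.div_le_div_right (by omega))
  have hε' : ε ^ ((i + 1) / N) ≤ ε ^ ((((i + 1) / N : ℕ) : ℤ) - 1) := by
    rw [← zpow_natCast]
    exact zpow_le_zpow_right_of_le_one₀ hε₀ hε₁.le (by omega)
  have hp : 0 < ε ^ ((i + 1) / N) := by positivity
  have hd' : d ≤ loopCoeff (i + 1) a * ε ^ ((i + 1) / N) := by
    refine hd.trans ((mul_le_of_le_one_right ?_ ht1).trans (mul_le_mul_of_nonneg_left hε hc))
    positivity
  have hSS : sumInvCube μ ((i + 2) ^ a * R) * loopCoeff (i + 1) a ≤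
      sumInvCube μ ((i + 3) ^ a * R - 1) * loopCoeff (i + 1) a := by
    -- (i+2)^a R ≤ (i+3)^a R - 1 needs strict growth, hence positive `a` and `R`. If a = 0 the
    -- coefficient vanishes, and if R = 0 both sums are empty by truncated subtraction.
    rcases a.eq_zero_or_pos with rfl | ha
    · simp [loopCoeff]
    rcases R.eq_zero_or_pos with rfl | hR
    · simp
    refine mul_le_mul_of_nonneg_right (sumInvCube_mono hμ ?_) hc
    have := (Nat.mul_lt_mul_right hR).2 (Nat.pow_lt_pow_left (show i + 2 < i + 3 by omega) ha.ne')
    omega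
  calc 16 * sumInvCube μ ((i + 2) ^ a * R) * d
      ≤ 16 * sumInvCube μ ((i + 2) ^ a * R) * (loopCoeff (i + 1) a * ε ^ ((i + 1) / N)) :=
        mul_le_mul_of_nonneg_left hd' (mul_nonneg (by norm_num) (hS _))
    _ = sumInvCube μ ((i + 2) ^ a * R) * loopCoeff (i + 1) a * (16 * ε ^ ((i + 1) / N)) := by ring
    _ ≤ sumInvCube μ ((i + 3) ^ a * R - 1) * loopCoeff (i + 1) a *
        (4 * (2 * ε ^ ((i + 1) / N) + 2 * ε ^ ((((i + 1) / N : ℕ) : ℤ) - 1))) :=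
        mul_le_mul hSS (by linarith) (by positivity) (mul_nonneg (hS _) hc)
    _ = _ := by ring

theorem tsum_le_momentBound {μ : ℕ → ℝ} (hμ : ∀ n, 1 ≤ n → 0 < μ n) {ε : ℝ} (hε₀ : 0 < ε)
    (hε₁ : ε < 1) (ht1 : t ≤ 1) (M : ℝ) (a R N : ℕ)
    (hd : ∀ i, T (i + 1) - T i ≤ loopCoeff i a * ε ^ ((i + 1) / N) * t) :
    ENNReal.ofReal (M ^ 4) * (ENNReal.ofReal (16 * sumInvCube μ R) +
        ∑' i, ENNReal.ofReal (16 * sumInvCube μ ((i + 2) ^ a * R)) *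
          ENNReal.ofReal (T (i + 2) - T (i + 1))) ≤ momentBound μ ε N M R a := by
  have h4 : ENNReal.ofReal (4 * M ^ 4) = ENNReal.ofReal (M ^ 4) * ENNReal.ofReal 4 := by
    rw [← ENNReal.ofReal_mul (by positivity), mul_comm]
  rw [momentBound, h4, mul_assoc, mul_add (ENNReal.ofReal 4), ← ENNReal.ofReal_mul (by norm_num),
    ← mul_assoc, ← ENNReal.tsum_mul_left]
  refine mul_le_mul_right (add_le_add (le_of_eq (by norm_num)) ?_) _
  -- The increment from i + 1 to i + 2 is matched with the term k = i + 2 of the bound; the term k =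
  -- 1 is not needed.
  refine le_trans (ENNReal.tsum_le_tsum fun i => ?_) (ENNReal.tsum_comp_le_tsum_of_injective
    (add_left_injective 1) _)
  simp only
  rw [← ENNReal.ofReal_mul (mul_nonneg (by norm_num) (sumInvCube_nonneg hμ _)),
    ← ENNReal.ofReal_mul (by norm_num)]
  refine ENNReal.ofReal_le_ofReal ?_
  rw [← loopCoeff_eq, show i + 1 + 1 - 1 = i + 1 by omega, show i + 1 + 1 + 1 = i + 3 by omega]
  exact sumInvCube_mul_le hμ hε₀ hε₁ ht1 a R N i (hd (i + 1))

end Summation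

end

end QWhile

/-! ### The main theorem -/

theorem theoremB5 {V : Type} [Fintype V] [DecidableEq V] {B : V → Type} [∀ v, Fintype (B v)]
    [∀ v, DecidableEq (B v)] [∀ v, Zero (B v)] {k : ℕ}
    (P : Prog k B) (hP : P.WF) (θ : Fin k → ℝ) (j : Fin k)
    (hterm : P.AllLoopsTerminate θ)
    (ρ : Matrix (Cfg B) (Cfg B) ℂ) (hρ : IsPartialDensity ρ)
    (ρ₀ : Matrix (Cfg (AncB B)) (Cfg (AncB B)) ℂ) (hρ₀ : IsPartialDensity ρ₀)
    (O : Matrix (Cfg B) (Cfg B) ℂ) (hO : O.IsHermitian)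
    (M : ℝ) (hM : IsGreatest
      {x : ℝ | Module.End.HasEigenvalue (Matrix.toLin' (CFC.abs O)) (x : ℂ)} M)
    (μ : ℕ → ℝ) (hμpos : ∀ n, 1 ≤ n → 0 < μ n) (hμsum : HasSum (fun n => μ (n + 1)) 1)
    (hμrate : Filter.Tendsto (fun n : ℕ => μ n ^ (1 / (n : ℝ))) Filter.atTop (nhds 1))
    (ε : ℝ) (hε₀ : 0 < ε) (hε₁ : ε < 1) :
    (∃ N : ℕ, 0 < N ∧ P.AllLoopsDecay θ ε N) ∧
      ∀ N : ℕ, 0 < N → P.AllLoopsDecay θ ε N →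
        fourthMoment μ j θ P O ρ ρ₀ ≤
          momentBound μ ε N M (P.runningCount j) P.loopCount := by
  refine ⟨exists_allLoopsDecay hε₀ hε₁ P hP hterm, fun N _ hN => ?_⟩
  have hμ := IsPositiveRate.of_hasSum hμpos hμsum
  have hf := diffProg_spec hμ θ j hP hρ hρ₀
  have hO' := isGreatest_eigenvalue_abs hO hM
  have ht1 : rtr ρ ≤ 1 := (isPartialDensity_iff.1 hρ).2
  have hT : Monotone fun n => rtr (tsem n θ P ρ) :=
    monotone_nat_of_le_succ fun n => rtr_mono (tsem_le_succ n θ P hP ρ hρ.nonneg)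
  refine (expectSq_le hO hO'.2 μ hf.1).trans (le_trans (mul_le_mul_right ?_ _)
    (tsum_le_momentBound (T := fun n => rtr (tsem n θ P ρ)) hμpos hε₀ hε₁ ht1 M P.loopCount
      (P.runningCount j) N fun i => rtr_tsem_succ_sub_le θ hε₀ N i P hP hN ρ hρ))
  exact tsum_flagged_le hμpos hT (tendsto_rtr_tsem θ hP hterm hρ) ht1
    (fun n hn => (hf.2 n hn).1) fun n hn => (hf.2 n hn).2
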